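/- Let $\mathbb T=\mathbb R/2\pi\mathbb Z$, let $H$ be the Hilbert transform, $\widehat{Hu}(n)=-i\,\mathrm{sgn}(n)\hat u(n)$, and let $H^s$ be the Sobolev space of real valued functions (distributions if $s<0$) of zero mean value on $\mathbb T$, with $\|u\|_{H^s}^2=\sum_n(1+n^2)^s|\hat u(n)|^2$. Let $\pi_N$ be the Dirichlet projector on the frequencies $|n|\le N$. *Energies.* Put $P_-=\frac12(1-iH)$. For a trigonometric polynomial $v$ let $w(v)=\sum_{n\ge1}w_n(v)\varepsilon^n$ be the formal power series solution of $$-\varepsilon\, i\,P_-\partial_x w+(1-e^{-w})=\varepsilon v .$$ For $k\ge0$ let $E_{k/2}(u)=8\int_{\mathbb T}w_{k+2}(u/2)\,dx$ (real part, the integral being real for real valued $u$). These are the conservation laws of the Benjamin–Ono equation $\partial_tu+H\partial_x^2u+u\partial_xu=0$, normalized so that the quadratic part of $E_{k/2}(u)$ is $\|u\|_{\dot H^{k/2}}^2=\int_{\mathbb T}\big||D|^{k/2}u\big|^2dx$. *Truncated flow.* $\Phi_t^N(u_0)$ denotes the solution $u_N\in C(\mathbb R;H^s)$ of $$\partial_tu_N+H\partial_x^2u_N+\pi_N\big((\pi_Nu_N)\partial_x(\pi_Nu_N)\big)=0,\qquad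 u_N(0)=u_0 .$$ *Measure.* $\mu_{m+1}$ is the law on $H^s$, $s<m+\frac12$, of the random series $\sum_{n\ne0}\frac{\varphi_n(\omega)}{|n|^{m+1}}e^{inx}$, where $\varphi_n=c(h_n+il_n)$ and $\varphi_{-n}=\overline{\varphi_n}$ for $n>0$, with $h_n,l_n$ ($n>0$) independent standard real gaussians and $c$ a real constant. **Proposition 3.1.** Let $m\ge2$, $1\le q<\infty$, $c\in\mathbb R$ and $s<m+\frac12$. Then the truncated problem has, for every $N\ge 0$ and $u_0\in H^s$, exactly one solution; $\mu_{m+1}$ is a probability measure on $H^s$; the functions $$G_N(u)=\frac{d}{dt}E_{m+1}(\pi_N\Phi_t^N(u))\Big|_{t=0},\quad H_N(u)=\frac{d}{dt}E_{m+1/2}(\pi_N\Phi_t^N(u))\Big|_{t=0},\quad L_N^{j}(u)=\frac{d}{dt}E_{j/2}(\pi_N\Phi_t^N(u))\Big|_{t=0}\ (0\le j\le 2m)$$ are well defined on $H^s$ (the derivatives exist) and belong to $L^q(d\mu_{m+1})$; and $$\lim_{N\to\infty}\Big(\|G_N\|_{L^q(d\mu_{m+1})}+\|H_N\|_{L^q(d\mu_{m+1})}+\sum_{j=0}^{2m}\|L_N^{j}\|_{L^q(d\mu_{m+1})}\Big)=0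 .$$ -/

import Mathlib

open Filter Topology MeasureTheory ProbabilityTheory Complex
open scoped ENNReal ComplexConjugate

noncomputable section

namespace BenjaminOno

/-! ### Trigonometric polynomials and the operators acting on them -/

/-- Trigonometric polynomials `∑ aₙ e^{inx}` on the torus `ℝ/2πℤ` with complex coefficients. The
ring of Laurent polynomials `∑ aₙ Tⁿ`, with `T` standing for `e^{ix}`, has as product the pointwise
product of functions (see `TrigPoly.toFun`). -/
abbrev TrigPoly : Type := LaurentPolynomial ℂ

/-- The function `x ↦ ∑ aₙ e^{inx}` of a trigonometric polynomial; an algebra homomorphism to the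
functions with pointwise operations. -/
def TrigPoly.toFun : TrigPoly →ₐ[ℂ] (ℝ → ℂ) :=
  AddMonoidAlgebra.lift ℂ (ℝ → ℂ) ℤ
    { toFun := fun n x => Complex.exp (I * (Multiplicative.toAdd n : ℤ) * x)
      map_one' := by
        funext x
        simp
      map_mul' := fun a b => by
        funext x
        simp only [toAdd_mul, Pi.mul_apply, ← Complex.exp_add]
        congr 1
        push_cast
        ring }

/-- The Fourier multiplier with symbol `σ`, i.e. `∑ aₙ e^{inx} ↦ ∑ σ(n) aₙ e^{inx}`. -/
def multiplier (σ : ℤ → ℂ) : TrigPoly →ₗ[ℂ] TrigPoly where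
  toFun p := ∑ n ∈ p.coeff.support, AddMonoidAlgebra.single n (σ n * p.coeff n)
  map_add' p q := by
    ext n
    simp only [AddMonoidAlgebra.coeff_add, AddMonoidAlgebra.coeff_sum,
      AddMonoidAlgebra.coeff_single, Finsupp.add_apply, Finsupp.finsetSum_apply,
      Finsupp.single_apply, Finset.sum_ite_eq', Finsupp.mem_support_iff]
    by_cases h1 : p.coeff n = 0 <;> by_cases h2 : q.coeff n = 0 <;> simp [h1, h2, mul_add]
    intro h
    rw [← mul_add, h, mul_zero]
  map_smul' a p := by
    ext n
    simp only [AddMonoidAlgebra.coeff_smul, AddMonoidAlgebra.coeff_sum,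
      AddMonoidAlgebra.coeff_single, Finsupp.smul_apply, Finsupp.finsetSum_apply,
      Finsupp.single_apply, Finset.sum_ite_eq', Finsupp.mem_support_iff, RingHom.id_apply,
      smul_eq_mul]
    by_cases h1 : p.coeff n = 0 <;> by_cases h2 : a = 0 <;> simp [h1, h2, mul_left_comm]

theorem multiplier_coeff (σ : ℤ → ℂ) (p : TrigPoly) (n : ℤ) :
    (multiplier σ p).coeff n = σ n * p.coeff n := by
  simp only [multiplier, LinearMap.coe_mk, AddHom.coe_mk, AddMonoidAlgebra.coeff_sum,
    AddMonoidAlgebra.coeff_single, Finsupp.finsetSum_apply,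
    Finsupp.single_apply, Finset.sum_ite_eq', Finsupp.mem_support_iff]
  by_cases h1 : p.coeff n = 0 <;> simp [h1]

/-- The derivative `∂ₓ`. -/
def dx : TrigPoly →ₗ[ℂ] TrigPoly := multiplier fun n => I * n

/-- The symbol `-i sgn(n)` of the Hilbert transform: `H cos(nx) = sin(nx)` and
`H sin(nx) = -cos(nx)` for `n ≥ 1`. -/
def hilbertSymbol (n : ℤ) : ℂ := -I * (n.sign : ℂ)

/-- The Hilbert transform `H`. -/
def hilbert : TrigPoly →ₗ[ℂ] TrigPoly := multiplier hilbertSymbol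

/-- The projector `P₋ = (1 - iH)/2` on negative frequencies. -/
def projNeg : TrigPoly →ₗ[ℂ] TrigPoly := (1 / 2 : ℂ) • (LinearMap.id - I • hilbert)

/-- The Dirichlet projector `π_N` on the frequencies `|n| ≤ N`. -/
def dirichletProj (N : ℕ) : TrigPoly →ₗ[ℂ] TrigPoly :=
  multiplier fun n => if |n| ≤ (N : ℤ) then 1 else 0

/-- The integral `∫ p dx` over the torus `ℝ/2πℤ`. -/
def torusIntegral (p : TrigPoly) : ℂ := ∫ x in (0 : ℝ)..(2 * Real.pi), TrigPoly.toFun p x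

theorem toFun_apply (p : TrigPoly) (x : ℝ) :
    TrigPoly.toFun p x = ∑ n ∈ p.coeff.support, p.coeff n * Complex.exp (I * (n : ℤ) * x) := by
  rw [TrigPoly.toFun, AddMonoidAlgebra.lift_apply, Finsupp.sum]
  simp

theorem toFun_single (n : ℤ) (a : ℂ) (x : ℝ) :
    TrigPoly.toFun (AddMonoidAlgebra.single n a) x = a * Complex.exp (I * (n : ℤ) * x) := by
  rw [TrigPoly.toFun, AddMonoidAlgebra.lift_single]
  simp

theorem multiplier_single (σ : ℤ → ℂ) (n : ℤ) (a : ℂ) :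
    multiplier σ (AddMonoidAlgebra.single n a) = AddMonoidAlgebra.single n (σ n * a) := by
  ext k
  rw [multiplier_coeff, AddMonoidAlgebra.coeff_single, AddMonoidAlgebra.coeff_single,
    Finsupp.single_apply, Finsupp.single_apply]
  split_ifs with h
  · rw [h]
  · simp

/-- `dx` is differentiation of functions. -/
theorem hasDerivAt_toFun (p : TrigPoly) (x : ℝ) :
    HasDerivAt (TrigPoly.toFun p) (TrigPoly.toFun (dx p) x) x := by
  induction p using AddMonoidAlgebra.induction_linear with
  | zero =>
    rw [map_zero, map_zero, map_zero]
    exact hasDerivAt_const x 0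
  | add f g hf hg =>
    rw [map_add, map_add, map_add]
    exact hf.add hg
  | single n a =>
    have h1 : TrigPoly.toFun (AddMonoidAlgebra.single n a) =
        fun y : ℝ => a * Complex.exp (I * (n : ℤ) * y) := funext fun y => toFun_single n a y
    rw [h1, dx, multiplier_single, toFun_single]
    have h2 : HasDerivAt (fun y : ℝ => I * (n : ℂ) * (y : ℂ)) (I * (n : ℂ) * 1) x :=
      (Complex.ofRealCLM.hasDerivAt (x := x)).const_mul (I * (n : ℂ))
    have h3 : I * (n : ℂ) * a * Complex.exp (I * (n : ℤ) * x) =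
        a * (Complex.exp (I * (n : ℤ) * x) * (I * (n : ℂ) * 1)) := by ring
    rw [h3]
    exact h2.cexp.const_mul a

/-- `∫ p dx = 2π p̂(0)`. -/
theorem torusIntegral_eq (p : TrigPoly) : torusIntegral p = 2 * Real.pi * p.coeff 0 := by
  have hc : ∀ q : TrigPoly, Continuous (TrigPoly.toFun q) := fun q =>
    continuous_iff_continuousAt.2 fun x => (hasDerivAt_toFun q x).continuousAt
  induction p using AddMonoidAlgebra.induction_linear with
  | zero => simp [torusIntegral]
  | add f g hf hg =>
    have h : torusIntegral (f + g) = torusIntegral f + torusIntegral g := by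
      simp only [torusIntegral, map_add, Pi.add_apply]
      exact intervalIntegral.integral_add ((hc f).intervalIntegrable _ _)
        ((hc g).intervalIntegrable _ _)
    rw [h, hf, hg, AddMonoidAlgebra.coeff_add, Finsupp.add_apply]
    ring
  | single n a =>
    simp only [torusIntegral, toFun_single, AddMonoidAlgebra.coeff_single, Finsupp.single_apply]
    rw [intervalIntegral.integral_const_mul]
    by_cases hn : n = 0
    · subst hn
      simp [mul_comm]
    · have hI : I * (n : ℂ) ≠ 0 := mul_ne_zero I_ne_zero (by exact_mod_cast hn)
      rw [integral_exp_mul_complex hI, if_neg hn]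
      have h1 : Complex.exp (I * (n : ℂ) * ((2 * Real.pi : ℝ) : ℂ)) = 1 := by
        rw [Complex.exp_eq_one_iff]
        exact ⟨n, by push_cast; ring⟩
      rw [h1]
      simp

/-! ### The conservation laws of the Benjamin-Ono equation -/

/-- The densities `w₁(u), w₂(u), …` (and `w₀ = 0`) of the formal power series
`w(u) = ∑_{n ≥ 1} wₙ(u) εⁿ` that solves `-ε i P₋ ∂ₓ w + (1 - e^{-w}) = ε u`. Comparing the
coefficients of `εⁿ⁺¹`, this reads
`wₙ₊₁ = i P₋ ∂ₓ wₙ + [n = 0] u + ∑_{k=2}^{n+1} ((-1)ᵏ / k!) [εⁿ⁺¹] wᵏ`,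
where only `w₁, …, wₙ` enter `[εⁿ⁺¹] wᵏ` for `k ≥ 2`. -/
def matsunoDensity (u : TrigPoly) : ℕ → TrigPoly
  | 0 => 0
  | n + 1 =>
    I • projNeg (dx (matsunoDensity u n)) + (if n = 0 then u else 0) +
      ∑ k ∈ Finset.Icc 2 (n + 1), ((-1 : ℂ) ^ k / (k.factorial : ℂ)) •
        PowerSeries.coeff (n + 1)
          ((PowerSeries.mk fun j => if _h : j < n + 1 then matsunoDensity u j else 0) ^ k)

/-- The defining relation of the densities, with the full power series `w(u)`. -/
theorem matsunoDensity_succ (u : TrigPoly) (n : ℕ) :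
    matsunoDensity u (n + 1) = I • projNeg (dx (matsunoDensity u n)) + (if n = 0 then u else 0) +
      ∑ k ∈ Finset.Icc 2 (n + 1), ((-1 : ℂ) ^ k / (k.factorial : ℂ)) •
        PowerSeries.coeff (n + 1) (PowerSeries.mk (matsunoDensity u) ^ k) := by
  rw [matsunoDensity]
  congr 1
  refine Finset.sum_congr rfl fun k hk => ?_
  congr 1
  obtain ⟨l, rfl⟩ : ∃ l, k = l + 2 := ⟨k - 2, by have := (Finset.mem_Icc.1 hk).1; omega⟩
  simp only [dite_eq_ite]
  set W : PowerSeries TrigPoly := PowerSeries.mk (matsunoDensity u) with hW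
  set V : PowerSeries TrigPoly :=
    PowerSeries.mk fun j => if j < n + 1 then matsunoDensity u j else 0 with hV
  have hWX : PowerSeries.X ∣ W := by
    rw [PowerSeries.X_dvd_iff, ← PowerSeries.coeff_zero_eq_constantCoeff_apply, hW,
      PowerSeries.coeff_mk, matsunoDensity]
  have hVX : PowerSeries.X ∣ V := by
    rw [PowerSeries.X_dvd_iff, ← PowerSeries.coeff_zero_eq_constantCoeff_apply, hV,
      PowerSeries.coeff_mk, matsunoDensity]
    simp
  have hWV : PowerSeries.X ^ (n + 1) ∣ W - V := by
    rw [PowerSeries.X_pow_dvd_iff]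
    intro j hj
    rw [map_sub, hW, hV, PowerSeries.coeff_mk, PowerSeries.coeff_mk, if_pos hj, sub_self]
  have hsum : PowerSeries.X ∣ ∑ i ∈ Finset.range (l + 2), W ^ i * V ^ (l + 2 - 1 - i) := by
    refine Finset.dvd_sum fun i _ => ?_
    rcases Nat.eq_zero_or_pos i with rfl | hi
    · exact Dvd.dvd.mul_left (dvd_pow hVX (by omega)) _
    · exact Dvd.dvd.mul_right (dvd_pow hWX hi.ne') _
  have hdiff : PowerSeries.X ^ (n + 2) ∣ W ^ (l + 2) - V ^ (l + 2) := by
    rw [← (Commute.all W V).geom_sum₂_mul, pow_succ']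
    exact mul_dvd_mul hsum hWV
  have h0 := PowerSeries.X_pow_dvd_iff.1 hdiff (n + 1) (by omega)
  rw [map_sub, sub_eq_zero] at h0
  exact h0.symm

/-- The conservation law `E_{k/2}` of the Benjamin-Ono equation `∂ₜu + H∂ₓ²u + u∂ₓu = 0`:
`E_{k/2}(u) = 8 ∫ w_{k+2}(u/2) dx`. The integrals `∫ wₙ(v) dx` are conserved by
`∂ₜv + H∂ₓ²v + 2v∂ₓv = 0`, which `v = u/2` solves if `u` solves the Benjamin-Ono equation, and the
factor `8` makes the quadratic part equal to `‖u‖²_{Ḣ^{k/2}} = ∫ ||D|^{k/2} u|² dx`. For real valued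
`u` the integral is real. -/
def energy (k : ℕ) (u : TrigPoly) : ℝ :=
  (8 * torusIntegral (matsunoDensity ((1 / 2 : ℂ) • u) (k + 2))).re

/-! ### Sobolev spaces of real valued functions of zero mean value -/

/-- Sequences of Fourier coefficients `û : ℤ → ℂ` of the real valued functions (distributions, if
`s < 0`) of zero mean value on the torus with `∑ (1 + n²)ˢ |û(n)|² < ∞`. -/
def sobolevSubmodule (s : ℝ) : Submodule ℝ (ℤ → ℂ) where
  carrier := {a | a 0 = 0 ∧ (∀ n, a (-n) = conj (a n)) ∧
    Memℓp (fun n : ℤ => (1 + (n : ℝ) ^ 2) ^ (s / 2) • a n) 2}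
  zero_mem' := ⟨rfl, fun n => by simp, by
    convert (zero_memℓp : Memℓp (0 : ℤ → ℂ) 2) using 1
    funext n
    simp⟩
  add_mem' := fun {a b} ha hb => ⟨by simp [ha.1, hb.1], fun n => by simp [ha.2.1 n, hb.2.1 n], by
    have h := ha.2.2.add hb.2.2
    convert h using 1
    funext n
    simp⟩
  smul_mem' := fun r a ha => ⟨by simp [ha.1], fun n => by simp [ha.2.1 n], by
    have h := ha.2.2.const_smul r
    convert h using 1
    funext n
    simp [mul_left_comm]⟩

/-- The Sobolev space `Hˢ` of real valued functions of zero mean value on the torus, a function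
being represented by its Fourier coefficients `û(n)`, `u = ∑ û(n) e^{inx}`. -/
def Sobolev (s : ℝ) : Type := sobolevSubmodule s

instance (s : ℝ) : AddCommGroup (Sobolev s) :=
  inferInstanceAs (AddCommGroup (sobolevSubmodule s))

instance (s : ℝ) : Module ℝ (Sobolev s) :=
  inferInstanceAs (Module ℝ (sobolevSubmodule s))

/-- The Fourier coefficients of `u`. -/
def fc {s : ℝ} (u : Sobolev s) : ℤ → ℂ := Subtype.val u

/-- The isometry `u ↦ ((1 + n²)^{s/2} û(n))ₙ` from `Hˢ` to `ℓ²`, which defines the norm. -/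
def Sobolev.toLp (s : ℝ) : Sobolev s →ₗ[ℝ] lp (fun _ : ℤ => ℂ) 2 where
  toFun u := ⟨fun n => (1 + (n : ℝ) ^ 2) ^ (s / 2) • fc u n, u.2.2.2⟩
  map_add' u v := by
    ext n
    exact smul_add _ _ _
  map_smul' r u := by
    ext n
    exact smul_comm ((1 + (n : ℝ) ^ 2) ^ (s / 2)) r (fc u n)

theorem Sobolev.toLp_injective (s : ℝ) : Function.Injective (Sobolev.toLp s) := by
  intro u v h
  apply Subtype.ext
  funext n
  have h1 : (1 + (n : ℝ) ^ 2) ^ (s / 2) • fc u n = (1 + (n : ℝ) ^ 2) ^ (s / 2) • fc v n :=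
    congrFun (congrArg Subtype.val h) n
  have h2 : (1 + (n : ℝ) ^ 2) ^ (s / 2) ≠ 0 := (Real.rpow_pos_of_pos (by positivity) _).ne'
  exact smul_right_injective ℂ h2 h1

/-- The norm `‖u‖² = ∑ (1 + n²)ˢ |û(n)|²`. -/
instance (s : ℝ) : NormedAddCommGroup (Sobolev s) :=
  NormedAddCommGroup.induced (Sobolev s) (lp (fun _ : ℤ => ℂ) 2) (Sobolev.toLp s)
    (Sobolev.toLp_injective s)

instance (s : ℝ) : NormedSpace ℝ (Sobolev s) :=
  NormedSpace.induced ℝ (Sobolev s) (lp (fun _ : ℤ => ℂ) 2) (Sobolev.toLp s)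

/-- `Hˢ` carries its Borel `σ`-algebra. -/
instance (s : ℝ) : MeasurableSpace (Sobolev s) := borel (Sobolev s)

instance (s : ℝ) : BorelSpace (Sobolev s) := ⟨rfl⟩

/-- The trigonometric polynomial `π_N u = ∑_{|n| ≤ N} û(n) e^{inx}`. -/
def trunc {s : ℝ} (N : ℕ) (u : Sobolev s) : TrigPoly :=
  ∑ n ∈ Finset.Icc (-(N : ℤ)) N, AddMonoidAlgebra.single n (fc u n)

/-! ### The truncated flow -/

/-- `u` is a global solution in `C(ℝ; Hˢ)` of the truncated problem
`∂ₜu + H∂ₓ²u + π_N((π_N u) ∂ₓ(π_N u)) = 0`, `u(0) = u₀`; the equation is written for each Fourier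
coefficient, which is the equation in the sense of distributions. -/
def IsTruncatedSolution {s : ℝ} (N : ℕ) (u₀ : Sobolev s) (u : ℝ → Sobolev s) : Prop :=
  Continuous u ∧ u 0 = u₀ ∧ ∀ (t : ℝ) (n : ℤ),
    HasDerivAt (fun τ => fc (u τ) n)
      (-(hilbertSymbol n * (I * n) ^ 2 * fc (u t) n) -
        (dirichletProj N (trunc N (u t) * dx (trunc N (u t)))).coeff n) t

open Classical in
/-- The truncated flow `Φₜᴺ(u₀)`: the solution of the truncated problem (and the constant `u₀`
if there were none). -/
def truncatedFlow {s : ℝ} (N : ℕ) (t : ℝ) (u₀ : Sobolev s) : Sobolev s :=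
  if h : ∃ u : ℝ → Sobolev s, IsTruncatedSolution N u₀ u then h.choose t else u₀

/-- `d/dt E_{k/2}(π_N Φₜᴺ(u))` at `t = 0`. -/
def energyRate {s : ℝ} (N k : ℕ) (u : Sobolev s) : ℝ :=
  deriv (fun t => energy k (trunc N (truncatedFlow N t u))) 0

/-! ### The gaussian measures -/

/-- The Fourier coefficients `φₙ / |n|^{k/2}`, `n ≠ 0`, of the random Fourier series, where
`φₙ = c (hₙ + i lₙ)` and `φ₋ₙ` is the conjugate of `φₙ`, for `n > 0`; here `ω n = (hₙ, lₙ)`, and the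
coordinate `ω 0` is not used. -/
def randomCoeff (c : ℝ) (k : ℕ) (ω : ℕ → ℝ × ℝ) (n : ℤ) : ℂ :=
  if n = 0 then 0
  else (c * ((ω n.natAbs).1 + n.sign * I * (ω n.natAbs).2)) / ((|(n : ℝ)| ^ ((k : ℝ) / 2) : ℝ) : ℂ)

/-- The law of the sequence `((hₙ, lₙ))ₙ` of independent pairs of independent standard real
gaussian variables. -/
def gaussianSpace : Measure (ℕ → ℝ × ℝ) :=
  Measure.infinitePi fun _ => (gaussianReal 0 1).prod (gaussianReal 0 1)

/-- The gaussian measure `μ_{k/2}` on `Hˢ`: the law of the random Fourier series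
`∑_{n ≠ 0} φₙ |n|^{-k/2} e^{inx}`, as a measure on `Hˢ`. -/
def gaussianMeasure (c : ℝ) (k : ℕ) (s : ℝ) : Measure (Sobolev s) :=
  (gaussianSpace.map (randomCoeff c k)).comap fc

end BenjaminOno

end

/-!
The truncated problem is a system of ordinary differential equations for the frequencies `|n| ≤ N`,
together with the free evolution of the other frequencies. The vector field of the system is
polynomial and conserves the `L²` norm, whence existence and uniqueness for all times
(`exists_isTruncatedSolution`, `IsTruncatedSolution.unique`).

Let `v = π_N u / 2`. Up to the factor that normalizes `E_{k/2}`, its derivative along the truncated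
flow is the pairing of the gradient `g` of `v ↦ ∫ w_{k+2}(v) dx` (`gradDensity`) with the vector
field. The Benjamin-Ono field does not contribute, since `E_{k/2}` is one of its conservation laws:
if `v` moves by that field, then `w` moves by `∂ₜw = i (wₓₓ - wₓ²) - 2 v wₓ - 2i P₋ wₓₓ`, and the
right hand side has mean value zero (`linearised_evolution`, `mean_evolution`,
`gradDensity_mul_boField`). What remains is the part of the nonlinearity that the truncation
discards (`hasDerivAt_energy_truncatedFlow`),
`d/dt E_{k/2}(π_N Φₜᴺ(u)) = 8 ∫ g (1 - π_N) ∂ₓ(v²) dx` at `t = 0`.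

This is small for deterministic reasons. Only the frequencies `N < |p| ≤ 2N` of `g` enter, where the
part of `g` that is linear in `v` vanishes. A quadratic term has at `p` the coefficient
`∑_{a + b = p} σ(a, b) v̂(a) v̂(b)` with `|a|, |b| ≤ N < |p|`, so that `a` and `b` have the sign of
`p`, and one of them is of size comparable to `N`. If the other one is small, the symmetrization of
`σ` is close to a real multiple of `|p|^{k-1}`; if it is large, then `v̂(a) v̂(b)` is small. Up to an
error of the size of the cubic terms, the quadratic part is thus a real multiple of
`|p|^{k-1} (v²)^(p)` (`AlmostSquare.signPow_mul_signPow`, `almostSquare_gradDensity`), and its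
contribution to the pairing is purely imaginary. The cubic terms have one derivative less to
distribute. If `|v̂(n)| ≤ M (1 + |n|)^{-σ}` with `σ > 11/4`, a sup norm estimate of the coefficients
with a weight that is stable under convolution and that decays beyond the frequency `N` (`weight`)
bounds the derivative by `C (1 + M)^{k+3} (N + 1)^{k - 1 - 2σ}` (`abs_re_pairing_le`).

Under `μ_{m+1}`, for each `σ < m + 1` and each finite `p`, such a bound holds almost surely with a
random `M` in `L^p` (`exists_norm_fc_le`). With `σ = m + 7/8 > 11/4` and `k ≤ 2m + 2` the exponent of
`N + 1` is at most `-3/4`.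
-/

noncomputable section

namespace BenjaminOno

/-! ### Fourier multipliers and products of trigonometric polynomials -/

/-- The operator `i P₋ ∂ₓ`, with symbol `n ↦ max (-n) 0`. -/
def negDeriv : TrigPoly →ₗ[ℂ] TrigPoly := multiplier fun n => ((max (-n) 0 : ℤ) : ℂ)

/-- The operator `-i P₊ ∂ₓ`, with symbol `n ↦ max n 0`: the transpose of `negDeriv` for the bilinear
pairing `∫ p q dx`. -/
def posDeriv : TrigPoly →ₗ[ℂ] TrigPoly := multiplier fun n => ((max n 0 : ℤ) : ℂ)

theorem dx_coeff (p : TrigPoly) (n : ℤ) : (dx p).coeff n = I * n * p.coeff n :=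
  multiplier_coeff _ _ _

theorem negDeriv_coeff (p : TrigPoly) (n : ℤ) :
    (negDeriv p).coeff n = ((max (-n) 0 : ℤ) : ℂ) * p.coeff n :=
  multiplier_coeff _ _ _

theorem posDeriv_coeff (p : TrigPoly) (n : ℤ) :
    (posDeriv p).coeff n = ((max n 0 : ℤ) : ℂ) * p.coeff n :=
  multiplier_coeff _ _ _

theorem I_smul_projNeg_dx (p : TrigPoly) : I • projNeg (dx p) = negDeriv p := by
  ext n
  have h : (projNeg (dx p)).coeff n
      = (1 / 2 : ℂ) * ((dx p).coeff n - I * (hilbert (dx p)).coeff n) := rfl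
  rw [AddMonoidAlgebra.coeff_smul_apply, h, negDeriv_coeff, hilbert, multiplier_coeff, dx_coeff,
    hilbertSymbol, smul_eq_mul]
  rcases lt_trichotomy n 0 with hn | rfl | hn
  · rw [Int.sign_eq_neg_one_of_neg hn, max_eq_left (by omega)]
    push_cast
    linear_combination (n * p.coeff n - I ^ 2 * n * p.coeff n / 2) * I_sq
  · simp
  · rw [Int.sign_eq_one_of_pos hn, max_eq_right (by omega)]
    push_cast
    linear_combination (1 / 2 * n * p.coeff n * I ^ 2) * I_sq

theorem coeff_mul_of_subset (p q : TrigPoly) (n : ℤ) {S : Finset ℤ} (hS : p.coeff.support ⊆ S) :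
    (p * q).coeff n = ∑ a ∈ S, p.coeff a * q.coeff (n - a) := by
  rw [AddMonoidAlgebra.coeff_mul_apply_left, Finsupp.sum]
  refine (Finset.sum_congr rfl fun a _ => by rw [neg_add_eq_sub]).trans
    (Finset.sum_subset hS fun a _ ha => ?_)
  rw [Finsupp.notMem_support_iff.1 ha, zero_mul]

theorem coeff_mul (p q : TrigPoly) (n : ℤ) :
    (p * q).coeff n = ∑ a ∈ p.coeff.support, p.coeff a * q.coeff (n - a) :=
  coeff_mul_of_subset p q n subset_rfl

theorem dx_mul (p q : TrigPoly) : dx (p * q) = dx p * q + p * dx q := by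
  have hS : (dx p).coeff.support ⊆ p.coeff.support := fun n hn => by
    rw [Finsupp.mem_support_iff, dx_coeff] at hn
    exact Finsupp.mem_support_iff.2 (right_ne_zero_of_mul hn)
  ext n
  rw [AddMonoidAlgebra.coeff_add, Finsupp.add_apply, dx_coeff, coeff_mul p q,
    coeff_mul p (dx q), coeff_mul_of_subset _ _ _ hS, Finset.mul_sum, ← Finset.sum_add_distrib]
  refine Finset.sum_congr rfl fun a _ => ?_
  rw [dx_coeff, dx_coeff]
  push_cast
  ring

theorem negDeriv_dx (p : TrigPoly) : negDeriv (dx p) = dx (negDeriv p) := by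
  ext n
  rw [negDeriv_coeff, dx_coeff, dx_coeff, negDeriv_coeff]
  ring

/-- `posDeriv` is the transpose of `negDeriv`. -/
theorem coeff_zero_mul_negDeriv (p q : TrigPoly) :
    (p * negDeriv q).coeff 0 = (posDeriv p * q).coeff 0 := by
  have hS : (posDeriv p).coeff.support ⊆ p.coeff.support := fun n hn => by
    rw [Finsupp.mem_support_iff, posDeriv_coeff] at hn
    exact Finsupp.mem_support_iff.2 (right_ne_zero_of_mul hn)
  rw [coeff_mul, coeff_mul_of_subset _ _ _ hS]
  refine Finset.sum_congr rfl fun a _ => ?_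
  rw [negDeriv_coeff, posDeriv_coeff, zero_sub, neg_neg]
  ring

/-- The function `p` is real valued. -/
def IsReal (p : TrigPoly) : Prop := ∀ n, p.coeff (-n) = conj (p.coeff n)

theorem IsReal.mul {p q : TrigPoly} (hp : IsReal p) (hq : IsReal q) : IsReal (p * q) := by
  intro n
  have hS : p.coeff.support ⊆ p.coeff.support ∪ p.coeff.support.image Neg.neg :=
    Finset.subset_union_left
  rw [coeff_mul_of_subset _ _ _ hS, coeff_mul_of_subset _ _ _ hS, map_sum]
  have hmem : ∀ a ∈ p.coeff.support ∪ p.coeff.support.image Neg.neg,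
      -a ∈ p.coeff.support ∪ p.coeff.support.image Neg.neg := by
    intro a ha
    rcases Finset.mem_union.1 ha with h | h
    · exact Finset.mem_union_right _ (Finset.mem_image_of_mem _ h)
    · obtain ⟨b, hb, rfl⟩ := Finset.mem_image.1 h
      exact Finset.mem_union_left _ (by rwa [neg_neg])
  refine Finset.sum_nbij' (fun a => -a) (fun a => -a) hmem hmem ?_ ?_ ?_
  · intro a _; simp
  · intro a _; simp
  · intro a _
    rw [map_mul, hp a, Complex.conj_conj, show -n - a = -(n - -a) by ring, hq]

theorem IsReal.dx {p : TrigPoly} (hp : IsReal p) : IsReal (dx p) := by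
  intro n
  rw [dx_coeff, dx_coeff, hp n, map_mul, map_mul, Complex.conj_I, map_intCast]
  push_cast
  ring

/-- All frequencies of `p` are positive. -/
def PosFreq (p : TrigPoly) : Prop := ∀ n ≤ 0, p.coeff n = 0

/-- All frequencies of `p` are negative. -/
def NegFreq (p : TrigPoly) : Prop := ∀ n, 0 ≤ n → p.coeff n = 0

theorem PosFreq.mul {p q : TrigPoly} (hp : PosFreq p) (hq : PosFreq q) : PosFreq (p * q) := by
  intro n hn
  rw [coeff_mul]
  refine Finset.sum_eq_zero fun a _ => ?_
  rcases le_or_gt a 0 with ha | ha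
  · rw [hp a ha, zero_mul]
  · rw [hq (n - a) (by omega), mul_zero]

theorem NegFreq.mul {p q : TrigPoly} (hp : NegFreq p) (hq : NegFreq q) : NegFreq (p * q) := by
  intro n hn
  rw [coeff_mul]
  refine Finset.sum_eq_zero fun a _ => ?_
  rcases le_or_gt 0 a with ha | ha
  · rw [hp a ha, zero_mul]
  · rw [hq (n - a) (by omega), mul_zero]

theorem PosFreq.sum {ι : Type*} {s : Finset ι} {p : ι → TrigPoly} (h : ∀ i ∈ s, PosFreq (p i)) :
    PosFreq (∑ i ∈ s, p i) := by
  intro n hn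
  rw [AddMonoidAlgebra.coeff_sum, Finsupp.finsetSum_apply]
  exact Finset.sum_eq_zero fun i hi => h i hi n hn

theorem NegFreq.sum {ι : Type*} {s : Finset ι} {p : ι → TrigPoly} (h : ∀ i ∈ s, NegFreq (p i)) :
    NegFreq (∑ i ∈ s, p i) := by
  intro n hn
  rw [AddMonoidAlgebra.coeff_sum, Finsupp.finsetSum_apply]
  exact Finset.sum_eq_zero fun i hi => h i hi n hn

theorem PosFreq.negDeriv_eq {p : TrigPoly} (hp : PosFreq p) : negDeriv p = 0 := by
  ext n
  rw [negDeriv_coeff]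
  rcases le_or_gt n 0 with hn | hn
  · rw [hp n hn, mul_zero]; rfl
  · rw [max_eq_right (by omega), Int.cast_zero, zero_mul]; rfl

theorem NegFreq.negDeriv_eq {p : TrigPoly} (hp : NegFreq p) : negDeriv p = I • dx p := by
  ext n
  rw [negDeriv_coeff, AddMonoidAlgebra.coeff_smul_apply, dx_coeff, smul_eq_mul]
  rcases le_or_gt 0 n with hn | hn
  · rw [hp n hn]; ring
  · rw [max_eq_left (by omega)]
    push_cast
    linear_combination (-(n : ℂ) * p.coeff n) * I_sq

theorem negFreq_negDeriv (p : TrigPoly) : NegFreq (negDeriv p) := by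
  intro n hn
  rw [negDeriv_coeff, max_eq_right (by omega), Int.cast_zero, zero_mul]

/-- `∂ₓ + i (i P₋ ∂ₓ)` is supported on positive frequencies. -/
theorem posFreq_dx_add (p : TrigPoly) : PosFreq (dx p + I • negDeriv p) := by
  intro n hn
  rw [AddMonoidAlgebra.coeff_add, Finsupp.add_apply, AddMonoidAlgebra.coeff_smul_apply,
    negDeriv_coeff, dx_coeff, smul_eq_mul, max_eq_left (by omega)]
  push_cast
  ring

/-! ### Formal power series of trigonometric polynomials -/

/-- The coefficientwise action of a linear operator on formal power series in `ε`. -/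
def lift (T : TrigPoly →ₗ[ℂ] TrigPoly) : PowerSeries TrigPoly →ₗ[ℂ] PowerSeries TrigPoly where
  toFun Z := PowerSeries.mk fun n => T (PowerSeries.coeff n Z)
  map_add' Z Y := by
    ext1 n
    simp
  map_smul' a Z := by
    ext1 n
    simp

theorem coeff_lift (T : TrigPoly →ₗ[ℂ] TrigPoly) (Z : PowerSeries TrigPoly) (n : ℕ) :
    PowerSeries.coeff n (lift T Z) = T (PowerSeries.coeff n Z) := by
  simp [lift]

theorem lift_X_mul (T : TrigPoly →ₗ[ℂ] TrigPoly) (Z : PowerSeries TrigPoly) :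
    lift T (PowerSeries.X * Z) = PowerSeries.X * lift T Z := by
  ext1 n
  cases n with
  | zero => simp [coeff_lift]
  | succ n =>
    rw [coeff_lift, PowerSeries.coeff_succ_X_mul, PowerSeries.coeff_succ_X_mul, coeff_lift]

theorem lift_dx_mul (Z Y : PowerSeries TrigPoly) :
    lift dx (Z * Y) = lift dx Z * Y + Z * lift dx Y := by
  ext1 n
  rw [coeff_lift, map_add, PowerSeries.coeff_mul, PowerSeries.coeff_mul, PowerSeries.coeff_mul,
    map_sum, ← Finset.sum_add_distrib]
  refine Finset.sum_congr rfl fun a _ => ?_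
  rw [dx_mul, coeff_lift, coeff_lift]

theorem lift_negDeriv_dx (Z : PowerSeries TrigPoly) :
    lift negDeriv (lift dx Z) = lift dx (lift negDeriv Z) := by
  ext1 n
  simp only [coeff_lift, negDeriv_dx]

/-- The coefficientwise mean value of a power series of trigonometric polynomials. -/
def mean : PowerSeries TrigPoly →ₗ[ℂ] PowerSeries ℂ where
  toFun Z := PowerSeries.mk fun n => (PowerSeries.coeff n Z).coeff 0
  map_add' Z Y := by
    ext1 n
    simp
  map_smul' a Z := by
    ext1 n
    simp

theorem coeff_mean (Z : PowerSeries TrigPoly) (n : ℕ) :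
    PowerSeries.coeff n (mean Z) = (PowerSeries.coeff n Z).coeff 0 := by
  simp [mean]

theorem mean_X_mul (Z : PowerSeries TrigPoly) :
    mean (PowerSeries.X * Z) = PowerSeries.X * mean Z := by
  ext1 n
  cases n with
  | zero => simp [coeff_mean]
  | succ n =>
    rw [coeff_mean, PowerSeries.coeff_succ_X_mul, PowerSeries.coeff_succ_X_mul, coeff_mean]

theorem mean_lift_dx (Z : PowerSeries TrigPoly) : mean (lift dx Z) = 0 := by
  ext1 n
  rw [coeff_mean, coeff_lift, dx_coeff]
  simp

theorem mean_mul_lift_negDeriv (Z Y : PowerSeries TrigPoly) :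
    mean (Z * lift negDeriv Y) = mean (lift posDeriv Z * Y) := by
  ext1 n
  rw [coeff_mean, coeff_mean, PowerSeries.coeff_mul, PowerSeries.coeff_mul,
    AddMonoidAlgebra.coeff_sum, AddMonoidAlgebra.coeff_sum, Finsupp.finsetSum_apply,
    Finsupp.finsetSum_apply]
  refine Finset.sum_congr rfl fun a _ => ?_
  rw [coeff_lift, coeff_lift, coeff_zero_mul_negDeriv]

/-! ### The exponential series -/

/-- The partial sum `∑_{k ≤ M} (-W)ᵏ / k!`. -/
def expNegSum (W : PowerSeries TrigPoly) (M : ℕ) : PowerSeries TrigPoly :=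
  ∑ k ∈ Finset.range (M + 1), ((-1 : ℂ) ^ k / (k.factorial : ℂ)) • W ^ k

/-- The series `e^{-W}`, for `W` without constant term: its `n`-th coefficient is that of the
`n`-th partial sum of the exponential series. -/
def expNeg (W : PowerSeries TrigPoly) : PowerSeries TrigPoly :=
  PowerSeries.mk fun n => PowerSeries.coeff n (expNegSum W n)

theorem coeff_expNeg {W : PowerSeries TrigPoly} (hW : PowerSeries.X ∣ W) {n M : ℕ} (h : n ≤ M) :
    PowerSeries.coeff n (expNeg W) = PowerSeries.coeff n (expNegSum W M) := by
  rw [expNeg, PowerSeries.coeff_mk, expNegSum, expNegSum, map_sum, map_sum]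
  refine Finset.sum_subset (Finset.range_mono (by omega)) fun k _ hk => ?_
  rw [Finset.mem_range, not_lt] at hk
  have h1 := PowerSeries.X_pow_dvd_iff.1 (pow_dvd_pow_of_dvd hW k) n (by omega)
  rw [PowerSeries.coeff_smul, h1, smul_zero]

theorem coeff_expNeg_mul {W : PowerSeries TrigPoly} (hW : PowerSeries.X ∣ W)
    (Z : PowerSeries TrigPoly) (n : ℕ) :
    PowerSeries.coeff n (expNeg W * Z) = PowerSeries.coeff n (expNegSum W n * Z) := by
  rw [PowerSeries.coeff_mul, PowerSeries.coeff_mul]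
  refine Finset.sum_congr rfl fun a ha => ?_
  have h : a.1 ≤ n := by
    have := Finset.HasAntidiagonal.mem_antidiagonal.1 ha
    omega
  rw [coeff_expNeg hW h]

theorem lift_dx_pow (W : PowerSeries TrigPoly) (k : ℕ) :
    lift dx (W ^ (k + 1)) = ((k + 1 : ℕ) : ℂ) • (W ^ k * lift dx W) := by
  rw [Nat.cast_smul_eq_nsmul, nsmul_eq_mul]
  induction k with
  | zero => simp
  | succ k ih =>
    rw [pow_succ, lift_dx_mul, ih]
    push_cast
    ring

theorem factorial_coeff (k : ℕ) : ((-1 : ℂ) ^ (k + 1) / ((k + 1).factorial : ℂ)) *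
    ((k + 1 : ℕ) : ℂ) = -((-1 : ℂ) ^ k / (k.factorial : ℂ)) := by
  have h1 : (k.factorial : ℂ) ≠ 0 := by exact_mod_cast k.factorial_ne_zero
  have h2 : ((k + 1 : ℕ) : ℂ) ≠ 0 := by exact_mod_cast k.succ_ne_zero
  rw [Nat.factorial_succ, Nat.cast_mul]
  field_simp
  ring

theorem lift_dx_expNegSum (W : PowerSeries TrigPoly) (M : ℕ) :
    lift dx (expNegSum W (M + 1)) = -(expNegSum W M * lift dx W) := by
  rw [expNegSum, Finset.sum_range_succ', map_add, map_sum]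
  have h0 : lift dx (((-1 : ℂ) ^ 0 / ((Nat.factorial 0 : ℕ) : ℂ)) • W ^ 0) = 0 := by
    ext1 n
    ext m
    rw [coeff_lift, dx_coeff, pow_zero W, PowerSeries.coeff_smul, PowerSeries.coeff_one]
    split_ifs
    · rw [AddMonoidAlgebra.coeff_smul_apply, AddMonoidAlgebra.one_def,
        AddMonoidAlgebra.coeff_single, Finsupp.single_apply]
      split_ifs with h
      · simp [← h]
      · simp
    · simp
  rw [h0, add_zero, expNegSum, Finset.sum_mul, ← Finset.sum_neg_distrib]
  refine Finset.sum_congr rfl fun k _ => ?_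
  rw [map_smul, lift_dx_pow, smul_smul, factorial_coeff, neg_smul, smul_mul_assoc]

theorem lift_dx_expNeg {W : PowerSeries TrigPoly} (hW : PowerSeries.X ∣ W) :
    lift dx (expNeg W) = -(expNeg W * lift dx W) := by
  ext1 n
  rw [coeff_lift, coeff_expNeg hW n.le_succ, ← coeff_lift, lift_dx_expNegSum, map_neg, map_neg,
    coeff_expNeg_mul hW]

/-! ### Conservation of the energies by the Benjamin-Ono equation -/

/-- The generating series `w(u)` of the densities. -/
def matsunoSeries (u : TrigPoly) : PowerSeries TrigPoly := PowerSeries.mk (matsunoDensity u)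

/-- The coefficients `u + i P₋ ∂ₓ w₀, i P₋ ∂ₓ w₁, i P₋ ∂ₓ w₂, …` of `(1 - e^{-w}) / ε`. -/
def potential (u : TrigPoly) (n : ℕ) : TrigPoly :=
  negDeriv (matsunoDensity u n) + if n = 0 then u else 0

theorem X_dvd_matsunoSeries (u : TrigPoly) : PowerSeries.X ∣ matsunoSeries u := by
  rw [PowerSeries.X_dvd_iff, ← PowerSeries.coeff_zero_eq_constantCoeff_apply, matsunoSeries,
    PowerSeries.coeff_mk, matsunoDensity]

theorem mk_potential (u : TrigPoly) :
    PowerSeries.mk (potential u) = PowerSeries.C u + lift negDeriv (matsunoSeries u) := by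
  ext1 n
  rw [map_add, coeff_lift, PowerSeries.coeff_mk, PowerSeries.coeff_C, potential, matsunoSeries,
    PowerSeries.coeff_mk, add_comm]

/-- The equation for `w` in the form `e^{-w} = 1 - ε (u + i P₋ ∂ₓ w)`. -/
theorem expNeg_matsunoSeries (u : TrigPoly) :
    expNeg (matsunoSeries u) = 1 - PowerSeries.X * PowerSeries.mk (potential u) := by
  ext1 n
  cases n with
  | zero => simp [expNeg, expNegSum]
  | succ n =>
    rw [map_sub, PowerSeries.coeff_succ_X_mul, PowerSeries.coeff_mk, potential, PowerSeries.coeff_one,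
      if_neg n.succ_ne_zero, expNeg, PowerSeries.coeff_mk, expNegSum,
      ← Finset.sum_range_add_sum_Ico _ (show 2 ≤ n + 1 + 1 by omega), map_add,
      Finset.sum_range_succ, Finset.sum_range_one]
    have h := matsunoDensity_succ u n
    rw [I_smul_projNeg_dx] at h
    have h2 : Finset.Ico 2 (n + 1 + 1) = Finset.Icc 2 (n + 1) := rfl
    rw [h2, map_sum, map_add]
    simp only [PowerSeries.coeff_smul]
    rw [pow_zero, pow_one, pow_one, pow_zero, PowerSeries.coeff_one, if_neg n.succ_ne_zero,
      smul_zero, zero_add, Nat.factorial_one, Nat.cast_one, div_one, matsunoSeries,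
      PowerSeries.coeff_mk, h]
    simp only [neg_smul, one_smul]
    abel

/-- The imaginary unit as a constant power series. -/
def imagUnit : PowerSeries TrigPoly := algebraMap ℂ (PowerSeries TrigPoly) I

theorem imagUnit_mul (Z : PowerSeries TrigPoly) : imagUnit * Z = I • Z :=
  (Algebra.smul_def I Z).symm

theorem imagUnit_sq : imagUnit * imagUnit = -1 := by
  rw [imagUnit, ← map_mul, I_mul_I, map_neg, map_one]

theorem lift_imagUnit_mul (T : TrigPoly →ₗ[ℂ] TrigPoly) (Z : PowerSeries TrigPoly) :
    lift T (imagUnit * Z) = imagUnit * lift T Z := by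
  rw [imagUnit_mul, imagUnit_mul, map_smul]

theorem mean_imagUnit_mul (Z : PowerSeries TrigPoly) :
    mean (imagUnit * Z) = I • mean Z := by
  rw [imagUnit_mul, map_smul]

theorem posFreq_coeff_sq (W : PowerSeries TrigPoly) (n : ℕ) :
    PosFreq (PowerSeries.coeff n
      ((lift dx W + imagUnit * lift negDeriv W) * (lift dx W + imagUnit * lift negDeriv W))) := by
  have h : ∀ k, PosFreq (PowerSeries.coeff k (lift dx W + imagUnit * lift negDeriv W)) := by
    intro k
    rw [imagUnit_mul, map_add, PowerSeries.coeff_smul, coeff_lift, coeff_lift]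
    exact posFreq_dx_add _
  rw [PowerSeries.coeff_mul]
  exact PosFreq.sum fun i _ => (h _).mul (h _)

theorem negFreq_coeff_sq (W : PowerSeries TrigPoly) (n : ℕ) :
    NegFreq (PowerSeries.coeff n (lift negDeriv W * lift negDeriv W)) := by
  rw [PowerSeries.coeff_mul]
  refine NegFreq.sum fun i _ => ?_
  rw [coeff_lift, coeff_lift]
  exact (negFreq_negDeriv _).mul (negFreq_negDeriv _)

section Conservation

variable {E w φ v : PowerSeries TrigPoly}

theorem X_mul_lift_dx_potential (hE : E = 1 - PowerSeries.X * φ)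
    (hD : lift dx E = -(E * lift dx w)) : PowerSeries.X * lift dx φ = E * lift dx w := by
  have h1 : lift dx E = -(PowerSeries.X * lift dx φ) := by
    have h0 : lift dx (1 : PowerSeries TrigPoly) = 0 := by
      have h := lift_dx_mul 1 1
      rw [one_mul, one_mul, mul_one] at h
      exact left_eq_add.1 h
    rw [hE, map_sub, h0, lift_X_mul, zero_sub]
  rw [← neg_inj, ← h1, hD]

/-- If `v` moves by the Benjamin-Ono flow, `∂ₜv = i vₓₓ - 2i P₋ vₓₓ - 2 v vₓ`, then `w` moves by
`∂ₜw = F` with `F = i (wₓₓ - wₓ²) - 2 v wₓ - 2i P₋ wₓₓ`: the linearisation of the equation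
`1 - e^{-w} - ε i P₋ ∂ₓ w = ε v` maps `F` to `ε ∂ₜv`. -/
theorem linearised_evolution (hE : E = 1 - PowerSeries.X * φ) (hφ : φ = v + lift negDeriv w)
    (hD : lift dx E = -(E * lift dx w)) :
    E * (imagUnit * (lift dx (lift dx w) - lift dx w * lift dx w) - 2 * (v * lift dx w)
        - 2 * lift dx (lift negDeriv w)) -
      PowerSeries.X * lift negDeriv
        (imagUnit * (lift dx (lift dx w) - lift dx w * lift dx w) - 2 * (v * lift dx w)
        - 2 * lift dx (lift negDeriv w)) =
      PowerSeries.X * (imagUnit * lift dx (lift dx v) - 2 * lift negDeriv (lift dx v)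
        - 2 * (v * lift dx v)) := by
  have h1 := X_mul_lift_dx_potential hE hD
  have h2 : PowerSeries.X * lift dx (lift dx φ) =
      E * (lift dx (lift dx w) - lift dx w * lift dx w) := by
    have h := congrArg (lift dx) h1
    rw [lift_X_mul, lift_dx_mul, hD] at h
    rw [h]
    ring
  have h4 : PowerSeries.X * lift negDeriv (φ * lift dx w) =
      lift negDeriv (lift dx w) - PowerSeries.X * lift negDeriv (lift dx φ) := by
    rw [← lift_X_mul, ← lift_X_mul, ← map_sub]
    congr 1
    rw [h1, hE]
    ring
  -- `wₓ + i (i P₋ ∂ₓ w)` has positive frequencies, so that `P₋` kills its square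
  have h5 : lift negDeriv (lift dx w * lift dx w) +
      2 * imagUnit * lift negDeriv (lift negDeriv w * lift dx w) -
      lift negDeriv (lift negDeriv w * lift negDeriv w) = 0 := by
    have h : lift negDeriv ((lift dx w + imagUnit * lift negDeriv w) *
        (lift dx w + imagUnit * lift negDeriv w)) = 0 := by
      ext1 n
      rw [coeff_lift, (posFreq_coeff_sq w n).negDeriv_eq, map_zero]
    have h' : (lift dx w + imagUnit * lift negDeriv w) * (lift dx w + imagUnit * lift negDeriv w) =
        lift dx w * lift dx w + imagUnit * (lift negDeriv w * lift dx w) +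
        imagUnit * (lift negDeriv w * lift dx w) - lift negDeriv w * lift negDeriv w := by
      linear_combination (lift negDeriv w * lift negDeriv w) * imagUnit_sq
    rw [h', map_sub, map_add, map_add, lift_imagUnit_mul] at h
    linear_combination h
  have h6 : lift negDeriv (lift negDeriv w * lift negDeriv w) =
      2 * imagUnit * (lift negDeriv w * lift dx (lift negDeriv w)) := by
    have h : lift negDeriv (lift negDeriv w * lift negDeriv w) =
        imagUnit * lift dx (lift negDeriv w * lift negDeriv w) := by
      ext1 n
      rw [coeff_lift, (negFreq_coeff_sq w n).negDeriv_eq, imagUnit_mul, PowerSeries.coeff_smul,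
        coeff_lift]
    rw [h, lift_dx_mul]
    ring
  have hv : v = φ - lift negDeriv w := by rw [hφ]; ring
  have h7 : lift negDeriv (v * lift dx w) = lift negDeriv (φ * lift dx w) -
      lift negDeriv (lift negDeriv w * lift dx w) := by
    rw [← map_sub, hv]
    congr 1
    ring
  have two (T : TrigPoly →ₗ[ℂ] TrigPoly) (Z : PowerSeries TrigPoly) :
      lift T (2 * Z) = 2 * lift T Z := by
    rw [two_mul, map_add, two_mul]
  have hv1 : lift dx v = lift dx φ - lift dx (lift negDeriv w) := by rw [hv, map_sub]
  rw [map_sub, map_sub, two, two, lift_imagUnit_mul, map_sub, h7, hv1, map_sub, map_sub]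
  simp only [lift_negDeriv_dx] at h4 h5 ⊢
  linear_combination -imagUnit * h2 + 2 * v * h1 + 2 * h4
    + PowerSeries.X * imagUnit * h5 + PowerSeries.X * imagUnit * h6
    - 2 * lift dx (lift negDeriv w) * hE + 2 * PowerSeries.X * lift dx (lift negDeriv w) * hφ
    + (2 * PowerSeries.X * (lift negDeriv w * lift dx (lift negDeriv w))
      - 2 * PowerSeries.X * lift negDeriv (lift negDeriv w * lift dx w)) * imagUnit_sq

/-- The right hand side `F` of `∂ₜw = F` has mean value zero: it is a combination of derivatives, of
`φ wₓ`, for which `ε φ wₓ = (w - ε φ)ₓ`, and of squares of series with frequencies of one sign. -/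
theorem mean_evolution (hE : E = 1 - PowerSeries.X * φ) (hφ : φ = v + lift negDeriv w)
    (hD : lift dx E = -(E * lift dx w)) :
    mean (imagUnit * (lift dx (lift dx w) - lift dx w * lift dx w) - 2 * (v * lift dx w)
        - 2 * lift dx (lift negDeriv w)) = 0 := by
  have h1 := X_mul_lift_dx_potential hE hD
  have h2 : mean (φ * lift dx w) = 0 := by
    have h : PowerSeries.X * mean (φ * lift dx w) = 0 := by
      have h' : PowerSeries.X * (φ * lift dx w) = lift dx w - lift dx (PowerSeries.X * φ) := by
        rw [lift_X_mul, h1, hE]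
        ring
      rw [← mean_X_mul, h', map_sub, mean_lift_dx, mean_lift_dx, sub_zero]
    exact (mul_eq_zero.1 h).resolve_left PowerSeries.X_ne_zero
  have h3 : mean ((lift dx w + imagUnit * lift negDeriv w) *
      (lift dx w + imagUnit * lift negDeriv w)) = 0 := by
    ext1 n
    rw [coeff_mean, posFreq_coeff_sq w n 0 le_rfl, map_zero]
  have h4 : mean (lift negDeriv w * lift negDeriv w) = 0 := by
    ext1 n
    rw [coeff_mean, negFreq_coeff_sq w n 0 le_rfl, map_zero]
  have h5 : imagUnit * (lift dx (lift dx w) - lift dx w * lift dx w) - 2 * (v * lift dx w)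
        - 2 * lift dx (lift negDeriv w) =
      imagUnit * lift dx (lift dx w) - (φ * lift dx w + φ * lift dx w)
        - (lift dx (lift negDeriv w) + lift dx (lift negDeriv w))
        - imagUnit * ((lift dx w + imagUnit * lift negDeriv w) *
      (lift dx w + imagUnit * lift negDeriv w)) - imagUnit * (lift negDeriv w * lift negDeriv w) := by
    rw [hφ]
    linear_combination (2 * (lift negDeriv w * lift dx w) +
      imagUnit * (lift negDeriv w * lift negDeriv w)) * imagUnit_sq
  rw [h5, map_sub, map_sub, map_sub, map_sub, map_add, map_add, mean_imagUnit_mul,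
    mean_imagUnit_mul, mean_imagUnit_mul, h2, h3, h4, mean_lift_dx, mean_lift_dx]
  simp

end Conservation

/-- The coefficients of the series `g` that solves `e^{-w} g + ε i P₊ ∂ₓ g = 1`, the transpose of
the linearised equation for `w`. Here `gₙ` is the gradient of `u ↦ ∫ wₙ₊₁(u) dx` for the pairing
`∫ p q dx`. -/
def gradDensity (u : TrigPoly) : ℕ → TrigPoly
  | 0 => 1
  | n + 1 => posDeriv (gradDensity u n) +
      ∑ i : Fin (n + 1), potential u (n - i) * gradDensity u i

theorem gradDensity_succ (u : TrigPoly) (n : ℕ) :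
    gradDensity u (n + 1) = posDeriv (gradDensity u n) +
      ∑ i ∈ Finset.range (n + 1), potential u (n - i) * gradDensity u i := by
  rw [gradDensity, Finset.sum_range]

theorem gradDensity_equation (u : TrigPoly) :
    expNeg (matsunoSeries u) * PowerSeries.mk (gradDensity u) -
      PowerSeries.X * lift posDeriv (PowerSeries.mk (gradDensity u)) = 1 := by
  rw [expNeg_matsunoSeries, sub_mul, one_mul, mul_assoc]
  ext1 n
  cases n with
  | zero => simp [gradDensity]
  | succ n =>
    rw [map_sub, map_sub, PowerSeries.coeff_succ_X_mul, PowerSeries.coeff_succ_X_mul, coeff_lift,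
      PowerSeries.coeff_mk, PowerSeries.coeff_mk, PowerSeries.coeff_one, if_neg n.succ_ne_zero,
      gradDensity_succ, mul_comm (PowerSeries.mk (potential u)), PowerSeries.coeff_mul,
      Finset.Nat.sum_antidiagonal_eq_sum_range_succ_mk]
    simp only [PowerSeries.coeff_mk]
    rw [Finset.sum_congr rfl fun i _ => mul_comm (gradDensity u i) (potential u (n - i))]
    abel

/-- Solving the linearised equation against `g`: the mean value of `η` only involves the right hand
side of the equation. -/
theorem mean_eq_of_linearised (u : TrigPoly) {η V : PowerSeries TrigPoly}
    (h : expNeg (matsunoSeries u) * η - PowerSeries.X * lift negDeriv η = PowerSeries.X * V) :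
    mean η = PowerSeries.X * mean (PowerSeries.mk (gradDensity u) * V) := by
  have h1 : PowerSeries.mk (gradDensity u) * (PowerSeries.X * V) =
      expNeg (matsunoSeries u) * PowerSeries.mk (gradDensity u) * η -
        PowerSeries.X * (PowerSeries.mk (gradDensity u) * lift negDeriv η) := by
    rw [← h]
    ring
  rw [← mean_X_mul, show PowerSeries.X * (PowerSeries.mk (gradDensity u) * V) =
    PowerSeries.mk (gradDensity u) * (PowerSeries.X * V) by ring, h1, map_sub, mean_X_mul,
    mean_mul_lift_negDeriv, ← mean_X_mul, ← map_sub]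
  congr 1
  linear_combination (-η) * gradDensity_equation u

/-- The Benjamin-Ono vector field `-H∂ₓ²v - 2v∂ₓv`. -/
def boField (v : TrigPoly) : TrigPoly := -hilbert (dx (dx v)) - 2 * (v * dx v)

theorem boField_eq (v : TrigPoly) :
    boField v = I • dx (dx v) - 2 * negDeriv (dx v) - 2 * (v * dx v) := by
  have h : -hilbert (dx (dx v)) = I • dx (dx v) - (2 : ℂ) • negDeriv (dx v) := by
    rw [← I_smul_projNeg_dx, projNeg]
    simp only [LinearMap.smul_apply, LinearMap.sub_apply, LinearMap.id_apply, smul_sub, smul_smul]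
    ring_nf
    simp
  rw [boField, h, two_smul ℂ, two_mul (negDeriv _)]

/-- The energies are conserved by the Benjamin-Ono equation: `gₙ`, the gradient of
`u ↦ ∫ wₙ₊₁(u) dx`, is orthogonal to the Benjamin-Ono vector field. -/
theorem gradDensity_mul_boField (u : TrigPoly) (n : ℕ) :
    (gradDensity u n * boField u).coeff 0 = 0 := by
  have hW := X_dvd_matsunoSeries u
  have h1 := linearised_evolution (expNeg_matsunoSeries u) (mk_potential u) (lift_dx_expNeg hW)
  have h2 := mean_evolution (expNeg_matsunoSeries u) (mk_potential u) (lift_dx_expNeg hW)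
  rw [mean_eq_of_linearised u h1] at h2
  have h3 := (mul_eq_zero.1 h2).resolve_left PowerSeries.X_ne_zero
  have liftC (T : TrigPoly →ₗ[ℂ] TrigPoly) (p : TrigPoly) :
      lift T (PowerSeries.C p) = PowerSeries.C (T p) := by
    ext1 k
    rw [coeff_lift, PowerSeries.coeff_C, PowerSeries.coeff_C]
    split_ifs
    · rfl
    · exact map_zero T
  have h4 : imagUnit * lift dx (lift dx (PowerSeries.C u)) -
      2 * lift negDeriv (lift dx (PowerSeries.C u)) -
      2 * (PowerSeries.C u * lift dx (PowerSeries.C u)) = PowerSeries.C (boField u) := by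
    rw [boField_eq, liftC, liftC, liftC, imagUnit_mul, map_sub, map_sub, map_mul, map_mul, map_mul,
      map_ofNat]
    congr 2
    ext1 k
    rw [PowerSeries.coeff_smul, PowerSeries.coeff_C, PowerSeries.coeff_C]
    split_ifs
    · rfl
    · exact smul_zero _
  rw [h4] at h3
  have h5 := congrArg (PowerSeries.coeff n) h3
  rwa [coeff_mean, PowerSeries.coeff_mul_C, PowerSeries.coeff_mk,
    (PowerSeries.coeff n).map_zero] at h5

/-! ### Differentiation along paths of trigonometric polynomials -/

/-- The path `p` of trigonometric polynomials, with frequencies in a fixed finite set, has the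
derivative `p'` at time `t`. -/
def HasCoeffDeriv (p : ℝ → TrigPoly) (p' : TrigPoly) (t : ℝ) : Prop :=
  (∃ S : Finset ℤ, ∀ s, (p s).coeff.support ⊆ S) ∧
    ∀ n, HasDerivAt (fun s => (p s).coeff n) (p'.coeff n) t

namespace HasCoeffDeriv

variable {p q : ℝ → TrigPoly} {p' q' : TrigPoly} {t : ℝ}

theorem unique (h₁ : HasCoeffDeriv p p' t) (h₂ : HasCoeffDeriv p q' t) : p' = q' := by
  ext n
  exact (h₁.2 n).unique (h₂.2 n)

theorem const (a : TrigPoly) (t : ℝ) : HasCoeffDeriv (fun _ => a) 0 t :=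
  ⟨⟨a.coeff.support, fun _ => subset_rfl⟩, fun _ => hasDerivAt_const _ _⟩

theorem add (hp : HasCoeffDeriv p p' t) (hq : HasCoeffDeriv q q' t) :
    HasCoeffDeriv (fun s => p s + q s) (p' + q') t := by
  obtain ⟨⟨S, hS⟩, hp⟩ := hp
  obtain ⟨⟨T, hT⟩, hq⟩ := hq
  exact ⟨⟨S ∪ T, fun s => Finsupp.support_add.trans (Finset.union_subset_union (hS s) (hT s))⟩,
    fun n => (hp n).add (hq n)⟩

theorem sum {ι : Type*} {J : Finset ι} {p : ι → ℝ → TrigPoly} {p' : ι → TrigPoly}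
    (h : ∀ i ∈ J, HasCoeffDeriv (p i) (p' i) t) :
    HasCoeffDeriv (fun s => ∑ i ∈ J, p i s) (∑ i ∈ J, p' i) t := by
  classical
  induction J using Finset.induction_on with
  | empty => simpa using const 0 t
  | insert i J hi ih =>
    simp only [Finset.sum_insert hi]
    exact (h i (Finset.mem_insert_self i J)).add
      (ih fun j hj => h j (Finset.mem_insert_of_mem hj))

theorem mul (hp : HasCoeffDeriv p p' t) (hq : HasCoeffDeriv q q' t) :
    HasCoeffDeriv (fun s => p s * q s) (p' * q t + p t * q') t := by
  obtain ⟨⟨S, hS⟩, hp⟩ := hp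
  obtain ⟨⟨T, hT⟩, hq⟩ := hq
  refine ⟨⟨Finset.image₂ (· + ·) S T, fun s n hn => ?_⟩, fun n => ?_⟩
  · by_contra hc
    refine Finsupp.mem_support_iff.1 hn ?_
    rw [coeff_mul_of_subset _ _ _ (hS s)]
    refine Finset.sum_eq_zero fun a ha => ?_
    have h : n - a ∉ T := fun hT' => hc (Finset.mem_image₂.2 ⟨a, ha, n - a, hT', by simp⟩)
    rw [Finsupp.notMem_support_iff.1 (fun h' => h (hT s h')), mul_zero]
  · have hS' : p'.coeff.support ⊆ S := fun a ha => by
      by_contra hc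
      have h0 : (fun s => (p s).coeff a) = fun _ => 0 := funext fun s =>
        Finsupp.notMem_support_iff.1 fun h' => hc (hS s h')
      have h1 := hp a
      rw [h0] at h1
      exact Finsupp.mem_support_iff.1 ha (h1.unique (hasDerivAt_const _ _))
    simp only [coeff_mul_of_subset _ _ _ (hS _)]
    rw [AddMonoidAlgebra.coeff_add, Finsupp.add_apply, coeff_mul_of_subset _ _ _ hS',
      coeff_mul_of_subset _ _ _ (hS t), ← Finset.sum_add_distrib]
    exact HasDerivAt.fun_sum fun a _ => (hp a).mul (hq (n - a))

theorem smul (c : ℂ) (hp : HasCoeffDeriv p p' t) : HasCoeffDeriv (fun s => c • p s) (c • p') t := by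
  obtain ⟨⟨S, hS⟩, hp⟩ := hp
  exact ⟨⟨S, fun s => Finsupp.support_smul.trans (hS s)⟩, fun n => (hp n).const_smul c⟩

theorem multiplier (σ : ℤ → ℂ) (hp : HasCoeffDeriv p p' t) :
    HasCoeffDeriv (fun s => multiplier σ (p s)) (multiplier σ p') t := by
  obtain ⟨⟨S, hS⟩, hp⟩ := hp
  refine ⟨⟨S, fun s n hn => hS s ?_⟩, fun n => ?_⟩
  · rw [Finsupp.mem_support_iff, multiplier_coeff] at hn
    exact Finsupp.mem_support_iff.2 (right_ne_zero_of_mul hn)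
  · simp only [multiplier_coeff]
    exact (hp n).const_mul (σ n)

end HasCoeffDeriv

/-- Coefficientwise differentiation of a path of power series. -/
def HasSeriesDeriv (W : ℝ → PowerSeries TrigPoly) (W' : PowerSeries TrigPoly) (t : ℝ) : Prop :=
  ∀ n, HasCoeffDeriv (fun s => PowerSeries.coeff n (W s)) (PowerSeries.coeff n W') t

namespace HasSeriesDeriv

variable {W Z : ℝ → PowerSeries TrigPoly} {W' Z' : PowerSeries TrigPoly} {t : ℝ}

theorem unique (h₁ : HasSeriesDeriv W W' t) (h₂ : HasSeriesDeriv W Z' t) : W' = Z' := by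
  ext1 n
  exact (h₁ n).unique (h₂ n)

theorem mul (hW : HasSeriesDeriv W W' t) (hZ : HasSeriesDeriv Z Z' t) :
    HasSeriesDeriv (fun s => W s * Z s) (W' * Z t + W t * Z') t := by
  intro n
  rw [map_add]
  simp only [PowerSeries.coeff_mul]
  rw [← Finset.sum_add_distrib]
  exact HasCoeffDeriv.sum fun i _ => (hW _).mul (hZ _)

theorem pow_succ (hW : HasSeriesDeriv W W' t) (k : ℕ) :
    HasSeriesDeriv (fun s => W s ^ (k + 1)) (((k + 1 : ℕ) : ℂ) • (W t ^ k * W')) t := by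
  rw [Nat.cast_smul_eq_nsmul, nsmul_eq_mul]
  induction k with
  | zero => simpa using hW
  | succ k ih =>
    have h := ih.mul hW
    simp only [← _root_.pow_succ] at h
    convert h using 1
    push_cast
    ring

theorem pow (hW : HasSeriesDeriv W W' t) (k : ℕ) :
    ∃ Y, HasSeriesDeriv (fun s => W s ^ k) Y t := by
  cases k with
  | zero =>
    refine ⟨0, fun n => ?_⟩
    simp only [pow_zero, map_zero]
    exact HasCoeffDeriv.const _ t
  | succ k => exact ⟨_, hW.pow_succ k⟩

theorem expNegSum (hW : HasSeriesDeriv W W' t) (M : ℕ) :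
    HasSeriesDeriv (fun s => expNegSum (W s) (M + 1)) (-(expNegSum (W t) M * W')) t := by
  intro n
  have h : PowerSeries.coeff n (-(BenjaminOno.expNegSum (W t) M * W')) =
      ∑ k ∈ Finset.range (M + 1), ((-1 : ℂ) ^ (k + 1) / ((k + 1).factorial : ℂ)) •
        PowerSeries.coeff n (((k + 1 : ℕ) : ℂ) • (W t ^ k * W')) + 0 := by
    rw [BenjaminOno.expNegSum, Finset.sum_mul, ← Finset.sum_neg_distrib, map_sum, add_zero]
    refine Finset.sum_congr rfl fun k _ => ?_
    rw [PowerSeries.coeff_smul, smul_smul, factorial_coeff, map_neg, smul_mul_assoc, neg_smul,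
      PowerSeries.coeff_smul]
  rw [h]
  simp only [BenjaminOno.expNegSum, Finset.sum_range_succ' _ (M + 1), map_add, map_sum,
    PowerSeries.coeff_smul, pow_zero (W _)]
  refine HasCoeffDeriv.add (HasCoeffDeriv.sum fun k _ => ?_) (HasCoeffDeriv.const _ t)
  exact (hW.pow_succ k n).smul _

theorem expNeg (hX : ∀ s, PowerSeries.X ∣ W s) (hW : HasSeriesDeriv W W' t) :
    HasSeriesDeriv (fun s => expNeg (W s)) (-(expNeg (W t) * W')) t := by
  intro n
  simp only [coeff_expNeg (hX _) n.le_succ]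
  rw [map_neg, coeff_expNeg_mul (hX t), ← map_neg]
  exact hW.expNegSum n n

end HasSeriesDeriv

/-! ### The derivative of the energies -/

theorem exists_hasCoeffDeriv_matsunoDensity {v : ℝ → TrigPoly} {v' : TrigPoly} {t : ℝ}
    (hv : HasCoeffDeriv v v' t) (n : ℕ) :
    ∃ η, HasCoeffDeriv (fun s => matsunoDensity (v s) n) η t := by
  induction n using Nat.strong_induction_on with
  | _ n ih =>
    cases n with
    | zero =>
      simp only [matsunoDensity]
      exact ⟨0, HasCoeffDeriv.const 0 t⟩
    | succ n =>
      choose η hη using ih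
      have hV : HasSeriesDeriv (fun s => PowerSeries.mk fun j =>
          if _h : j < n + 1 then matsunoDensity (v s) j else 0)
          (PowerSeries.mk fun j => if h : j < n + 1 then η j h else 0) t := by
        intro j
        simp only [PowerSeries.coeff_mk]
        split_ifs with hj
        · exact hη j hj
        · exact HasCoeffDeriv.const 0 t
      choose Y hY using hV.pow
      simp only [matsunoDensity, I_smul_projNeg_dx]
      have h0 : HasCoeffDeriv (fun s => if n = 0 then v s else 0) (if n = 0 then v' else 0) t := by
        split_ifs
        · exact hv
        · exact HasCoeffDeriv.const 0 t
      exact ⟨_, (((hη n n.lt_succ_self).multiplier _).add h0).add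
        (HasCoeffDeriv.sum fun k _ => (hY k (n + 1)).smul _)⟩

/-- `gₙ` is the gradient of the mean value of `wₙ₊₁`. -/
theorem hasDerivAt_mean_matsunoDensity {v : ℝ → TrigPoly} {v' : TrigPoly} {t : ℝ}
    (hv : HasCoeffDeriv v v' t) (n : ℕ) :
    HasDerivAt (fun s => (matsunoDensity (v s) (n + 1)).coeff 0)
      ((gradDensity (v t) n * v').coeff 0) t := by
  choose η hη using exists_hasCoeffDeriv_matsunoDensity hv
  have hW : HasSeriesDeriv (fun s => matsunoSeries (v s)) (PowerSeries.mk η) t := fun j => by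
    simp only [matsunoSeries, PowerSeries.coeff_mk]
    exact hη j
  have h1 := hW.expNeg fun s => X_dvd_matsunoSeries (v s)
  have h2 : HasSeriesDeriv (fun s => expNeg (matsunoSeries (v s)))
      (-(PowerSeries.X * (PowerSeries.C v' + lift negDeriv (PowerSeries.mk η)))) t := by
    intro j
    simp only [expNeg_matsunoSeries]
    cases j with
    | zero => simpa using HasCoeffDeriv.const 1 t
    | succ j =>
      simp only [map_sub, map_neg, PowerSeries.coeff_succ_X_mul, PowerSeries.coeff_one,
        if_neg j.succ_ne_zero, zero_sub, PowerSeries.coeff_mk, map_add, coeff_lift, potential,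
        PowerSeries.coeff_C]
      have h3 : HasCoeffDeriv (fun s => negDeriv (matsunoDensity (v s) j) +
          if j = 0 then v s else 0) (negDeriv (η j) + if j = 0 then v' else 0) t := by
        refine ((hη j).multiplier _).add ?_
        split_ifs
        · exact hv
        · exact HasCoeffDeriv.const 0 t
      have h4 := h3.smul (-1)
      simp only [neg_one_smul] at h4
      rwa [add_comm (negDeriv (η j))] at h4
  have h5 : expNeg (matsunoSeries (v t)) * PowerSeries.mk η -
      PowerSeries.X * lift negDeriv (PowerSeries.mk η) = PowerSeries.X * PowerSeries.C v' := by
    have h := neg_inj.1 (h1.unique h2)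
    rw [h]
    ring
  have h6 := congrArg (PowerSeries.coeff (n + 1)) (mean_eq_of_linearised (v t) h5)
  rw [PowerSeries.coeff_succ_X_mul, coeff_mean, coeff_mean, PowerSeries.coeff_mk,
    PowerSeries.coeff_mul_C, PowerSeries.coeff_mk] at h6
  rw [← h6]
  exact (hη (n + 1)).2 0

theorem hasDerivAt_energy {p : ℝ → TrigPoly} {p' : TrigPoly} {t : ℝ} (hp : HasCoeffDeriv p p' t)
    (k : ℕ) :
    HasDerivAt (fun s => energy k (p s))
      (8 * (2 * Real.pi * (gradDensity ((1 / 2 : ℂ) • p t) (k + 1) *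
        ((1 / 2 : ℂ) • p')).coeff 0) : ℂ).re t := by
  simp only [energy, torusIntegral_eq]
  have h := ((hasDerivAt_mean_matsunoDensity (hp.smul (1 / 2)) (k + 1)).const_mul
    (2 * Real.pi : ℂ)).const_mul (8 : ℂ)
  exact (Complex.reCLM.hasFDerivAt.comp_hasDerivAt t h)

/-- The part `p - π_N p` of a trigonometric polynomial on the frequencies `|n| > N`. -/
def highPart (N : ℕ) (p : TrigPoly) : TrigPoly := p - dirichletProj N p

theorem highPart_coeff (N : ℕ) (p : TrigPoly) (n : ℤ) :
    (highPart N p).coeff n = if |n| ≤ (N : ℤ) then 0 else p.coeff n := by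
  rw [highPart, AddMonoidAlgebra.coeff_sub, Finsupp.sub_apply, dirichletProj, multiplier_coeff]
  split_ifs <;> simp

theorem trunc_coeff {s : ℝ} (N : ℕ) (u : Sobolev s) (n : ℤ) :
    (trunc N u).coeff n = if |n| ≤ (N : ℤ) then fc u n else 0 := by
  rw [trunc, AddMonoidAlgebra.coeff_sum, Finsupp.finsetSum_apply]
  simp only [AddMonoidAlgebra.coeff_single, Finsupp.single_apply, Finset.sum_ite_eq',
    Finset.mem_Icc, abs_le]

theorem hasCoeffDeriv_trunc {s : ℝ} {N : ℕ} {u₀ : Sobolev s} {u : ℝ → Sobolev s}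
    (hu : IsTruncatedSolution N u₀ u) (t : ℝ) :
    HasCoeffDeriv (fun τ => trunc N (u τ)) (-hilbert (dx (dx (trunc N (u t)))) -
      dirichletProj N (trunc N (u t) * dx (trunc N (u t)))) t := by
  refine ⟨⟨Finset.Icc (-(N : ℤ)) N, fun τ n hn => ?_⟩, fun n => ?_⟩
  · by_contra hc
    rw [Finset.mem_Icc, ← abs_le] at hc
    rw [Finsupp.mem_support_iff, trunc_coeff, if_neg hc] at hn
    exact hn rfl
  · simp only [trunc_coeff]
    rw [AddMonoidAlgebra.coeff_sub, Finsupp.sub_apply, AddMonoidAlgebra.coeff_neg,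
      Finsupp.neg_apply, hilbert, multiplier_coeff, dx_coeff, dx_coeff, trunc_coeff]
    split_ifs with h
    · convert hu.2.2 t n using 1
      ring
    · have h1 (q : TrigPoly) : (dirichletProj N q).coeff n = 0 := by
        rw [dirichletProj, multiplier_coeff, if_neg h, zero_mul]
      rw [h1]
      simpa using hasDerivAt_const t (0 : ℂ)

/-- The derivative of the energies along the truncated flow: since the Benjamin-Ono field conserves
them, only the part `|n| > N` of the nonlinearity, which the truncation discards, contributes. -/
theorem hasDerivAt_energy_truncatedFlow {s : ℝ} {N : ℕ} {u : Sobolev s}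
    (hu : ∃ w : ℝ → Sobolev s, IsTruncatedSolution N u w) (k : ℕ) :
    HasDerivAt (fun t => energy k (trunc N (truncatedFlow N t u)))
      (16 * Real.pi * (gradDensity ((1 / 2 : ℂ) • trunc N u) (k + 1) *
        highPart N (dx (((1 / 2 : ℂ) • trunc N u) * ((1 / 2 : ℂ) • trunc N u)))).coeff 0 : ℂ).re
      0 := by
  have hf : ∀ t, truncatedFlow N t u = hu.choose t := fun t => by rw [truncatedFlow, dif_pos hu]
  simp only [hf]
  have h := hasDerivAt_energy (hasCoeffDeriv_trunc hu.choose_spec 0) k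
  rw [hu.choose_spec.2.1] at h
  convert h using 2
  set v := (1 / 2 : ℂ) • trunc N u with hv
  have hp : trunc N u = (2 : ℂ) • v := by rw [hv, smul_smul]; norm_num
  clear_value v
  have h1 : (1 / 2 : ℂ) • (-hilbert (dx (dx (trunc N u))) -
      dirichletProj N (trunc N u * dx (trunc N u))) =
      boField v + highPart N (dx (v * v)) := by
    rw [hp, map_smul, map_smul, map_smul, smul_mul_smul_comm, map_smul, smul_sub, ← smul_neg,
      smul_smul, smul_smul, highPart, boField, dx_mul, mul_comm (dx v) v, map_add, ← two_mul]
    norm_num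
    exact two_smul ℂ _
  rw [h1, mul_add, AddMonoidAlgebra.coeff_add, Finsupp.add_apply, gradDensity_mul_boField, zero_add]
  ring

/-! ### A weight adapted to convolution and truncation -/

/-- The weight `(1 + |n|)⁻ˢ`. -/
def decay (s : ℝ) (n : ℤ) : ℝ := (1 + |(n : ℝ)|) ^ (-s)

theorem decay_pos (s : ℝ) (n : ℤ) : 0 < decay s n := Real.rpow_pos_of_pos (by positivity) _

theorem summable_decay {s : ℝ} (hs : 1 < s) : Summable (decay s) := by
  refine Summable.of_norm_bounded_eventually (Real.summable_abs_int_rpow hs) ?_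
  refine (Set.finite_singleton (0 : ℤ)).subset fun n hn => ?_
  by_contra h0
  refine hn ?_
  have h : (0 : ℝ) < |(n : ℝ)| := abs_pos.2 (Int.cast_ne_zero.2 h0)
  change ‖decay s n‖ ≤ |(n : ℝ)| ^ (-s)
  rw [Real.norm_of_nonneg (decay_pos s n).le]
  exact Real.rpow_le_rpow_of_nonpos h (by linarith) (by linarith)

theorem sum_decay_sub_le {s : ℝ} (hs : 1 < s) (S : Finset ℤ) (c : ℤ) :
    ∑ a ∈ S, decay s (a - c) ≤ ∑' n, decay s n := by
  have h := (Equiv.subRight c).summable_iff.2 (summable_decay hs)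
  rw [← (Equiv.subRight c).tsum_eq (decay s)]
  exact h.sum_le_tsum S fun n _ => (decay_pos _ _).le

theorem decay_neg (s : ℝ) (n : ℤ) : decay s (-n) = decay s n := by
  rw [decay, decay, Int.cast_neg, abs_neg]

theorem sum_decay_sub_le' {s : ℝ} (hs : 1 < s) (S : Finset ℤ) (c : ℤ) :
    ∑ a ∈ S, decay s (c - a) ≤ ∑' n, decay s n := by
  simp only [← decay_neg s (c - _), neg_sub]
  exact sum_decay_sub_le hs S c

/-- The weight `(1 + |n|)^{-σ} (1 + (|n| - N)₊)^{-3/4}`. It is stable under convolution, uniformly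
in `N`, and its squares have a sum `O((N + 1)^{-2σ})` over `|n| > N`. -/
def weight (σ : ℝ) (N : ℕ) (n : ℤ) : ℝ :=
  decay σ n * (1 + max (|(n : ℝ)| - N) 0) ^ (-(3 / 4) : ℝ)

theorem weight_pos (σ : ℝ) (N : ℕ) (n : ℤ) : 0 < weight σ N n :=
  mul_pos (decay_pos _ _) (Real.rpow_pos_of_pos (by positivity) _)

theorem weight_neg (σ : ℝ) (N : ℕ) (n : ℤ) : weight σ N (-n) = weight σ N n := by
  rw [weight, weight, decay_neg, Int.cast_neg, abs_neg]

theorem weight_of_le (σ : ℝ) {N : ℕ} {n : ℤ} (h : |n| ≤ N) : weight σ N n = decay σ n := by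
  have h' : |(n : ℝ)| ≤ N := by exact_mod_cast h
  rw [weight, max_eq_right (by linarith), add_zero, Real.one_rpow, mul_one]

/-- The weights at the larger frequency `c` and at `b + c` are comparable up to `(1 + |b|)^{3/4}`. This
loss and the additional factor `1 + |b|` are absorbed by the decay at `b`, whence `σ - 7/4`. -/
theorem mul_weight_le {σ : ℝ} (hσ : 11 / 4 < σ) (N : ℕ) (b c : ℤ) (h : |b| ≤ |c|) :
    (1 + |(b : ℝ)|) * (weight σ N b * weight σ N c) ≤
      2 ^ σ * weight σ N (b + c) * decay (σ - 7 / 4) b := by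
  have h' : |(b : ℝ)| ≤ |(c : ℝ)| := by exact_mod_cast h
  have htri : |((b + c : ℤ) : ℝ)| ≤ |(b : ℝ)| + |(c : ℝ)| := by
    push_cast
    exact abs_add_le _ _
  set B := |(b : ℝ)| with hB
  set T := |((b + c : ℤ) : ℝ)| with hT
  have hB0 : 0 ≤ B := abs_nonneg _
  have hT0 : 0 ≤ T := abs_nonneg _
  have h1 : decay σ c ≤ 2 ^ σ * decay σ (b + c) := by
    have e : 2 ^ σ * decay σ (b + c) = ((1 + T) / 2) ^ (-σ) := by
      rw [decay, Real.div_rpow (by positivity) (by norm_num),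
        Real.rpow_neg (by norm_num : (0 : ℝ) ≤ 2), div_inv_eq_mul, mul_comm]
    rw [e, decay]
    exact Real.rpow_le_rpow_of_nonpos (by positivity) (by linarith) (by linarith)
  have h2 : (1 + max (|(c : ℝ)| - N) 0) ^ (-(3 / 4) : ℝ) ≤
      (1 + max (T - N) 0) ^ (-(3 / 4) : ℝ) * (1 + B) ^ (3 / 4 : ℝ) := by
    have e : (1 + max (T - N) 0) ^ (-(3 / 4) : ℝ) * (1 + B) ^ (3 / 4 : ℝ) =
        ((1 + max (T - N) 0) / (1 + B)) ^ (-(3 / 4) : ℝ) := by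
      rw [Real.div_rpow (by positivity) (by positivity), Real.rpow_neg (by positivity : 0 ≤ 1 + B),
        div_inv_eq_mul]
    rw [e]
    refine Real.rpow_le_rpow_of_nonpos (by positivity) ?_ (by norm_num)
    rw [div_le_iff₀ (by positivity)]
    have m0 := le_max_right (|(c : ℝ)| - N) 0
    have m1 := le_max_left (|(c : ℝ)| - N) 0
    have m2 : max (T - N) 0 ≤ max (|(c : ℝ)| - N) 0 + B :=
      max_le (by linarith) (by linarith)
    nlinarith [mul_nonneg m0 hB0]
  have h3 : (1 + max (B - N) 0) ^ (-(3 / 4) : ℝ) ≤ 1 :=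
    Real.rpow_le_one_of_one_le_of_nonpos (by linarith [le_max_right (B - N) 0]) (by norm_num)
  have h4 : decay (σ - 7 / 4) b = (1 + B) * decay σ b * (1 + B) ^ (3 / 4 : ℝ) := by
    rw [decay, decay, ← hB]
    nth_rewrite 2 [← Real.rpow_one (1 + B)]
    rw [← Real.rpow_add (by positivity), ← Real.rpow_add (by positivity)]
    congr 1
    ring
  have hd := (decay_pos σ b).le
  calc (1 + B) * (weight σ N b * weight σ N c)
      = (1 + B) * decay σ b * (1 + max (B - N) 0) ^ (-(3 / 4) : ℝ) *
        (decay σ c * (1 + max (|(c : ℝ)| - N) 0) ^ (-(3 / 4) : ℝ)) := by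
        rw [weight, weight]; ring
    _ ≤ (1 + B) * decay σ b * 1 * ((2 ^ σ * decay σ (b + c)) *
        ((1 + max (T - N) 0) ^ (-(3 / 4) : ℝ) * (1 + B) ^ (3 / 4 : ℝ))) := by
        have := decay_pos σ c
        have := decay_pos σ (b + c)
        gcongr
    _ = 2 ^ σ * weight σ N (b + c) * decay (σ - 7 / 4) b := by
        rw [h4, weight]; ring

/-- The constant of the convolution inequality for `weight σ N`. -/
def convConst (σ : ℝ) : ℝ := 2 ^ σ * (2 * ∑' n, decay (σ - 7 / 4) n)

theorem convConst_nonneg (σ : ℝ) : 0 ≤ convConst σ :=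
  mul_nonneg (by positivity) (mul_nonneg zero_le_two (tsum_nonneg fun n => (decay_pos _ n).le))

/-- The convolution inequality for `weight σ N`, with room for the smaller of the frequencies of the
two factors. -/
theorem sum_min_mul_weight_le {σ : ℝ} (hσ : 11 / 4 < σ) (N : ℕ) (S : Finset ℤ) (n : ℤ) :
    ∑ a ∈ S, (1 + min |(a : ℝ)| |((n - a : ℤ) : ℝ)|) * (weight σ N a * weight σ N (n - a)) ≤
      convConst σ * weight σ N n := by
  have hp (a : ℤ) : (1 + min |(a : ℝ)| |((n - a : ℤ) : ℝ)|) * (weight σ N a * weight σ N (n - a)) ≤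
      2 ^ σ * weight σ N n * (decay (σ - 7 / 4) a + decay (σ - 7 / 4) (n - a)) := by
    have hw := weight_pos σ N n
    have d1 := decay_pos (σ - 7 / 4) a
    have d2 := decay_pos (σ - 7 / 4) (n - a)
    have h2 : (0 : ℝ) < 2 ^ σ := by positivity
    rcases le_total |a| |n - a| with h | h
    · have h' : |(a : ℝ)| ≤ |((n - a : ℤ) : ℝ)| := by exact_mod_cast h
      rw [min_eq_left h', mul_add]
      have := mul_weight_le hσ N a (n - a) h
      rw [add_sub_cancel] at this
      have : 0 < 2 ^ σ * weight σ N n * decay (σ - 7 / 4) (n - a) := by positivity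
      linarith
    · have h' : |((n - a : ℤ) : ℝ)| ≤ |(a : ℝ)| := by exact_mod_cast h
      rw [min_eq_right h', mul_add, mul_comm (weight σ N a)]
      have := mul_weight_le hσ N (n - a) a h
      rw [sub_add_cancel] at this
      have : 0 < 2 ^ σ * weight σ N n * decay (σ - 7 / 4) a := by positivity
      linarith
  refine (Finset.sum_le_sum fun a _ => hp a).trans ?_
  rw [← Finset.mul_sum, Finset.sum_add_distrib, convConst, mul_assoc, mul_assoc,
    mul_comm (weight σ N n)]
  have h1 := sum_decay_sub_le (show 1 < σ - 7 / 4 by linarith) S 0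
  have h2 := sum_decay_sub_le' (show 1 < σ - 7 / 4 by linarith) S n
  simp only [sub_zero] at h1
  have hw := weight_pos σ N n
  gcongr
  linarith

theorem sum_weight_mul_weight_le {σ : ℝ} (hσ : 11 / 4 < σ) (N : ℕ) (S : Finset ℤ) (n : ℤ) :
    ∑ a ∈ S, weight σ N a * weight σ N (n - a) ≤ convConst σ * weight σ N n := by
  refine (Finset.sum_le_sum fun a _ => ?_).trans (sum_min_mul_weight_le hσ N S n)
  refine le_mul_of_one_le_left (mul_pos (weight_pos _ _ _) (weight_pos _ _ _)).le ?_
  have := le_min (abs_nonneg (a : ℝ)) (abs_nonneg ((n - a : ℤ) : ℝ))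
  linarith

theorem sum_weight_sq_le {σ : ℝ} (hσ : 0 ≤ σ) (N : ℕ) (S : Finset ℤ) (hS : ∀ a ∈ S, (N : ℤ) < |a|) :
    ∑ a ∈ S, weight σ N a ^ 2 ≤ ((N : ℝ) + 1) ^ (-(2 * σ)) * (2 * ∑' n, decay (3 / 2) n) := by
  have hp : ∀ a ∈ S, weight σ N a ^ 2 ≤ ((N : ℝ) + 1) ^ (-(2 * σ)) *
      (decay (3 / 2) (a - (N : ℤ)) + decay (3 / 2) (a - (-(N : ℤ)))) := by
    intro a ha
    have hN : (N : ℝ) + 1 ≤ |(a : ℝ)| := by exact_mod_cast hS a ha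
    have h1 : decay σ a ≤ ((N : ℝ) + 1) ^ (-σ) :=
      Real.rpow_le_rpow_of_nonpos (by positivity) (by linarith) (by linarith)
    have h2 : weight σ N a ^ 2 ≤ ((N : ℝ) + 1) ^ (-(2 * σ)) *
        (1 + (|(a : ℝ)| - N)) ^ (-(3 / 2) : ℝ) := by
      have e1 : ((N : ℝ) + 1) ^ (-(2 * σ)) = (((N : ℝ) + 1) ^ (-σ)) ^ 2 := by
        rw [← Real.rpow_natCast, ← Real.rpow_mul (by positivity)]
        congr 1; push_cast; ring
      have e2 : (1 + (|(a : ℝ)| - N)) ^ (-(3 / 2) : ℝ) =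
          ((1 + (|(a : ℝ)| - N)) ^ (-(3 / 4) : ℝ)) ^ 2 := by
        rw [← Real.rpow_natCast, ← Real.rpow_mul (by linarith)]
        congr 1; push_cast; ring
      rw [weight, max_eq_left (by linarith), mul_pow, e1, e2]
      have := decay_pos σ a
      gcongr
    refine h2.trans (mul_le_mul_of_nonneg_left ?_ (by positivity))
    rcases le_total 0 a with h0 | h0
    · have h0' : (0 : ℝ) ≤ a := by exact_mod_cast h0
      rw [abs_of_nonneg h0'] at hN ⊢
      have e : decay (3 / 2) (a - (N : ℤ)) = (1 + ((a : ℝ) - N)) ^ (-(3 / 2) : ℝ) := by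
        rw [decay]; push_cast; rw [abs_of_nonneg (by linarith)]
      rw [e]
      linarith [decay_pos (3 / 2) (a - (-(N : ℤ)))]
    · have h0' : (a : ℝ) ≤ 0 := by exact_mod_cast h0
      rw [abs_of_nonpos h0'] at hN ⊢
      have e : decay (3 / 2) (a - (-(N : ℤ))) = (1 + (-(a : ℝ) - N)) ^ (-(3 / 2) : ℝ) := by
        rw [decay]; push_cast; rw [abs_of_nonpos (by linarith)]; congr 1; ring
      rw [e]
      linarith [decay_pos (3 / 2) (a - (N : ℤ))]
  refine (Finset.sum_le_sum hp).trans ?_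
  rw [← Finset.mul_sum, Finset.sum_add_distrib]
  have h1 := sum_decay_sub_le (show (1 : ℝ) < 3 / 2 by norm_num) S N
  have h2 := sum_decay_sub_le (show (1 : ℝ) < 3 / 2 by norm_num) S (-(N : ℤ))
  gcongr
  linarith

/-! ### Orders of magnitude of the densities, uniformly in the truncation -/

/-- A real valued trigonometric polynomial `v` with frequencies `|n| ≤ N` and with
`|v̂(n)| ≤ M (1 + |n|)^{-σ}`. The estimates below are uniform in such data. -/
structure Datum (σ : ℝ) where
  /-- the truncation parameter -/
  N : ℕ
  /-- the size of the coefficients -/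
  M : ℝ
  /-- the trigonometric polynomial -/
  v : TrigPoly
  M_nonneg : 0 ≤ M
  conj_coeff : ∀ n, v.coeff (-n) = conj (v.coeff n)
  coeff_eq_zero : ∀ n : ℤ, (N : ℤ) < |n| → v.coeff n = 0
  norm_coeff_le : ∀ n, ‖v.coeff n‖ ≤ M * decay σ n

namespace Datum

variable {σ : ℝ}

/-- The scale `N + 1` of the largest frequencies. -/
def L (D : Datum σ) : ℝ := D.N + 1

/-- The unit `(1 + M)ⁿ Lⁿ⁻ᵈ` in which the part of degree at least `d` in `v` of the `n`-th densities
is measured: such a part carries at most `n - d` derivatives, each of which costs a factor `L`, and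
at most `n` factors `v`. -/
def size (D : Datum σ) (d n : ℕ) : ℝ := ((1 + D.M) * D.L) ^ n * (D.L⁻¹) ^ d

variable (D : Datum σ)

theorem one_le_L : 1 ≤ D.L := by
  have : (0 : ℝ) ≤ D.N := Nat.cast_nonneg _
  rw [L]
  linarith

theorem L_pos : 0 < D.L := zero_lt_one.trans_le D.one_le_L

theorem size_nonneg (d n : ℕ) : 0 ≤ D.size d n := by
  have := D.L_pos
  have := D.M_nonneg
  rw [size]
  positivity

theorem size_mul (d₁ d₂ n₁ n₂ : ℕ) : D.size d₁ n₁ * D.size d₂ n₂ = D.size (d₁ + d₂) (n₁ + n₂) := by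
  rw [size, size, size, pow_add, pow_add]
  ring

theorem size_anti {d₁ d₂ : ℕ} (h : d₁ ≤ d₂) (n : ℕ) : D.size d₂ n ≤ D.size d₁ n := by
  have := D.L_pos
  have := D.M_nonneg
  rw [size, size]
  refine mul_le_mul_of_nonneg_left ?_ (by positivity)
  exact pow_le_pow_of_le_one (by positivity) (inv_le_one_of_one_le₀ D.one_le_L) h

theorem L_mul_size_le (d n : ℕ) : D.L * D.size d n ≤ D.size d (n + 1) := by
  have h1 := D.L_pos
  have h2 := D.M_nonneg
  have h3 : D.size d (n + 1) = (1 + D.M) * (D.L * D.size d n) := by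
    rw [size, size, pow_succ]
    ring
  rw [h3]
  exact le_mul_of_one_le_left (mul_nonneg h1.le (D.size_nonneg _ _)) (by linarith)

theorem norm_coeff_le_weight (n : ℤ) : ‖D.v.coeff n‖ ≤ D.M * weight σ D.N n := by
  rcases le_or_gt |n| (D.N : ℤ) with h | h
  · rw [weight_of_le σ h]
    exact D.norm_coeff_le n
  · rw [D.coeff_eq_zero n h, norm_zero]
    exact mul_nonneg D.M_nonneg (weight_pos _ _ _).le

end Datum

/-- The family `z` of trigonometric polynomials has the frequencies and the size of the terms of
degree at least `d` of the `n`-th densities. -/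
def HasOrder {σ : ℝ} (d n : ℕ) (z : Datum σ → TrigPoly) : Prop :=
  ∃ C : ℝ, 0 ≤ C ∧ ∀ D : Datum σ, (∀ p : ℤ, (n * D.N : ℤ) < |p| → (z D).coeff p = 0) ∧
    ∀ p, ‖(z D).coeff p‖ ≤ C * D.size d n * weight σ D.N p

namespace HasOrder

variable {σ : ℝ} {d n : ℕ} {z y : Datum σ → TrigPoly}

theorem zero (d n : ℕ) : HasOrder d n fun _ : Datum σ => 0 :=
  ⟨0, le_rfl, fun D => ⟨fun p _ => rfl, fun p => by simp⟩⟩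

theorem one : HasOrder 0 0 fun _ : Datum σ => 1 := by
  refine ⟨1, zero_le_one, fun D => ⟨fun p hp => ?_, fun p => ?_⟩⟩
  · have : p ≠ 0 := by
      rintro rfl
      simp at hp
    rw [AddMonoidAlgebra.one_def, AddMonoidAlgebra.coeff_single,
      Finsupp.single_eq_of_ne this]
  · rw [AddMonoidAlgebra.one_def, AddMonoidAlgebra.coeff_single, Finsupp.single_apply]
    split_ifs with h
    · subst h
      rw [weight_of_le σ (by simp)]
      simp [Datum.size, decay]
    · rw [norm_zero]
      have := weight_pos σ D.N p
      have := D.size_nonneg 0 0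
      positivity

theorem self : HasOrder 1 1 fun D : Datum σ => D.v := by
  refine ⟨1, zero_le_one, fun D => ⟨fun p hp => D.coeff_eq_zero p (by simpa using hp), fun p => ?_⟩⟩
  have h : D.size 1 1 = 1 + D.M := by
    have := D.L_pos.ne'
    rw [Datum.size]
    field_simp
  rw [h, one_mul]
  refine (D.norm_coeff_le_weight p).trans (mul_le_mul_of_nonneg_right ?_ (weight_pos _ _ _).le)
  linarith

theorem anti {d' : ℕ} (h : d' ≤ d) (hz : HasOrder d n z) : HasOrder d' n z := by
  obtain ⟨C, hC, hz⟩ := hz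
  refine ⟨C, hC, fun D => ⟨(hz D).1, fun p => ((hz D).2 p).trans ?_⟩⟩
  have := weight_pos σ D.N p
  have := D.size_anti h n
  gcongr

theorem add (hz : HasOrder d n z) (hy : HasOrder d n y) : HasOrder d n fun D => z D + y D := by
  obtain ⟨C, hC, hz⟩ := hz
  obtain ⟨B, hB, hy⟩ := hy
  refine ⟨C + B, add_nonneg hC hB, fun D => ⟨fun p hp => ?_, fun p => ?_⟩⟩
  · rw [AddMonoidAlgebra.coeff_add, Finsupp.add_apply, (hz D).1 p hp, (hy D).1 p hp, add_zero]
  · rw [AddMonoidAlgebra.coeff_add, Finsupp.add_apply, add_mul, add_mul]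
    exact (norm_add_le _ _).trans (add_le_add ((hz D).2 p) ((hy D).2 p))

theorem sum {ι : Type*} {J : Finset ι} {z : ι → Datum σ → TrigPoly}
    (h : ∀ i ∈ J, HasOrder d n (z i)) : HasOrder d n fun D => ∑ i ∈ J, z i D := by
  classical
  induction J using Finset.induction_on with
  | empty => simpa using zero d n
  | insert i J hi ih =>
    simp only [Finset.sum_insert hi]
    exact (h i (Finset.mem_insert_self i J)).add
      (ih fun j hj => h j (Finset.mem_insert_of_mem hj))

theorem smul (c : ℂ) (hz : HasOrder d n z) : HasOrder d n fun D => c • z D := by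
  obtain ⟨C, hC, hz⟩ := hz
  refine ⟨‖c‖ * C, by positivity, fun D => ⟨fun p hp => ?_, fun p => ?_⟩⟩
  · rw [AddMonoidAlgebra.coeff_smul_apply, (hz D).1 p hp, smul_zero]
  · rw [AddMonoidAlgebra.coeff_smul_apply, norm_smul, mul_assoc, mul_assoc]
    refine mul_le_mul_of_nonneg_left ?_ (norm_nonneg c)
    rw [← mul_assoc]
    exact (hz D).2 p

theorem mul (hσ : 11 / 4 < σ) {d₁ d₂ n₁ n₂ : ℕ} (hz : HasOrder d₁ n₁ z) (hy : HasOrder d₂ n₂ y) :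
    HasOrder (d₁ + d₂) (n₁ + n₂) fun D => z D * y D := by
  obtain ⟨C, hC, hz⟩ := hz
  obtain ⟨B, hB, hy⟩ := hy
  have hK := convConst_nonneg σ
  refine ⟨C * B * convConst σ, by positivity, fun D => ⟨fun p hp => ?_, fun p => ?_⟩⟩
  · rw [coeff_mul]
    refine Finset.sum_eq_zero fun a _ => ?_
    rcases lt_or_ge (n₁ * D.N : ℤ) |a| with ha | ha
    · rw [(hz D).1 a ha, zero_mul]
    · rw [(hy D).1 (p - a) ?_, mul_zero]
      push_cast at hp
      have := abs_sub_abs_le_abs_sub p a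
      linarith
  · rw [coeff_mul, ← D.size_mul]
    have h1 := D.size_nonneg d₁ n₁
    have h2 := D.size_nonneg d₂ n₂
    calc ‖∑ a ∈ (z D).coeff.support, (z D).coeff a * (y D).coeff (p - a)‖
        ≤ ∑ a ∈ (z D).coeff.support, (C * D.size d₁ n₁ * (B * D.size d₂ n₂)) *
          (weight σ D.N a * weight σ D.N (p - a)) := by
          refine norm_sum_le_of_le _ fun a _ => ?_
          rw [norm_mul]
          refine (mul_le_mul ((hz D).2 a) ((hy D).2 (p - a)) (norm_nonneg _) ?_).trans_eq (by ring)
          have := weight_pos σ D.N a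
          positivity
      _ ≤ (C * D.size d₁ n₁ * (B * D.size d₂ n₂)) * (convConst σ * weight σ D.N p) := by
          rw [← Finset.mul_sum]
          exact mul_le_mul_of_nonneg_left (sum_weight_mul_weight_le hσ _ _ _) (by positivity)
      _ = _ := by ring

/-- A derivative costs a factor `N`. -/
theorem multiplier {s : ℤ → ℂ} (hs : ∀ p, ‖s p‖ ≤ |(p : ℝ)|) (hz : HasOrder d n z) :
    HasOrder d (n + 1) fun D => multiplier s (z D) := by
  obtain ⟨C, hC, hz⟩ := hz
  refine ⟨n * C, by positivity, fun D => ⟨fun p hp => ?_, fun p => ?_⟩⟩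
  · rw [multiplier_coeff, (hz D).1 p ?_, mul_zero]
    push_cast at hp
    linarith [Int.natCast_nonneg D.N]
  · have hw := weight_pos σ D.N p
    have hs0 := D.size_nonneg d (n + 1)
    rcases lt_or_ge (n * D.N : ℤ) |p| with hp | hp
    · rw [multiplier_coeff, (hz D).1 p hp, mul_zero, norm_zero]
      positivity
    · rw [multiplier_coeff, norm_mul]
      have hp' : |(p : ℝ)| ≤ n * D.N := by exact_mod_cast hp
      have h1 : |(p : ℝ)| ≤ n * D.L := by
        refine hp'.trans ?_
        rw [Datum.L]
        gcongr
        linarith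
      calc ‖s p‖ * ‖(z D).coeff p‖ ≤ (n * D.L) * (C * D.size d n * weight σ D.N p) :=
            mul_le_mul ((hs p).trans h1) ((hz D).2 p) (norm_nonneg _)
              (mul_nonneg (Nat.cast_nonneg _) D.L_pos.le)
        _ = n * C * (D.L * D.size d n) * weight σ D.N p := by ring
        _ ≤ _ := by
            have := D.L_mul_size_le d n
            gcongr

end HasOrder

theorem norm_negDeriv_symbol_le (p : ℤ) : ‖((max (-p) 0 : ℤ) : ℂ)‖ ≤ |(p : ℝ)| := by
  rw [Complex.norm_intCast]
  have h : |max (-p) 0| ≤ |p| := by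
    rw [abs_of_nonneg (le_max_right _ _)]
    exact max_le (neg_le_abs p) (abs_nonneg p)
  exact_mod_cast h

theorem norm_posDeriv_symbol_le (p : ℤ) : ‖((max p 0 : ℤ) : ℂ)‖ ≤ |(p : ℝ)| := by
  simpa using norm_negDeriv_symbol_le (-p)

theorem HasOrder.negDeriv {σ : ℝ} {d n : ℕ} {z : Datum σ → TrigPoly} (hz : HasOrder d n z) :
    HasOrder d (n + 1) fun D => negDeriv (z D) :=
  hz.multiplier norm_negDeriv_symbol_le

theorem HasOrder.posDeriv {σ : ℝ} {d n : ℕ} {z : Datum σ → TrigPoly} (hz : HasOrder d n z) :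
    HasOrder d (n + 1) fun D => posDeriv (z D) :=
  hz.multiplier norm_posDeriv_symbol_le

/-- The coefficients of a family of power series have the order `d`. -/
def SeriesHasOrder {σ : ℝ} (d : ℕ) (W : Datum σ → PowerSeries TrigPoly) : Prop :=
  ∀ n, HasOrder d n fun D => PowerSeries.coeff n (W D)

theorem SeriesHasOrder.mul {σ : ℝ} (hσ : 11 / 4 < σ) {d₁ d₂ : ℕ}
    {W Z : Datum σ → PowerSeries TrigPoly} (hW : SeriesHasOrder d₁ W) (hZ : SeriesHasOrder d₂ Z) :
    SeriesHasOrder (d₁ + d₂) fun D => W D * Z D := by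
  intro n
  simp only [PowerSeries.coeff_mul]
  refine HasOrder.sum fun a ha => ?_
  rw [← Finset.HasAntidiagonal.mem_antidiagonal.1 ha]
  exact (hW _).mul hσ (hZ _)

theorem SeriesHasOrder.pow {σ : ℝ} (hσ : 11 / 4 < σ) {W : Datum σ → PowerSeries TrigPoly}
    (hW : SeriesHasOrder 1 W) (k : ℕ) : SeriesHasOrder k fun D => W D ^ k := by
  induction k with
  | zero =>
    intro n
    simp only [pow_zero, PowerSeries.coeff_one]
    split_ifs with h
    · subst h
      exact HasOrder.one
    · exact HasOrder.zero 0 n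
  | succ k ih =>
    simp only [pow_succ]
    exact ih.mul hσ hW

/-! ### The densities to first order -/

/-- The densities vanish to first order at `v = 0`. -/
theorem hasOrder_matsunoDensity {σ : ℝ} (hσ : 11 / 4 < σ) (n : ℕ) :
    HasOrder 1 n fun D : Datum σ => matsunoDensity D.v n := by
  induction n using Nat.strong_induction_on with
  | _ n ih =>
    cases n with
    | zero =>
      simp only [matsunoDensity]
      exact HasOrder.zero 1 0
    | succ n =>
      have hV : SeriesHasOrder 1 fun D : Datum σ => PowerSeries.mk fun j =>
          if _h : j < n + 1 then matsunoDensity D.v j else 0 := by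
        intro j
        simp only [PowerSeries.coeff_mk]
        split_ifs with hj
        · exact ih j hj
        · exact HasOrder.zero 1 j
      simp only [matsunoDensity, I_smul_projNeg_dx]
      refine ((ih n n.lt_succ_self).negDeriv.add ?_).add (HasOrder.sum fun k hk => ?_)
      · split_ifs with h
        · subst h
          exact HasOrder.self
        · exact HasOrder.zero _ _
      · exact ((hV.pow hσ k (n + 1)).anti (by have := (Finset.mem_Icc.1 hk).1; omega)).smul _

/-! ### The linear part of the densities -/

/-- The Fourier multiplier with symbol `x |p|ⁿ` for `p > 0` and `y |p|ⁿ` for `p ≤ 0`. -/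
def signPow (x y : ℝ) (n : ℕ) : TrigPoly →ₗ[ℂ] TrigPoly :=
  multiplier fun p => (((if 0 < p then x else y) * |(p : ℝ)| ^ n : ℝ) : ℂ)

theorem signPow_coeff (x y : ℝ) (n : ℕ) (q : TrigPoly) (p : ℤ) :
    (signPow x y n q).coeff p =
      (((if 0 < p then x else y) * |(p : ℝ)| ^ n : ℝ) : ℂ) * q.coeff p :=
  multiplier_coeff _ _ _

/-- The value at positive frequencies of the symbol of `negDeriv ^ n`. -/
def negSide (n : ℕ) : ℝ := if n = 0 then 1 else 0

theorem signPow_one_one_zero (q : TrigPoly) : signPow 1 1 0 q = q := by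
  ext p
  simp [signPow_coeff]

theorem negDeriv_signPow (n : ℕ) (q : TrigPoly) :
    negDeriv (signPow (negSide n) 1 n q) = signPow (negSide (n + 1)) 1 (n + 1) q := by
  ext p
  rw [negDeriv_coeff, signPow_coeff, signPow_coeff, ← mul_assoc]
  congr 1
  rw [← Complex.ofReal_intCast, ← Complex.ofReal_mul, negSide, negSide, if_neg n.succ_ne_zero]
  split_ifs with h1
  · rw [max_eq_right (by omega)]; simp
  · rw [max_eq_right (by omega)]; simp
  · rw [max_eq_left (by omega), abs_of_nonpos (by exact_mod_cast not_lt.1 h1)]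
    congr 1
    push_cast
    ring

theorem posDeriv_signPow_add (n : ℕ) (q : TrigPoly) :
    posDeriv (signPow 1 1 n q) + signPow (negSide (n + 1)) 1 (n + 1) q =
      signPow 1 1 (n + 1) q := by
  ext p
  rw [AddMonoidAlgebra.coeff_add, Finsupp.add_apply, posDeriv_coeff, signPow_coeff, signPow_coeff,
    signPow_coeff, ← mul_assoc, ← add_mul]
  congr 1
  rw [← Complex.ofReal_intCast, ← Complex.ofReal_mul, ← Complex.ofReal_add, negSide,
    if_neg n.succ_ne_zero]
  split_ifs with h1
  · rw [max_eq_left (by omega), abs_of_nonneg (by exact_mod_cast h1.le)]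
    congr 1
    ring
  · rw [max_eq_right (by omega)]
    simp

theorem negSide_zero : negSide 0 = 1 := rfl

theorem hasOrder_signPow {σ : ℝ} (x y : ℝ) (n : ℕ) :
    HasOrder 1 (n + 1) fun D : Datum σ => signPow x y n D.v := by
  have hx : ∀ n, ∃ C : ℝ, 0 ≤ C ∧ ∀ D : Datum σ, ∀ p,
      ‖(signPow x y n D.v).coeff p‖ ≤ C * D.size 1 (n + 1) * weight σ D.N p := by
    intro n
    refine ⟨|x| + |y|, by positivity, fun D p => ?_⟩
    have hw := weight_pos σ D.N p
    have hs := D.size_nonneg 1 (n + 1)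
    rcases lt_or_ge (D.N : ℤ) |p| with hp | hp
    · rw [signPow_coeff, D.coeff_eq_zero p hp, mul_zero, norm_zero]
      positivity
    · have hp' : |(p : ℝ)| ≤ D.L := by
        have : |(p : ℝ)| ≤ D.N := by exact_mod_cast hp
        rw [Datum.L]; linarith
      have h1 : |if 0 < p then x else y| ≤ |x| + |y| := by
        split_ifs
        · linarith [abs_nonneg y]
        · linarith [abs_nonneg x]
      have hL := D.L_pos
      have hM := D.M_nonneg
      have h2 : D.size 1 (n + 1) = (1 + D.M) ^ (n + 1) * D.L ^ n := by
        rw [Datum.size, mul_pow]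
        field_simp
        ring
      have h3 : D.M ≤ (1 + D.M) ^ (n + 1) :=
        (by linarith : D.M ≤ 1 + D.M).trans (le_self_pow₀ (by linarith) n.succ_ne_zero)
      rw [signPow_coeff, norm_mul, Complex.norm_real, Real.norm_eq_abs, abs_mul, abs_pow, abs_abs,
        h2]
      calc |if 0 < p then x else y| * |(p : ℝ)| ^ n * ‖D.v.coeff p‖
          ≤ (|x| + |y|) * D.L ^ n * (D.M * weight σ D.N p) := by
            gcongr
            exact D.norm_coeff_le_weight p
        _ ≤ (|x| + |y|) * D.L ^ n * ((1 + D.M) ^ (n + 1) * weight σ D.N p) := by gcongr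
        _ = _ := by ring
  obtain ⟨C, hC, h⟩ := hx n
  refine ⟨C, hC, fun D => ⟨fun p hp => ?_, h D⟩⟩
  rw [signPow_coeff, D.coeff_eq_zero p ?_, mul_zero]
  push_cast at hp
  have : (0 : ℤ) ≤ n * D.N := by positivity
  linarith

section Order

variable {σ : ℝ}

theorem seriesHasOrder_matsunoSeries (hσ : 11 / 4 < σ) :
    SeriesHasOrder 1 fun D : Datum σ => matsunoSeries D.v := by
  intro n
  simp only [matsunoSeries, PowerSeries.coeff_mk]
  exact hasOrder_matsunoDensity hσ n

/-- The nonlinear part of the recursion for the densities. -/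
def matsunoRest (u : TrigPoly) (n : ℕ) : TrigPoly :=
  ∑ k ∈ Finset.Icc 2 (n + 1), ((-1 : ℂ) ^ k / (k.factorial : ℂ)) •
    PowerSeries.coeff (n + 1) (matsunoSeries u ^ k)

theorem matsunoDensity_one (u : TrigPoly) : matsunoDensity u 1 = u := by
  rw [matsunoDensity_succ, I_smul_projNeg_dx]
  simp [matsunoDensity]

theorem matsunoDensity_add_two (u : TrigPoly) (n : ℕ) :
    matsunoDensity u (n + 2) = negDeriv (matsunoDensity u (n + 1)) + matsunoRest u (n + 1) := by
  rw [matsunoDensity_succ, I_smul_projNeg_dx, if_neg n.succ_ne_zero, add_zero]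
  rfl

theorem hasOrder_matsunoRest (hσ : 11 / 4 < σ) (n : ℕ) :
    HasOrder 2 (n + 1) fun D : Datum σ => matsunoRest D.v n :=
  HasOrder.sum fun k hk => (((seriesHasOrder_matsunoSeries hσ).pow hσ k (n + 1)).anti
    (Finset.mem_Icc.1 hk).1).smul _

/-- The linear part of `wₙ₊₁` is `(i P₋ ∂ₓ)ⁿ v`. -/
theorem hasOrder_matsunoDensity_sub (hσ : 11 / 4 < σ) (n : ℕ) :
    HasOrder 2 (n + 1) fun D : Datum σ =>
      matsunoDensity D.v (n + 1) - signPow (negSide n) 1 n D.v := by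
  induction n with
  | zero =>
    simp only [zero_add, matsunoDensity_one, negSide_zero, signPow_one_one_zero, sub_self]
    exact HasOrder.zero 2 1
  | succ n ih =>
    have h := ih.negDeriv.add (hasOrder_matsunoRest hσ (n + 1))
    simp only [map_sub, negDeriv_signPow] at h
    refine (congrArg (HasOrder 2 (n + 1 + 1)) (funext fun D => ?_)).mp h
    rw [matsunoDensity_add_two]
    abel

theorem potential_zero (u : TrigPoly) : potential u 0 = u := by
  simp [potential, matsunoDensity]

theorem potential_succ (u : TrigPoly) (n : ℕ) :
    potential u (n + 1) = negDeriv (matsunoDensity u (n + 1)) := by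
  simp [potential]

theorem hasOrder_potential (hσ : 11 / 4 < σ) (n : ℕ) :
    HasOrder 1 (n + 1) fun D : Datum σ => potential D.v n := by
  cases n with
  | zero =>
    simp only [potential_zero]
    exact HasOrder.self
  | succ n =>
    simp only [potential_succ]
    exact (hasOrder_matsunoDensity hσ _).negDeriv

theorem hasOrder_potential_sub (hσ : 11 / 4 < σ) (n : ℕ) :
    HasOrder 2 (n + 1) fun D : Datum σ => potential D.v n - signPow (negSide n) 1 n D.v := by
  cases n with
  | zero =>
    simp only [potential_zero, negSide_zero, signPow_one_one_zero, sub_self]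
    exact HasOrder.zero 2 1
  | succ n =>
    simp only [potential_succ, ← negDeriv_signPow, ← map_sub]
    exact (hasOrder_matsunoDensity_sub hσ n).negDeriv

theorem gradDensity_zero (u : TrigPoly) : gradDensity u 0 = 1 := by
  rw [gradDensity]

theorem gradDensity_one (u : TrigPoly) : gradDensity u 1 = u := by
  rw [gradDensity_succ]
  have h : posDeriv (1 : TrigPoly) = 0 := by
    ext p
    rw [posDeriv_coeff, AddMonoidAlgebra.one_def, AddMonoidAlgebra.coeff_single,
      Finsupp.single_apply]
    split_ifs with hp
    · subst hp
      simp
    · simp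
  simp [gradDensity, potential_zero, h]

theorem gradDensity_add_two (u : TrigPoly) (n : ℕ) :
    gradDensity u (n + 2) = posDeriv (gradDensity u (n + 1)) + negDeriv (matsunoDensity u (n + 1)) +
      ∑ i ∈ Finset.range (n + 1), potential u (n - i) * gradDensity u (i + 1) := by
  rw [gradDensity_succ, Finset.sum_range_succ', tsub_zero, potential_succ, gradDensity_zero,
    mul_one, add_comm (∑ _ ∈ _, _), add_assoc]
  simp only [Nat.add_sub_add_right]

theorem hasOrder_gradDensity_succ (hσ : 11 / 4 < σ) (n : ℕ) :
    HasOrder 1 (n + 1) fun D : Datum σ => gradDensity D.v (n + 1) := by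
  induction n using Nat.strong_induction_on with
  | _ n ih =>
    cases n with
    | zero =>
      simp only [zero_add, gradDensity_one]
      exact HasOrder.self
    | succ n =>
      simp only [gradDensity_add_two]
      refine ((ih n n.lt_succ_self).posDeriv.add (hasOrder_matsunoDensity hσ _).negDeriv).add
        (HasOrder.sum fun i hi => ?_)
      have hi' := Finset.mem_range.1 hi
      have h := ((hasOrder_potential hσ (n - i)).mul hσ (ih i (by omega))).anti one_le_two
      rwa [show n - i + 1 + (i + 1) = n + 1 + 1 by omega] at h

/-- The linear part of `gₙ₊₁` is `|D|ⁿ v`. -/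
theorem hasOrder_gradDensity_sub (hσ : 11 / 4 < σ) (n : ℕ) :
    HasOrder 2 (n + 1) fun D : Datum σ => gradDensity D.v (n + 1) - signPow 1 1 n D.v := by
  induction n with
  | zero =>
    simp only [zero_add, gradDensity_one, signPow_one_one_zero, sub_self]
    exact HasOrder.zero 2 1
  | succ n ih =>
    have h1 : HasOrder 2 (n + 1 + 1) fun D : Datum σ =>
        ∑ i ∈ Finset.range (n + 1), potential D.v (n - i) * gradDensity D.v (i + 1) := by
      refine HasOrder.sum fun i hi => ?_
      have hi' := Finset.mem_range.1 hi
      have h := (hasOrder_potential hσ (n - i)).mul hσ (hasOrder_gradDensity_succ hσ i)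
      rwa [show n - i + 1 + (i + 1) = n + 1 + 1 by omega] at h
    have h := (ih.posDeriv.add (hasOrder_matsunoDensity_sub hσ n).negDeriv).add h1
    refine (congrArg (HasOrder 2 (n + 1 + 1)) (funext fun D => ?_)).mp h
    rw [gradDensity_add_two, map_sub, map_sub, negDeriv_signPow, ← posDeriv_signPow_add]
    abel

end Order

/-! ### The quadratic part of the densities at high frequencies -/

/-- At the frequencies `|p| > N`, the family `z` is a real multiple of `|p|ⁿ (v²)^(p)`, the multiple
depending on the sign of `p` only, up to a term of the size of the cubic part of the densities of
index `n + 2`. -/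
def AlmostSquare {σ : ℝ} (n : ℕ) (z : Datum σ → TrigPoly) : Prop :=
  ∃ x y C : ℝ, 0 ≤ C ∧ ∀ D : Datum σ,
    (∀ p : ℤ, ((n + 2 : ℕ) * D.N : ℤ) < |p| → (z D).coeff p = 0) ∧
    ∀ p : ℤ, (D.N : ℤ) < |p| → ‖(z D).coeff p - (signPow x y n (D.v * D.v)).coeff p‖ ≤
      C * D.size 3 (n + 2) * weight σ D.N p

theorem coeff_sq_eq_zero {σ : ℝ} (D : Datum σ) {p : ℤ} (hp : (2 * D.N : ℤ) < |p|) :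
    (D.v * D.v).coeff p = 0 := by
  rw [coeff_mul]
  refine Finset.sum_eq_zero fun a _ => ?_
  rcases lt_or_ge (D.N : ℤ) |a| with ha | ha
  · rw [D.coeff_eq_zero a ha, zero_mul]
  · rw [D.coeff_eq_zero (p - a) ?_, mul_zero]
    have := abs_sub_abs_le_abs_sub p a
    linarith

theorem norm_coeff_sq_le {σ : ℝ} (hσ : 11 / 4 < σ) (D : Datum σ) (p : ℤ) :
    ‖(D.v * D.v).coeff p‖ ≤ D.M ^ 2 * (convConst σ * weight σ D.N p) := by
  rw [coeff_mul]
  calc ‖∑ a ∈ D.v.coeff.support, D.v.coeff a * D.v.coeff (p - a)‖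
      ≤ ∑ a ∈ D.v.coeff.support, D.M ^ 2 * (weight σ D.N a * weight σ D.N (p - a)) := by
        refine norm_sum_le_of_le _ fun a _ => ?_
        rw [norm_mul]
        refine (mul_le_mul (D.norm_coeff_le_weight a) (D.norm_coeff_le_weight (p - a))
          (norm_nonneg _) ?_).trans_eq (by ring)
        have := weight_pos σ D.N a
        have := D.M_nonneg
        positivity
    _ ≤ _ := by
        rw [← Finset.mul_sum]
        exact mul_le_mul_of_nonneg_left (sum_weight_mul_weight_le hσ _ _ _) (by positivity)

namespace AlmostSquare

variable {σ : ℝ} {n : ℕ} {z y : Datum σ → TrigPoly}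

theorem of_hasOrder (hz : HasOrder 3 (n + 2) z) : AlmostSquare n z := by
  obtain ⟨C, hC, hz⟩ := hz
  refine ⟨0, 0, C, hC, fun D => ⟨(hz D).1, fun p _ => ?_⟩⟩
  simpa [signPow_coeff] using (hz D).2 p

/-- The linear terms have no frequencies `|p| > N`. -/
theorem multiplier_self (s : ℤ → ℂ) (n : ℕ) :
    AlmostSquare n fun D : Datum σ => multiplier s D.v := by
  have h (D : Datum σ) (p : ℤ) (hp : (D.N : ℤ) < |p|) : (multiplier s D.v).coeff p = 0 := by
    rw [multiplier_coeff, D.coeff_eq_zero p hp, mul_zero]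
  refine ⟨0, 0, 0, le_rfl, fun D => ⟨fun p hp => h D p ?_, fun p hp => ?_⟩⟩
  · push_cast at hp
    have : (0 : ℤ) ≤ n * D.N := by positivity
    linarith [Int.natCast_nonneg D.N]
  · rw [h D p hp]
    simp [signPow_coeff]

theorem add (hz : AlmostSquare n z) (hy : AlmostSquare n y) :
    AlmostSquare n fun D => z D + y D := by
  obtain ⟨x₁, y₁, C, hC, hz⟩ := hz
  obtain ⟨x₂, y₂, B, hB, hy⟩ := hy
  refine ⟨x₁ + x₂, y₁ + y₂, C + B, add_nonneg hC hB, fun D => ⟨fun p hp => ?_, fun p hp => ?_⟩⟩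
  · rw [AddMonoidAlgebra.coeff_add, Finsupp.add_apply, (hz D).1 p hp, (hy D).1 p hp, add_zero]
  · have h : (signPow (x₁ + x₂) (y₁ + y₂) n (D.v * D.v)).coeff p =
        (signPow x₁ y₁ n (D.v * D.v)).coeff p + (signPow x₂ y₂ n (D.v * D.v)).coeff p := by
      rw [signPow_coeff, signPow_coeff, signPow_coeff]
      split_ifs <;> push_cast <;> ring
    rw [h, AddMonoidAlgebra.coeff_add, Finsupp.add_apply, add_sub_add_comm, add_mul, add_mul]
    exact (norm_add_le _ _).trans (add_le_add ((hz D).2 p hp) ((hy D).2 p hp))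

theorem sum {ι : Type*} {J : Finset ι} {z : ι → Datum σ → TrigPoly}
    (h : ∀ i ∈ J, AlmostSquare n (z i)) : AlmostSquare n fun D => ∑ i ∈ J, z i D := by
  classical
  induction J using Finset.induction_on with
  | empty => simpa using of_hasOrder (HasOrder.zero (σ := σ) 3 (n + 2))
  | insert i J hi ih =>
    simp only [Finset.sum_insert hi]
    exact (h i (Finset.mem_insert_self i J)).add
      (ih fun j hj => h j (Finset.mem_insert_of_mem hj))

theorem smul (c : ℝ) (hz : AlmostSquare n z) : AlmostSquare n fun D => (c : ℂ) • z D := by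
  obtain ⟨x, y, C, hC, hz⟩ := hz
  refine ⟨c * x, c * y, |c| * C, by positivity, fun D => ⟨fun p hp => ?_, fun p hp => ?_⟩⟩
  · rw [AddMonoidAlgebra.coeff_smul_apply, (hz D).1 p hp, smul_zero]
  · have h : (signPow (c * x) (c * y) n (D.v * D.v)).coeff p =
        (c : ℂ) * (signPow x y n (D.v * D.v)).coeff p := by
      rw [signPow_coeff, signPow_coeff]
      split_ifs <;> push_cast <;> ring
    rw [AddMonoidAlgebra.coeff_smul_apply, smul_eq_mul, h, ← mul_sub, norm_mul, Complex.norm_real,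
      Real.norm_eq_abs, mul_assoc, mul_assoc]
    refine mul_le_mul_of_nonneg_left ?_ (abs_nonneg c)
    rw [← mul_assoc]
    exact (hz D).2 p hp

/-- A multiplier with symbol `a |p|` for `p > 0` and `b |p|` for `p < 0`. -/
theorem signPow_one (a b : ℝ) (hz : AlmostSquare n z) :
    AlmostSquare (n + 1) fun D => signPow a b 1 (z D) := by
  obtain ⟨x, y, C, hC, hz⟩ := hz
  refine ⟨a * x, b * y, (|a| + |b|) * ((n + 2 : ℕ) * C), by positivity,
    fun D => ⟨fun p hp => ?_, fun p hp => ?_⟩⟩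
  · rw [signPow_coeff, (hz D).1 p ?_, mul_zero]
    push_cast at hp ⊢
    linarith [Int.natCast_nonneg D.N]
  · have h : (signPow (a * x) (b * y) (n + 1) (D.v * D.v)).coeff p =
        (((if 0 < p then a else b) * |(p : ℝ)| ^ 1 : ℝ) : ℂ) *
          (signPow x y n (D.v * D.v)).coeff p := by
      rw [signPow_coeff, signPow_coeff]
      split_ifs <;> push_cast <;> ring
    have hw := weight_pos σ D.N p
    have hs := D.size_nonneg 3 (n + 1 + 2)
    rw [signPow_coeff, h, ← mul_sub]
    rcases lt_or_ge ((n + 2 : ℕ) * D.N : ℤ) |p| with hp' | hp'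
    · have h2 : (2 * D.N : ℤ) < |p| := by
        push_cast at hp'
        have : (0 : ℤ) ≤ n * D.N := by positivity
        linarith
      rw [(hz D).1 p hp', signPow_coeff, coeff_sq_eq_zero D h2, mul_zero, sub_zero, mul_zero,
        norm_zero]
      positivity
    · have h1 : |(p : ℝ)| ≤ (n + 2 : ℕ) * D.L := by
        have : |(p : ℝ)| ≤ (n + 2 : ℕ) * D.N := by exact_mod_cast hp'
        refine this.trans ?_
        rw [Datum.L]
        gcongr
        linarith
      have h2 : |if 0 < p then a else b| ≤ |a| + |b| := by
        split_ifs
        · linarith [abs_nonneg b]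
        · linarith [abs_nonneg a]
      rw [norm_mul, Complex.norm_real, Real.norm_eq_abs, abs_mul, abs_pow, abs_abs, pow_one]
      have hL := D.L_pos
      calc |if 0 < p then a else b| * |(p : ℝ)| *
            ‖(z D).coeff p - (signPow x y n (D.v * D.v)).coeff p‖
          ≤ (|a| + |b|) * ((n + 2 : ℕ) * D.L) * (C * D.size 3 (n + 2) * weight σ D.N p) := by
            gcongr
            exact (hz D).2 p hp
        _ = (|a| + |b|) * ((n + 2 : ℕ) * C) * (D.L * D.size 3 (n + 2)) * weight σ D.N p := by ring
        _ ≤ _ := by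
            gcongr
            exact D.L_mul_size_le 3 (n + 2)

theorem negDeriv (hz : AlmostSquare n z) : AlmostSquare (n + 1) fun D => negDeriv (z D) := by
  have h (q : TrigPoly) : BenjaminOno.negDeriv q = signPow 0 1 1 q := by
    have := negDeriv_signPow 0 q
    rwa [negSide_zero, signPow_one_one_zero] at this
  simp only [h]
  exact hz.signPow_one 0 1

theorem posDeriv (hz : AlmostSquare n z) : AlmostSquare (n + 1) fun D => posDeriv (z D) := by
  have h (q : TrigPoly) : BenjaminOno.posDeriv q = signPow 1 0 1 q := by
    ext p
    rw [posDeriv_coeff, signPow_coeff, ← Complex.ofReal_intCast]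
    congr 2
    split_ifs with h1
    · rw [max_eq_left (by omega), abs_of_nonneg (by exact_mod_cast h1.le)]
      ring
    · rw [max_eq_right (by omega)]
      simp
  simp only [h]
  exact hz.signPow_one 1 0

end AlmostSquare

/-- `(x + y)ᵏ - yᵏ` is at most `k x (x + y)ᵏ⁻¹`. -/
theorem pow_sub_pow_mul_le {x y : ℝ} (hx : 0 ≤ x) (hy : 0 ≤ y) (k : ℕ) :
    ((x + y) ^ k - y ^ k) * (x + y) ≤ k * x * (x + y) ^ k := by
  induction k with
  | zero => simp
  | succ k ih =>
    have h1 : y ^ k ≤ (x + y) ^ k := pow_le_pow_left₀ hy (by linarith) k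
    have h2 : x * (x + y) * y ^ k ≤ x * (x + y) * (x + y) ^ k :=
      mul_le_mul_of_nonneg_left h1 (by positivity)
    have h3 := mul_le_mul_of_nonneg_left ih (by positivity : 0 ≤ x + y)
    calc ((x + y) ^ (k + 1) - y ^ (k + 1)) * (x + y)
        = (x + y) * (((x + y) ^ k - y ^ k) * (x + y)) + x * (x + y) * y ^ k := by ring
      _ ≤ (x + y) * (k * x * (x + y) ^ k) + x * (x + y) * (x + y) ^ k := add_le_add h3 h2
      _ = ((k + 1 : ℕ) : ℝ) * x * (x + y) ^ (k + 1) := by push_cast; ring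

/-- A symmetric monomial in `x, y ≥ 0` is a multiple of the power of `x + y`, up to a relative error
`min x y / (x + y)`. -/
theorem exists_abs_symm_monomial_sub_le (i j : ℕ) : ∃ c C : ℝ, 0 ≤ C ∧ ∀ x y : ℝ, 0 ≤ x → 0 ≤ y →
    |x ^ i * y ^ j + y ^ i * x ^ j - 2 * c * (x + y) ^ (i + j)| * (x + y) ≤
      C * (x + y) ^ (i + j) * min x y := by
  have pure (k : ℕ) (hk : k ≠ 0) (x y : ℝ) (hx : 0 ≤ x) (hy : 0 ≤ y) :
      |x ^ k + y ^ k - (x + y) ^ k| * (x + y) ≤ (k + 1) * (x + y) ^ k * min x y := by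
    wlog hxy : x ≤ y generalizing x y
    · have := this y x hy hx (le_of_not_ge hxy)
      rwa [add_comm y x, add_comm (y ^ k), min_comm] at this
    rw [min_eq_left hxy]
    have h1 := pow_sub_pow_mul_le hx hy k
    have h2 : x ^ k * (x + y) ≤ x * (x + y) ^ k := by
      obtain ⟨l, rfl⟩ := Nat.exists_eq_succ_of_ne_zero hk
      have : x ^ l ≤ (x + y) ^ l := pow_le_pow_left₀ hx (by linarith) l
      have h3 := mul_le_mul_of_nonneg_left this (by positivity : 0 ≤ x * (x + y))
      rw [Nat.succ_eq_add_one, pow_succ, pow_succ]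
      linarith
    have h4 : y ^ k ≤ (x + y) ^ k := pow_le_pow_left₀ hy (by linarith) k
    have h5 : |x ^ k + y ^ k - (x + y) ^ k| ≤ x ^ k + ((x + y) ^ k - y ^ k) :=
      abs_le.2 ⟨by linarith [pow_nonneg hx k], by linarith⟩
    have h6 := mul_le_mul_of_nonneg_right h5 (by positivity : 0 ≤ x + y)
    linarith
  rcases Nat.eq_zero_or_pos i with rfl | hi
  · rcases Nat.eq_zero_or_pos j with rfl | hj
    · refine ⟨1, 0, le_rfl, fun x y hx hy => ?_⟩
      norm_num
    · refine ⟨1 / 2, j + 1, by positivity, fun x y hx hy => ?_⟩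
      have h := pure j hj.ne' x y hx hy
      rw [zero_add]
      convert h using 3
      ring
  · rcases Nat.eq_zero_or_pos j with rfl | hj
    · refine ⟨1 / 2, i + 1, by positivity, fun x y hx hy => ?_⟩
      have h := pure i hi.ne' x y hx hy
      rw [add_zero]
      convert h using 3
      ring
    · refine ⟨0, 2, zero_le_two, fun x y hx hy => ?_⟩
      wlog hxy : x ≤ y generalizing x y
      · have := this y x hy hx (le_of_not_ge hxy)
        rwa [add_comm y x, add_comm (y ^ i * x ^ j), min_comm] at this
      rw [min_eq_left hxy, mul_zero, zero_mul, sub_zero, abs_of_nonneg (by positivity)]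
      obtain ⟨i, rfl⟩ := Nat.exists_eq_succ_of_ne_zero hi.ne'
      obtain ⟨j, rfl⟩ := Nat.exists_eq_succ_of_ne_zero hj.ne'
      have hx' : x ≤ x + y := by linarith
      have hy' : y ≤ x + y := by linarith
      have e1 : x ^ (i + 1) * y ^ (j + 1) ≤ x * ((x + y) ^ i * (x + y) ^ (j + 1)) := by
        rw [pow_succ' x, mul_assoc]
        gcongr
      have e2 : y ^ (i + 1) * x ^ (j + 1) ≤ x * ((x + y) ^ (i + 1) * (x + y) ^ j) := by
        rw [pow_succ' x, mul_left_comm]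
        gcongr
      have e3 := mul_le_mul_of_nonneg_right (add_le_add e1 e2) (by positivity : 0 ≤ x + y)
      refine e3.trans_eq ?_
      rw [Nat.succ_eq_add_one, Nat.succ_eq_add_one]
      ring

/-- At a frequency `|p| > N`, the two factors of a quadratic term have frequencies of the same sign
as `p`, and the symbol of the term is almost constant: the frequencies of the factors add up to `p`,
and where both are large the coefficients of `v` are small. -/
theorem AlmostSquare.signPow_mul_signPow {σ : ℝ} (hσ : 11 / 4 < σ) (x y x' y' : ℝ) (i j : ℕ) :
    AlmostSquare (i + j) fun D : Datum σ => signPow x y i D.v * signPow x' y' j D.v := by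
  obtain ⟨c, C, hC, hc⟩ := exists_abs_symm_monomial_sub_le i j
  have hK := convConst_nonneg σ
  set b : ℝ := |x * x'| + |y * y'| with hb
  refine ⟨x * x' * c, y * y' * c, b * (C * 2 ^ (i + j) * convConst σ), by positivity,
    fun D => ⟨fun p hp => ?_, fun p hp => ?_⟩⟩
  · rw [coeff_mul]
    refine Finset.sum_eq_zero fun a _ => ?_
    rcases lt_or_ge (D.N : ℤ) |a| with ha | ha
    · rw [signPow_coeff, D.coeff_eq_zero a ha, mul_zero, zero_mul]
    · rw [signPow_coeff _ _ _ _ (p - a), D.coeff_eq_zero (p - a) ?_, mul_zero, mul_zero]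
      push_cast at hp
      have := abs_sub_abs_le_abs_sub p a
      have : (0 : ℤ) ≤ (i + j) * D.N := by positivity
      linarith
  have hw := weight_pos σ D.N p
  have hs := D.size_nonneg 3 (i + j + 2)
  have hL := D.L_pos
  have hM := D.M_nonneg
  -- a set of frequencies that contains the support of `v` and is invariant under `a ↦ p - a`
  set S : Finset ℤ := Finset.Icc (p - (|p| + D.N)) (|p| + D.N) with hS
  have hsupp {q : TrigPoly} (hq : ∀ a : ℤ, (D.N : ℤ) < |a| → q.coeff a = 0) :
      q.coeff.support ⊆ S := by
    intro a ha
    have h1 : |a| ≤ D.N := by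
      by_contra h
      exact Finsupp.mem_support_iff.1 ha (hq a (not_le.1 h))
    have h2 := abs_le.1 h1
    have h3 := le_abs_self p
    have h4 := abs_nonneg p
    exact Finset.mem_Icc.2 ⟨by linarith, by linarith⟩
  have hflip (f : ℤ → ℂ) : ∑ a ∈ S, f (p - a) = ∑ a ∈ S, f a := by
    refine Finset.sum_nbij' (fun a => p - a) (fun a => p - a) ?_ ?_ ?_ ?_ ?_
    · intro a ha
      rw [hS, Finset.mem_Icc] at ha ⊢
      exact ⟨by linarith [ha.2], by linarith [ha.1]⟩
    · intro a ha
      rw [hS, Finset.mem_Icc] at ha ⊢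
      exact ⟨by linarith [ha.2], by linarith [ha.1]⟩
    · intro a _; simp
    · intro a _; simp
    · intro a _; rfl
  set g : ℝ := if 0 < p then x * x' else y * y' with hg
  have hgb : |g| ≤ b := by
    rw [hg, hb]
    split_ifs
    · linarith [abs_nonneg (y * y')]
    · linarith [abs_nonneg (x * x')]
  -- where the coefficients of `v` do not vanish, `a` and `p - a` have the sign of `p`
  have hsign (a : ℤ) (h : D.v.coeff a * D.v.coeff (p - a) ≠ 0) :
      (0 < a ↔ 0 < p) ∧ (0 < p - a ↔ 0 < p) ∧
        |(a : ℝ)| + |((p - a : ℤ) : ℝ)| = |(p : ℝ)| := by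
    have h1 : |a| ≤ D.N := by
      by_contra h'
      exact h (by rw [D.coeff_eq_zero a (not_le.1 h'), zero_mul])
    have h2 : |p - a| ≤ D.N := by
      by_contra h'
      exact h (by rw [D.coeff_eq_zero _ (not_le.1 h'), mul_zero])
    have key : (0 < a ↔ 0 < p) ∧ (0 < p - a ↔ 0 < p) ∧ |a| + |p - a| = |p| := by
      have h1' := abs_le.1 h1
      have h2' := abs_le.1 h2
      rcases lt_abs.1 hp with h3 | h3
      · rw [abs_of_pos (by omega : 0 < a), abs_of_pos (by omega : 0 < p - a),
          abs_of_pos (by omega : 0 < p)]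
        omega
      · rw [abs_of_neg (by omega : a < 0), abs_of_neg (by omega : p - a < 0),
          abs_of_neg (by omega : p < 0)]
        omega
    exact ⟨key.1, key.2.1, by exact_mod_cast key.2.2⟩
  set m : ℤ → ℝ := fun a => |(a : ℝ)| ^ i * |((p - a : ℤ) : ℝ)| ^ j with hm
  have hz : (signPow x y i D.v * signPow x' y' j D.v).coeff p =
      (g : ℂ) * ∑ a ∈ S, (m a : ℂ) * (D.v.coeff a * D.v.coeff (p - a)) := by
    rw [coeff_mul_of_subset _ _ _ (hsupp fun a ha => by
      rw [signPow_coeff, D.coeff_eq_zero a ha, mul_zero]), Finset.mul_sum]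
    refine Finset.sum_congr rfl fun a _ => ?_
    rw [signPow_coeff, signPow_coeff]
    by_cases h : D.v.coeff a * D.v.coeff (p - a) = 0
    · rw [h, mul_mul_mul_comm, h]
      ring
    · obtain ⟨h1, h2, -⟩ := hsign a h
      rw [hg, hm]
      simp only [h1, h2]
      split_ifs <;> push_cast <;> ring
  have hq : (signPow (x * x' * c) (y * y' * c) (i + j) (D.v * D.v)).coeff p =
      (g : ℂ) * ∑ a ∈ S, ((c * |(p : ℝ)| ^ (i + j) : ℝ) : ℂ) *
        (D.v.coeff a * D.v.coeff (p - a)) := by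
    rw [signPow_coeff, coeff_mul_of_subset _ _ _ (hsupp D.coeff_eq_zero), ← Finset.mul_sum,
      ← mul_assoc, ← Complex.ofReal_mul, hg]
    congr 2
    split_ifs <;> ring
  have hsymm : ∑ a ∈ S, (m a : ℂ) * (D.v.coeff a * D.v.coeff (p - a)) =
      ∑ a ∈ S, (((m a + m (p - a)) / 2 : ℝ) : ℂ) * (D.v.coeff a * D.v.coeff (p - a)) := by
    have h1 := hflip fun a => (m a : ℂ) * (D.v.coeff a * D.v.coeff (p - a))
    have h2 : ∑ a ∈ S, (((m a + m (p - a)) / 2 : ℝ) : ℂ) * (D.v.coeff a * D.v.coeff (p - a)) =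
        (∑ a ∈ S, (m a : ℂ) * (D.v.coeff a * D.v.coeff (p - a)) +
        ∑ a ∈ S, (m (p - a) : ℂ) * (D.v.coeff (p - a) * D.v.coeff (p - (p - a)))) / 2 := by
      rw [← Finset.sum_add_distrib, Finset.sum_div]
      refine Finset.sum_congr rfl fun a _ => ?_
      rw [sub_sub_cancel]
      push_cast
      ring
    rw [h2, h1]
    ring
  have hLp : D.L ≤ |(p : ℝ)| := by
    rw [Datum.L]
    exact_mod_cast hp
  have hterm (a : ℤ) : ‖((((m a + m (p - a)) / 2 : ℝ) : ℂ) - ((c * |(p : ℝ)| ^ (i + j) : ℝ) : ℂ)) *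
      (D.v.coeff a * D.v.coeff (p - a))‖ ≤ C * 2 ^ (i + j) * (D.L ^ (i + j) * D.L⁻¹ * D.M ^ 2) *
        ((1 + min |(a : ℝ)| |((p - a : ℤ) : ℝ)|) * (weight σ D.N a * weight σ D.N (p - a))) := by
    have hwa := weight_pos σ D.N a
    have hwb := weight_pos σ D.N (p - a)
    have hmin : 0 ≤ min |(a : ℝ)| |((p - a : ℤ) : ℝ)| := le_min (abs_nonneg _) (abs_nonneg _)
    by_cases h : D.v.coeff a * D.v.coeff (p - a) = 0
    · rw [h, mul_zero, norm_zero]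
      positivity
    obtain ⟨-, -, h3⟩ := hsign a h
    have hp2 : |(p : ℝ)| ≤ 2 * D.L := by
      have h1 : |a| ≤ D.N := by
        by_contra h'
        exact h (by rw [D.coeff_eq_zero a (not_le.1 h'), zero_mul])
      have h2 : |p - a| ≤ D.N := by
        by_contra h'
        exact h (by rw [D.coeff_eq_zero _ (not_le.1 h'), mul_zero])
      have h1' : |(a : ℝ)| ≤ D.N := by exact_mod_cast h1
      have h2' : |((p - a : ℤ) : ℝ)| ≤ D.N := by exact_mod_cast h2
      rw [Datum.L]
      linarith
    have h4 := hc |(a : ℝ)| |((p - a : ℤ) : ℝ)| (abs_nonneg _) (abs_nonneg _)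
    rw [h3] at h4
    have h5 : |m a + m (p - a) - 2 * c * |(p : ℝ)| ^ (i + j)| ≤
        C * (2 * D.L) ^ (i + j) * D.L⁻¹ * (1 + min |(a : ℝ)| |((p - a : ℤ) : ℝ)|) := by
      have e : m a + m (p - a) = |(a : ℝ)| ^ i * |((p - a : ℤ) : ℝ)| ^ j +
          |((p - a : ℤ) : ℝ)| ^ i * |(a : ℝ)| ^ j := by
        simp only [hm, sub_sub_cancel]
      rw [e]
      refine le_of_mul_le_mul_right ?_ hL
      refine (mul_le_mul_of_nonneg_left hLp (abs_nonneg _)).trans (h4.trans ?_)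
      calc C * |(p : ℝ)| ^ (i + j) * min |(a : ℝ)| |((p - a : ℤ) : ℝ)|
          ≤ C * (2 * D.L) ^ (i + j) * (1 + min |(a : ℝ)| |((p - a : ℤ) : ℝ)|) := by
            gcongr
            linarith
        _ = _ := by field_simp
    rw [norm_mul, norm_mul, ← Complex.ofReal_sub, Complex.norm_real, Real.norm_eq_abs,
      show (m a + m (p - a)) / 2 - c * |(p : ℝ)| ^ (i + j) =
        (m a + m (p - a) - 2 * c * |(p : ℝ)| ^ (i + j)) / 2 by ring, abs_div,
      abs_of_pos (zero_lt_two' ℝ)]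
    calc |m a + m (p - a) - 2 * c * |(p : ℝ)| ^ (i + j)| / 2 *
          (‖D.v.coeff a‖ * ‖D.v.coeff (p - a)‖)
        ≤ (C * (2 * D.L) ^ (i + j) * D.L⁻¹ * (1 + min |(a : ℝ)| |((p - a : ℤ) : ℝ)|)) *
          ((D.M * weight σ D.N a) * (D.M * weight σ D.N (p - a))) := by
          have ha := D.norm_coeff_le_weight a
          have hb := D.norm_coeff_le_weight (p - a)
          gcongr
          linarith [abs_nonneg (m a + m (p - a) - 2 * c * |(p : ℝ)| ^ (i + j))]
      _ = _ := by
          rw [mul_pow]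
          ring
  have hsize : D.L ^ (i + j) * D.L⁻¹ * D.M ^ 2 ≤ D.size 3 (i + j + 2) := by
    have e : D.size 3 (i + j + 2) = D.L ^ (i + j) * D.L⁻¹ * (1 + D.M) ^ (i + j + 2) := by
      rw [Datum.size, mul_pow]
      field_simp
      ring
    rw [e]
    refine mul_le_mul_of_nonneg_left ?_ (by positivity)
    calc D.M ^ 2 ≤ (1 + D.M) ^ 2 := pow_le_pow_left₀ hM (by linarith) 2
      _ ≤ (1 + D.M) ^ (i + j + 2) := pow_le_pow_right₀ (by linarith) (by omega)
  rw [hz, hq, hsymm, ← mul_sub, ← Finset.sum_sub_distrib, norm_mul, Complex.norm_real,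
    Real.norm_eq_abs]
  simp only [← sub_mul]
  calc |g| * ‖∑ a ∈ S, _‖ ≤ b * ∑ a ∈ S, C * 2 ^ (i + j) * (D.L ^ (i + j) * D.L⁻¹ * D.M ^ 2) *
        ((1 + min |(a : ℝ)| |((p - a : ℤ) : ℝ)|) * (weight σ D.N a * weight σ D.N (p - a))) := by
        refine mul_le_mul hgb (norm_sum_le_of_le _ fun a _ => hterm a) (norm_nonneg _)
          (by positivity)
    _ ≤ b * (C * 2 ^ (i + j) * D.size 3 (i + j + 2) * (convConst σ * weight σ D.N p)) := by
        rw [← Finset.mul_sum]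
        have := sum_min_mul_weight_le hσ D.N S p
        gcongr
        refine Finset.sum_nonneg fun a _ => ?_
        have hwa := weight_pos σ D.N a
        have hwb := weight_pos σ D.N (p - a)
        have hmin : 0 ≤ min |(a : ℝ)| |((p - a : ℤ) : ℝ)| := le_min (abs_nonneg _) (abs_nonneg _)
        positivity
    _ = _ := by ring

/-- A product of two families is almost a square if their linear parts are multipliers. -/
theorem AlmostSquare.mul_of_linear {σ : ℝ} (hσ : 11 / 4 < σ) {x y x' y' : ℝ} {i j n : ℕ}
    (hn : i + j = n) {z z' : Datum σ → TrigPoly} (hz : HasOrder 1 (i + 1) z)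
    (h : HasOrder 2 (i + 1) fun D => z D - signPow x y i D.v)
    (h' : HasOrder 2 (j + 1) fun D => z' D - signPow x' y' j D.v) :
    AlmostSquare n fun D => z D * z' D := by
  subst hn
  have h1 : HasOrder 3 (i + j + 2) fun D => z D * (z' D - signPow x' y' j D.v) := by
    have := hz.mul hσ h'
    rwa [show i + 1 + (j + 1) = i + j + 2 by ring] at this
  have h2 : HasOrder 3 (i + j + 2) fun D => (z D - signPow x y i D.v) * signPow x' y' j D.v := by
    have := h.mul hσ (hasOrder_signPow x' y' j)
    rwa [show i + 1 + (j + 1) = i + j + 2 by ring] at this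
  have h3 := ((AlmostSquare.of_hasOrder h1).add (AlmostSquare.of_hasOrder h2)).add
    (AlmostSquare.signPow_mul_signPow hσ x y x' y' i j)
  refine (congrArg (AlmostSquare (i + j)) (funext fun D => ?_)).mp h3
  ring

theorem almostSquare_matsunoRest {σ : ℝ} (hσ : 11 / 4 < σ) (n : ℕ) :
    AlmostSquare n fun D : Datum σ => matsunoRest D.v (n + 1) := by
  refine AlmostSquare.sum fun k hk => ?_
  have hk2 := (Finset.mem_Icc.1 hk).1
  rcases hk2.eq_or_lt with rfl | hk3
  · have h : ((-1 : ℂ) ^ 2 / (Nat.factorial 2 : ℂ)) = ((1 / 2 : ℝ) : ℂ) := by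
      norm_num [Nat.factorial]
    rw [h]
    refine AlmostSquare.smul _ ?_
    simp only [pow_two, PowerSeries.coeff_mul]
    refine AlmostSquare.sum fun a ha => ?_
    have ha' := Finset.HasAntidiagonal.mem_antidiagonal.1 ha
    obtain ⟨a, b⟩ := a
    simp only [matsunoSeries, PowerSeries.coeff_mk] at ha' ⊢
    have h0 : AlmostSquare n fun _ : Datum σ => 0 := AlmostSquare.of_hasOrder (HasOrder.zero _ _)
    cases a with
    | zero => simpa [matsunoDensity] using h0
    | succ a =>
      cases b with
      | zero => simpa [matsunoDensity] using h0
      | succ b =>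
        exact AlmostSquare.mul_of_linear hσ (by omega) (hasOrder_matsunoDensity hσ _)
          (hasOrder_matsunoDensity_sub hσ a) (hasOrder_matsunoDensity_sub hσ b)
  · exact AlmostSquare.of_hasOrder
      ((((seriesHasOrder_matsunoSeries hσ).pow hσ k (n + 2)).anti hk3).smul _)

theorem almostSquare_matsunoDensity {σ : ℝ} (hσ : 11 / 4 < σ) (n : ℕ) :
    AlmostSquare n fun D : Datum σ => matsunoDensity D.v (n + 2) := by
  induction n with
  | zero =>
    simp only [matsunoDensity_add_two, zero_add, matsunoDensity_one]
    exact (AlmostSquare.multiplier_self _ _).add (almostSquare_matsunoRest hσ 0)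
  | succ n ih =>
    simp only [matsunoDensity_add_two _ (n + 1)]
    exact ih.negDeriv.add (almostSquare_matsunoRest hσ (n + 1))

theorem almostSquare_gradDensity {σ : ℝ} (hσ : 11 / 4 < σ) (n : ℕ) :
    AlmostSquare n fun D : Datum σ => gradDensity D.v (n + 2) := by
  have hsum (n : ℕ) : AlmostSquare n fun D : Datum σ =>
      ∑ i ∈ Finset.range (n + 1), potential D.v (n - i) * gradDensity D.v (i + 1) := by
    refine AlmostSquare.sum fun i hi => ?_
    have hi' := Finset.mem_range.1 hi
    exact AlmostSquare.mul_of_linear hσ (by omega) (hasOrder_potential hσ _)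
      (hasOrder_potential_sub hσ (n - i)) (hasOrder_gradDensity_sub hσ i)
  induction n with
  | zero =>
    simp only [gradDensity_add_two _ 0, zero_add 1, matsunoDensity_one, gradDensity_one]
    exact ((AlmostSquare.multiplier_self _ _).add (AlmostSquare.multiplier_self _ _)).add
      (by simpa only [zero_add, gradDensity_one] using hsum 0)
  | succ n ih =>
    simp only [gradDensity_add_two _ (n + 1)]
    exact (ih.posDeriv.add (almostSquare_matsunoDensity hσ n).negDeriv).add (hsum (n + 1))

/-! ### The bound for the derivative of the energies -/

theorem conj_coeff_sq {σ : ℝ} (D : Datum σ) (p : ℤ) :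
    (D.v * D.v).coeff (-p) = conj ((D.v * D.v).coeff p) :=
  IsReal.mul D.conj_coeff D.conj_coeff p

/-- The deterministic bound for the derivative of the energies. At the frequencies `|p| > N`, the
gradient is a real multiple of `|p|ⁿ⁻¹ (v²)^(p)` plus an error; the pairing of the former with
`∂ₓ(v²)` is purely imaginary. For `n = 0` the gradient is `v`, which has no such frequencies. -/
theorem abs_re_pairing_le {σ : ℝ} (hσ : 11 / 4 < σ) (n : ℕ) : ∃ C : ℝ, 0 ≤ C ∧ ∀ D : Datum σ,
    |((gradDensity D.v (n + 1) * highPart D.N (dx (D.v * D.v))).coeff 0).re| ≤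
      C * (1 + D.M) ^ (n + 3) * D.L ^ ((n : ℝ) - 1 - 2 * σ) := by
  cases n with
  | zero =>
    refine ⟨0, le_rfl, fun D => ?_⟩
    rw [gradDensity_one, coeff_mul, Finset.sum_eq_zero]
    · simp
    · intro a _
      rw [highPart_coeff]
      split_ifs with h
      · rw [mul_zero]
      · rw [D.coeff_eq_zero a, zero_mul]
        rwa [zero_sub, abs_neg, not_le] at h
  | succ n =>
    obtain ⟨x, y, C, hC, hz⟩ := almostSquare_gradDensity hσ n
    have hK := convConst_nonneg σ
    set Z : ℝ := 2 * ∑' n, decay (3 / 2) n with hZ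
    have hZ0 : 0 ≤ Z := mul_nonneg zero_le_two (tsum_nonneg fun n => (decay_pos _ n).le)
    refine ⟨C * 2 * convConst σ * Z, by positivity, fun D => ?_⟩
    have hL := D.L_pos
    have hM := D.M_nonneg
    have hs := D.size_nonneg 3 (n + 2)
    set g := gradDensity D.v (n + 2) with hg
    set S := g.coeff.support with hS
    set S' := S.filter fun a => (D.N : ℤ) < |a| with hS'
    have h1 : ((g * highPart D.N (dx (D.v * D.v))).coeff 0).re =
        ∑ a ∈ S', ((g.coeff a - (signPow x y n (D.v * D.v)).coeff a) *
          (I * (-a : ℤ) * (D.v * D.v).coeff (-a))).re := by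
      rw [coeff_mul, Complex.re_sum, hS', Finset.sum_filter]
      refine Finset.sum_congr rfl fun a _ => ?_
      rw [zero_sub, highPart_coeff, abs_neg]
      by_cases h : (D.N : ℤ) < |a|
      · rw [if_pos h, if_neg (not_le.2 h), dx_coeff, sub_mul, Complex.sub_re]
        -- the main term is a real multiple of `i |(v²)^(a)|²`
        have h2 : ((signPow x y n (D.v * D.v)).coeff a *
            (I * (-a : ℤ) * (D.v * D.v).coeff (-a))).re = 0 := by
          rw [conj_coeff_sq, signPow_coeff]
          have e : (((if 0 < a then x else y) * |(a : ℝ)| ^ n : ℝ) : ℂ) * (D.v * D.v).coeff a *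
              (I * (-a : ℤ) * conj ((D.v * D.v).coeff a)) =
              (((if 0 < a then x else y) * |(a : ℝ)| ^ n * (-a) *
                Complex.normSq ((D.v * D.v).coeff a) : ℝ) : ℂ) * I := by
            rw [Complex.ofReal_mul _ (Complex.normSq _), ← Complex.mul_conj]
            push_cast
            ring
          rw [e, Complex.re_ofReal_mul, Complex.I_re, mul_zero]
        rw [h2, sub_zero]
      · rw [if_neg h, if_pos (not_lt.1 h), mul_zero, Complex.zero_re]
    have hterm : ∀ a ∈ S', |((g.coeff a - (signPow x y n (D.v * D.v)).coeff a) *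
          (I * (-a : ℤ) * (D.v * D.v).coeff (-a))).re| ≤
        (C * D.size 3 (n + 2) * (2 * D.L) * (D.M ^ 2 * convConst σ)) * weight σ D.N a ^ 2 := by
      intro a ha
      have ha' : (D.N : ℤ) < |a| := (Finset.mem_filter.1 ha).2
      have hw := weight_pos σ D.N a
      refine (Complex.abs_re_le_norm _).trans ?_
      rw [norm_mul, norm_mul, norm_mul, Complex.norm_I, one_mul, Complex.norm_intCast, Int.cast_neg,
        abs_neg]
      rcases lt_or_ge (2 * D.N : ℤ) |a| with h | h
      · rw [coeff_sq_eq_zero D (by rwa [abs_neg]), norm_zero, mul_zero, mul_zero]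
        positivity
      · have h2 : |(a : ℝ)| ≤ 2 * D.L := by
          have : |(a : ℝ)| ≤ 2 * D.N := by exact_mod_cast h
          rw [Datum.L]
          linarith
        have h3 := norm_coeff_sq_le hσ D (-a)
        rw [weight_neg] at h3
        calc _ ≤ (C * D.size 3 (n + 2) * weight σ D.N a) *
              ((2 * D.L) * (D.M ^ 2 * (convConst σ * weight σ D.N a))) := by
              gcongr
              exact (hz D).2 a ha'
          _ = _ := by ring
    have hsq := sum_weight_sq_le (by linarith : 0 ≤ σ) D.N S' fun a ha => (Finset.mem_filter.1 ha).2
    rw [← hZ] at hsq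
    rw [h1]
    refine (Finset.abs_sum_le_sum_abs _ _).trans ((Finset.sum_le_sum hterm).trans ?_)
    rw [← Finset.mul_sum]
    have e1 : D.size 3 (n + 2) * D.L = (1 + D.M) ^ (n + 2) * D.L ^ (n : ℝ) := by
      rw [Datum.size, mul_pow, Real.rpow_natCast]
      field_simp
      ring
    have e2 : D.L ^ (((n + 1 : ℕ) : ℝ) - 1 - 2 * σ) = D.L ^ (n : ℝ) * D.L ^ (-(2 * σ)) := by
      rw [← Real.rpow_add hL]
      congr 1
      push_cast
      ring
    calc _ ≤ (C * D.size 3 (n + 2) * (2 * D.L) * (D.M ^ 2 * convConst σ)) *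
          (D.L ^ (-(2 * σ)) * Z) := mul_le_mul_of_nonneg_left hsq (by positivity)
      _ = (C * 2 * convConst σ * Z) * D.M ^ 2 * (D.size 3 (n + 2) * D.L) * D.L ^ (-(2 * σ)) := by
          ring
      _ ≤ (C * 2 * convConst σ * Z) * (1 + D.M) ^ 2 * (D.size 3 (n + 2) * D.L) *
            D.L ^ (-(2 * σ)) := by
          gcongr
          linarith
      _ = _ := by
          rw [e1, e2]
          ring

/-! ### Ordinary differential equations with a coercive conserved quantity -/

/-- A bounded Lipschitz vector field has global integral curves. -/
theorem exists_global_of_lipschitz {E : Type*} [NormedAddCommGroup E] [NormedSpace ℝ E]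
    [CompleteSpace E] {G : E → E} {K : NNReal} (hK : LipschitzWith K G) {B : NNReal}
    (hB : ∀ x, ‖G x‖ ≤ B) (x₀ : E) :
    ∃ x : ℝ → E, x 0 = x₀ ∧ ∀ t, HasDerivAt x (G (x t)) t := by
  have hloc (T : ℝ) (hT : 0 ≤ T) : ∃ x : ℝ → E, x 0 = x₀ ∧
      ∀ t ∈ Set.Icc (-T) T, HasDerivWithinAt x (G (x t)) (Set.Icc (-T) T) t := by
    have hP : IsPicardLindelof (fun _ => G) (⟨0, by constructor <;> linarith⟩ : Set.Icc (-T) T) x₀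
        (B * ⟨T, hT⟩) 0 B K :=
      IsPicardLindelof.of_time_independent (fun x _ => hB x) hK.lipschitzOnWith
        (by
          simp only [sub_zero, zero_sub, neg_neg, max_self, NNReal.coe_zero]
          exact le_rfl)
    exact hP.exists_eq_forall_mem_Icc_hasDerivWithinAt₀
  choose y hy0 hy using fun n : ℕ => hloc (n + 1) (by positivity)
  have hy' (n : ℕ) (t : ℝ) (ht : t ∈ Set.Ioo (-(n + 1 : ℝ)) (n + 1)) :
      HasDerivAt (y n) (G (y n t)) t :=
    (hy n t (Set.Ioo_subset_Icc_self ht)).hasDerivAt (Icc_mem_nhds ht.1 ht.2)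
  have hagree (n k : ℕ) (h : n ≤ k) : Set.EqOn (y n) (y k) (Set.Ioo (-(n + 1 : ℝ)) (n + 1)) := by
    have hnk : (n : ℝ) ≤ k := by exact_mod_cast h
    have hn : (0 : ℝ) ≤ n := n.cast_nonneg
    refine ODE_solution_unique_of_mem_Ioo (v := fun _ => G) (s := fun _ => Set.univ) (K := K)
      (t₀ := 0) (fun t _ => hK.lipschitzOnWith) ⟨by linarith, by linarith⟩
      (fun t ht => ⟨hy' n t ht, trivial⟩) (fun t ht => ⟨hy' k t ⟨?_, ?_⟩, trivial⟩) ?_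
    · linarith [ht.1]
    · linarith [ht.2]
    · rw [hy0, hy0]
  refine ⟨fun t => y ⌈|t|⌉₊ t, by simp [hy0], fun t => ?_⟩
  set n := ⌈|t|⌉₊ with hn
  have htn : |t| ≤ n := Nat.le_ceil _
  have ht : t ∈ Set.Ioo (-(n + 1 : ℝ)) (n + 1) := by
    rcases abs_le.1 htn with ⟨h1, h2⟩
    exact ⟨by linarith, by linarith⟩
  refine (hy' n t ht).congr_of_eventuallyEq ?_
  filter_upwards [Ioo_mem_nhds ht.1 ht.2] with s hs
  rcases le_total n ⌈|s|⌉₊ with h | h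
  · exact (hagree n _ h hs).symm
  · refine hagree _ n h ?_
    rcases abs_le.1 (Nat.le_ceil |s|) with ⟨h1, h2⟩
    exact ⟨by linarith, by linarith⟩

section Conserved

variable {E : Type*} [NormedAddCommGroup E] [NormedSpace ℝ E] {F : E → E} {Q : E → ℝ}

/-- The quantity `Q` is conserved also if time is reparametrized, as happens after a cutoff. -/
theorem conserved_eq (hQ : ∀ (x : ℝ → E) (t c : ℝ), HasDerivAt x (c • F (x t)) t →
      HasDerivAt (fun s => Q (x s)) 0 t) {x : ℝ → E} {c : ℝ → ℝ}
    (hx : ∀ t, HasDerivAt x (c t • F (x t)) t) (t : ℝ) : Q (x t) = Q (x 0) :=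
  is_const_of_deriv_eq_zero (fun t => (hQ x t (c t) (hx t)).differentiableAt)
    (fun t => (hQ x t (c t) (hx t)).deriv) t 0

variable [FiniteDimensional ℝ E]

/-- The vector field, cut off outside of a large ball. -/
theorem exists_cutoff (hF : ContDiff ℝ 1 F) (B : ℝ) :
    ∃ (χ : E → ℝ) (K : NNReal) (M : NNReal), (∀ x, ‖x‖ ≤ B → χ x = 1) ∧
      LipschitzWith K (fun x => χ x • F x) ∧ ∀ x, ‖χ x • F x‖ ≤ M := by
  let f : ContDiffBump (0 : E) := ⟨|B| + 1, |B| + 2, by positivity, by linarith⟩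
  have hs : HasCompactSupport fun x => f x • F x := f.hasCompactSupport.smul_right
  have hc : ContDiff ℝ 1 fun x => f x • F x := f.contDiff.smul hF
  obtain ⟨K, hK⟩ := hc.lipschitzWith_of_hasCompactSupport hs one_ne_zero
  obtain ⟨M, hM⟩ := hs.exists_bound_of_continuous hc.continuous
  refine ⟨f, K, ⟨max M 0, le_max_right _ _⟩, fun x hx => f.one_of_mem_closedBall ?_, hK,
    fun x => (hM x).trans (le_max_left _ _)⟩
  rw [mem_closedBall_zero_iff]
  change ‖x‖ ≤ |B| + 1
  linarith [le_abs_self B]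

/-- The conserved quantity keeps the solution of the cut off equation in the region where the cutoff
is not felt. -/
theorem exists_global_of_conserved (hF : ContDiff ℝ 1 F)
    (hQ : ∀ (x : ℝ → E) (t c : ℝ), HasDerivAt x (c • F (x t)) t →
      HasDerivAt (fun s => Q (x s)) 0 t)
    (hcoer : ∀ R, ∃ B, ∀ x, Q x ≤ R → ‖x‖ ≤ B) (x₀ : E) :
    ∃ x : ℝ → E, x 0 = x₀ ∧ (∀ t, HasDerivAt x (F (x t)) t) ∧ ∃ B, ∀ t, ‖x t‖ ≤ B := by
  have := FiniteDimensional.complete ℝ E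
  obtain ⟨B, hB⟩ := hcoer (Q x₀)
  obtain ⟨χ, K, M, hχ, hK, hM⟩ := exists_cutoff hF B
  obtain ⟨x, hx0, hx⟩ := exists_global_of_lipschitz hK hM x₀
  have hb (t : ℝ) : ‖x t‖ ≤ B := by
    refine hB _ (le_of_eq ?_)
    rw [conserved_eq hQ (c := fun t => χ (x t)) hx t, hx0]
  refine ⟨x, hx0, fun t => ?_, B, hb⟩
  have h := hx t
  rwa [hχ _ (hb t), one_smul] at h

theorem unique_of_conserved (hF : ContDiff ℝ 1 F)
    (hQ : ∀ (x : ℝ → E) (t c : ℝ), HasDerivAt x (c • F (x t)) t →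
      HasDerivAt (fun s => Q (x s)) 0 t)
    (hcoer : ∀ R, ∃ B, ∀ x, Q x ≤ R → ‖x‖ ≤ B) {x y : ℝ → E}
    (hx : ∀ t, HasDerivAt x (F (x t)) t) (hy : ∀ t, HasDerivAt y (F (y t)) t) (h0 : x 0 = y 0) :
    x = y := by
  obtain ⟨B, hB⟩ := hcoer (Q (x 0))
  obtain ⟨χ, K, M, hχ, hK, hM⟩ := exists_cutoff hF B
  have key {z : ℝ → E} (hz : ∀ t, HasDerivAt z (F (z t)) t) (hz0 : z 0 = x 0) (t : ℝ) :
      HasDerivAt z (χ (z t) • F (z t)) t := by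
    have : ‖z t‖ ≤ B := by
      refine hB _ (le_of_eq ?_)
      rw [conserved_eq hQ (c := fun _ => 1) (by simpa using hz) t, hz0]
    rw [hχ _ this, one_smul]
    exact hz t
  exact ODE_solution_unique_univ (v := fun _ z => χ z • F z) (s := fun _ => Set.univ) (K := K)
    (fun _ => hK.lipschitzOnWith) (fun t => ⟨key hx rfl t, trivial⟩)
    (fun t => ⟨key hy h0.symm t, trivial⟩) h0

end Conserved

/-! ### The truncated flow -/

/-- The vector field `-H∂ₓ²p - π_N(p∂ₓp)` of the truncated problem. -/
def truncField (N : ℕ) (p : TrigPoly) : TrigPoly :=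
  -hilbert (dx (dx p)) - dirichletProj N (p * dx p)

theorem dirichletProj_coeff (N : ℕ) (p : TrigPoly) (n : ℤ) :
    (dirichletProj N p).coeff n = if |n| ≤ (N : ℤ) then p.coeff n else 0 := by
  have h : (dirichletProj N p).coeff n = (if |n| ≤ (N : ℤ) then 1 else 0) * p.coeff n :=
    multiplier_coeff _ _ _
  rw [h]
  split_ifs <;> simp

theorem truncField_coeff (N : ℕ) (p : TrigPoly) (n : ℤ) :
    (truncField N p).coeff n = -(hilbertSymbol n * (I * n) ^ 2) * p.coeff n -
      (dirichletProj N (p * dx p)).coeff n := by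
  rw [truncField, AddMonoidAlgebra.coeff_sub, Finsupp.sub_apply, AddMonoidAlgebra.coeff_neg,
    Finsupp.neg_apply, hilbert, multiplier_coeff, dx_coeff, dx_coeff]
  ring

/-- The frequency `-n² sgn(n)` of the free evolution. -/
theorem hilbertSymbol_mul_sq (n : ℤ) :
    -(hilbertSymbol n * (I * n) ^ 2) = ((-(n.sign * n ^ 2) : ℤ) : ℂ) * I := by
  rw [hilbertSymbol]
  push_cast
  linear_combination (n.sign : ℂ) * (n : ℂ) ^ 2 * I * I_sq

theorem IsReal.truncField {p : TrigPoly} (hp : IsReal p) (N : ℕ) : IsReal (truncField N p) := by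
  intro n
  rw [truncField_coeff, truncField_coeff, dirichletProj_coeff, dirichletProj_coeff, abs_neg,
    hilbertSymbol_mul_sq, hilbertSymbol_mul_sq, map_sub, map_mul, map_mul,
    map_intCast, Complex.conj_I, hp n, Int.sign_neg]
  congr 1
  · push_cast
    ring
  · split_ifs
    · exact hp.mul hp.dx n
    · exact (map_zero _).symm

/-- `∫ p² ∂ₓp dx = 0`. -/
theorem coeff_zero_mul_mul_dx (p : TrigPoly) : (p * (p * dx p)).coeff 0 = 0 := by
  have h : dx (p * (p * p)) = (3 : ℂ) • (p * (p * dx p)) := by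
    rw [dx_mul, dx_mul, show (3 : ℂ) = 1 + 1 + 1 by norm_num, add_smul, add_smul, one_smul]
    ring
  have h1 := congrArg (fun q : TrigPoly => q.coeff 0) h
  simp only [dx_coeff, AddMonoidAlgebra.coeff_smul_apply, smul_eq_mul] at h1
  simpa using h1.symm

theorem coeff_zero_mul_dx (p : TrigPoly) : (p * dx p).coeff 0 = 0 := by
  have h : dx (p * p) = (2 : ℂ) • (p * dx p) := by
    rw [dx_mul, two_smul]
    ring
  have h1 := congrArg (fun q : TrigPoly => q.coeff 0) h
  simp only [dx_coeff, AddMonoidAlgebra.coeff_smul_apply, smul_eq_mul] at h1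
  simpa using h1.symm

/-- The real valued trigonometric polynomial of zero mean value with given coefficients at the
frequencies `1, …, N`. -/
def realPoly {N : ℕ} (x : Fin N → ℂ) : TrigPoly :=
  ∑ j : Fin N, (AddMonoidAlgebra.single ((j : ℤ) + 1) (x j) +
    AddMonoidAlgebra.single (-((j : ℤ) + 1)) (conj (x j)))

section RealPoly

variable {N : ℕ}

theorem realPoly_coeff (x : Fin N → ℂ) (n : ℤ) : (realPoly x).coeff n =
    ∑ j : Fin N, ((if (j : ℤ) + 1 = n then x j else 0) +
      (if -((j : ℤ) + 1) = n then conj (x j) else 0)) := by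
  rw [realPoly, AddMonoidAlgebra.coeff_sum, Finsupp.finsetSum_apply]
  refine Finset.sum_congr rfl fun j _ => ?_
  rw [AddMonoidAlgebra.coeff_add, Finsupp.add_apply, AddMonoidAlgebra.coeff_single,
    AddMonoidAlgebra.coeff_single, Finsupp.single_apply, Finsupp.single_apply]

theorem realPoly_coeff_succ (x : Fin N → ℂ) (k : Fin N) :
    (realPoly x).coeff ((k : ℤ) + 1) = x k := by
  rw [realPoly_coeff, Finset.sum_eq_single k]
  · rw [if_pos rfl, if_neg (by omega), add_zero]
  · intro j _ hj
    have : (j : ℕ) ≠ k := fun h => hj (Fin.ext h)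
    rw [if_neg (by omega), if_neg (by omega), add_zero]
  · simp

theorem realPoly_coeff_eq_zero (x : Fin N → ℂ) {n : ℤ} (h : ¬|n| ≤ (N : ℤ)) :
    (realPoly x).coeff n = 0 := by
  rw [realPoly_coeff]
  refine Finset.sum_eq_zero fun j _ => ?_
  have hj := j.2
  rw [abs_le] at h
  rw [if_neg (by omega), if_neg (by omega), add_zero]

theorem realPoly_coeff_zero (x : Fin N → ℂ) : (realPoly x).coeff 0 = 0 := by
  rw [realPoly_coeff]
  refine Finset.sum_eq_zero fun j _ => ?_
  rw [if_neg (by omega), if_neg (by omega), add_zero]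

theorem isReal_realPoly (x : Fin N → ℂ) : IsReal (realPoly x) := by
  intro n
  rw [realPoly_coeff, realPoly_coeff, map_sum]
  refine Finset.sum_congr rfl fun j _ => ?_
  rw [map_add, apply_ite conj, apply_ite conj, map_zero, Complex.conj_conj, add_comm]
  congr 1
  · simp only [neg_inj]
  · congr 1
    exact propext ⟨fun h => by omega, fun h => by omega⟩

/-- A real valued trigonometric polynomial of zero mean value is determined by its coefficients at
positive frequencies. -/
theorem eq_realPoly {p : TrigPoly} (hp : IsReal p) (h0 : p.coeff 0 = 0)
    (hN : ∀ n : ℤ, ¬|n| ≤ (N : ℤ) → p.coeff n = 0) :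
    p = realPoly fun k : Fin N => p.coeff ((k : ℤ) + 1) := by
  have hpos : ∀ n : ℤ, 0 < n →
      p.coeff n = (realPoly fun k : Fin N => p.coeff ((k : ℤ) + 1)).coeff n := by
    intro n hn
    by_cases h : |n| ≤ (N : ℤ)
    · rw [abs_of_pos hn] at h
      have e : n = (((⟨(n - 1).toNat, by omega⟩ : Fin N) : ℕ) : ℤ) + 1 := by
        simp only
        omega
      rw [e, realPoly_coeff_succ]
    · rw [hN n h, realPoly_coeff_eq_zero _ h]
  ext n
  rcases lt_trichotomy n 0 with hn | rfl | hn
  · rw [← neg_neg n, hp, isReal_realPoly, hpos (-n) (by omega)]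
  · rw [h0, realPoly_coeff_zero]
  · exact hpos n hn

/-- The truncated problem in the coordinates `û(1), …, û(N)`. -/
def coordField (N : ℕ) (x : Fin N → ℂ) : Fin N → ℂ := fun k =>
  (truncField N (realPoly x)).coeff ((k : ℤ) + 1)

theorem contDiff_coordField (N : ℕ) : ContDiff ℝ 1 (coordField N) := by
  have hc (n : ℤ) : ContDiff ℝ 1 fun x : Fin N → ℂ => (realPoly x).coeff n := by
    simp only [realPoly_coeff]
    refine ContDiff.sum fun j _ => ContDiff.add ?_ ?_
    · split_ifs
      · exact contDiff_apply ℝ ℂ j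
      · exact contDiff_const
    · split_ifs
      · exact Complex.conjCLE.contDiff.comp (contDiff_apply ℝ ℂ j)
      · exact contDiff_const
  have hS (x : Fin N → ℂ) : (realPoly x).coeff.support ⊆ Finset.Icc (-(N : ℤ)) N := by
    intro a ha
    by_contra h
    rw [Finset.mem_Icc, ← abs_le] at h
    exact Finsupp.mem_support_iff.1 ha (realPoly_coeff_eq_zero x h)
  refine contDiff_pi.2 fun k => ?_
  simp only [coordField, truncField_coeff, dirichletProj_coeff]
  refine ContDiff.sub (contDiff_const.mul (hc _)) ?_
  split_ifs
  · simp only [coeff_mul_of_subset _ _ _ (hS _), dx_coeff]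
    exact ContDiff.sum fun a _ => (hc a).mul (contDiff_const.mul (hc _))
  · exact contDiff_const

theorem hasDerivAt_realPoly {x : ℝ → Fin N → ℂ} {t c : ℝ}
    (hx : HasDerivAt x (c • coordField N (x t)) t) {n : ℤ} (hn : |n| ≤ (N : ℤ)) :
    HasDerivAt (fun s => (realPoly (x s)).coeff n) (c * (truncField N (realPoly (x t))).coeff n)
      t := by
  have hpos : ∀ n : ℤ, 0 < n → |n| ≤ (N : ℤ) → HasDerivAt (fun s => (realPoly (x s)).coeff n)
      (c * (truncField N (realPoly (x t))).coeff n) t := by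
    intro n h0 hn
    rw [abs_of_pos h0] at hn
    obtain ⟨k, rfl⟩ : ∃ k : Fin N, n = (k : ℤ) + 1 :=
      ⟨⟨(n - 1).toNat, by omega⟩, by simp only; omega⟩
    simp only [realPoly_coeff_succ]
    exact (hasDerivAt_pi.1 hx k).congr_deriv Complex.real_smul
  rcases lt_trichotomy n 0 with h0 | rfl | h0
  · have h := Complex.conjCLE.hasFDerivAt.comp_hasDerivAt t
      (hpos (-n) (by omega) (by rwa [abs_neg]))
    have e (y : Fin N → ℂ) : (realPoly y).coeff n = conj ((realPoly y).coeff (-n)) := by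
      rw [← isReal_realPoly, neg_neg]
    simp only [e]
    refine h.congr_deriv ?_
    have e' := (isReal_realPoly (x t)).truncField N (-n)
    rw [neg_neg] at e'
    rw [e']
    simp
  · simp only [realPoly_coeff_zero]
    rw [truncField_coeff, realPoly_coeff_zero, dirichletProj_coeff, coeff_zero_mul_dx]
    simpa using hasDerivAt_const t (0 : ℂ)
  · exact hpos n h0 hn

/-- The square of the `L²` norm. -/
def sqNorm (x : Fin N → ℂ) : ℝ := ∑ n ∈ Finset.Icc (-(N : ℤ)) N, ‖(realPoly x).coeff n‖ ^ 2

theorem hasDerivAt_sqNorm (x : ℝ → Fin N → ℂ) (t c : ℝ)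
    (hx : HasDerivAt x (c • coordField N (x t)) t) :
    HasDerivAt (fun s => sqNorm (x s)) 0 t := by
  set p := realPoly (x t) with hp
  have hmem {n : ℤ} (hn : n ∈ Finset.Icc (-(N : ℤ)) N) : |n| ≤ (N : ℤ) :=
    abs_le.2 (Finset.mem_Icc.1 hn)
  have h : HasDerivAt (fun s => sqNorm (x s)) (∑ n ∈ Finset.Icc (-(N : ℤ)) N,
      2 * (c * (conj (p.coeff n) * (truncField N p).coeff n).re)) t := by
    refine HasDerivAt.fun_sum fun n hn => ?_
    have h1 := (hasDerivAt_realPoly hx (hmem hn)).norm_sq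
    refine h1.congr_deriv ?_
    rw [Complex.inner, ← hp, mul_assoc, Complex.re_ofReal_mul, mul_comm (conj _)]
  refine h.congr_deriv ?_
  have hS : p.coeff.support ⊆ Finset.Icc (-(N : ℤ)) N := by
    intro a ha
    by_contra h
    rw [Finset.mem_Icc, ← abs_le] at h
    exact Finsupp.mem_support_iff.1 ha (realPoly_coeff_eq_zero _ h)
  rw [← Finset.mul_sum, ← Finset.mul_sum, ← Complex.re_sum]
  have h2 : (∑ n ∈ Finset.Icc (-(N : ℤ)) N, conj (p.coeff n) * (truncField N p).coeff n).re = 0 := by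
    have h3 : ∑ n ∈ Finset.Icc (-(N : ℤ)) N, conj (p.coeff n) * (p * dx p).coeff n = 0 := by
      rw [← coeff_zero_mul_mul_dx p, coeff_mul_of_subset _ _ _ hS]
      refine Finset.sum_nbij' (fun a => -a) (fun a => -a) ?_ ?_ ?_ ?_ ?_
      · intro a ha
        rw [Finset.mem_Icc] at ha ⊢
        exact ⟨by linarith [ha.2], by linarith [ha.1]⟩
      · intro a ha
        rw [Finset.mem_Icc] at ha ⊢
        exact ⟨by linarith [ha.2], by linarith [ha.1]⟩
      · intro a _; simp
      · intro a _; simp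
      · intro a _
        rw [isReal_realPoly, zero_sub, neg_neg]
    have h4 : ∑ n ∈ Finset.Icc (-(N : ℤ)) N, conj (p.coeff n) * (truncField N p).coeff n =
        ∑ n ∈ Finset.Icc (-(N : ℤ)) N,
          (((-(n.sign * n ^ 2) : ℤ) * Complex.normSq (p.coeff n) : ℝ) : ℂ) * I -
        ∑ n ∈ Finset.Icc (-(N : ℤ)) N, conj (p.coeff n) * (p * dx p).coeff n := by
      rw [← Finset.sum_sub_distrib]
      refine Finset.sum_congr rfl fun n hn => ?_
      rw [truncField_coeff, dirichletProj_coeff, if_pos (hmem hn), hilbertSymbol_mul_sq,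
        Complex.ofReal_mul, Complex.normSq_eq_conj_mul_self]
      push_cast
      ring
    rw [h4, h3, sub_zero, Complex.re_sum]
    refine Finset.sum_eq_zero fun n _ => ?_
    rw [Complex.re_ofReal_mul, Complex.I_re, mul_zero]
  rw [h2]
  ring

theorem sqNorm_coercive (R : ℝ) : ∃ B, ∀ x : Fin N → ℂ, sqNorm x ≤ R → ‖x‖ ≤ B := by
  refine ⟨√R, fun x hx => (pi_norm_le_iff_of_nonneg (Real.sqrt_nonneg R)).2 fun k => ?_⟩
  refine Real.le_sqrt_of_sq_le (le_trans ?_ hx)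
  have hk : ((k : ℤ) + 1) ∈ Finset.Icc (-(N : ℤ)) N := by
    have := k.2
    rw [Finset.mem_Icc]
    omega
  have := Finset.single_le_sum (f := fun n : ℤ => ‖(realPoly x).coeff n‖ ^ 2)
    (fun n _ => by positivity) hk
  rwa [realPoly_coeff_succ] at this

end RealPoly

/-! ### The topology of the Sobolev spaces -/

section Sobolev

variable {s : ℝ}

theorem Sobolev.isometry_toLp (s : ℝ) : Isometry (Sobolev.toLp s) :=
  AddMonoidHomClass.isometry_of_norm (Sobolev.toLp s) fun _ => rfl

theorem Sobolev.toLp_apply (u : Sobolev s) (n : ℤ) :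
    (Sobolev.toLp s u : ℤ → ℂ) n = (1 + (n : ℝ) ^ 2) ^ (s / 2) • fc u n := rfl

theorem Sobolev.weight_pos (s : ℝ) (n : ℤ) : 0 < (1 + (n : ℝ) ^ 2) ^ (s / 2) :=
  Real.rpow_pos_of_pos (by positivity) _

theorem Sobolev.norm_sq (u : Sobolev s) :
    ‖u‖ ^ 2 = ∑' n : ℤ, ‖(1 + (n : ℝ) ^ 2) ^ (s / 2) • fc u n‖ ^ 2 := by
  have h := lp.norm_rpow_eq_tsum (p := 2) (by norm_num) (Sobolev.toLp s u)
  simp only [ENNReal.toReal_ofNat, Real.rpow_ofNat] at h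
  exact h

theorem fc_zero_freq (u : Sobolev s) : fc u 0 = 0 := u.2.1

theorem fc_neg (u : Sobolev s) (n : ℤ) : fc u (-n) = conj (fc u n) := u.2.2.1 n

theorem memℓp_fc (u : Sobolev s) :
    Memℓp (fun n : ℤ => (1 + (n : ℝ) ^ 2) ^ (s / 2) • fc u n) 2 := u.2.2.2

theorem fc_injective : Function.Injective (fc : Sobolev s → ℤ → ℂ) := Subtype.val_injective

theorem continuous_fc_apply (n : ℤ) : Continuous fun u : Sobolev s => fc u n := by
  have h : Continuous fun u : Sobolev s => (Sobolev.toLp s u : ℤ → ℂ) n :=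
    (continuous_apply n).comp (lp.uniformContinuous_coe.continuous.comp
      (Sobolev.isometry_toLp s).continuous)
  have h2 := h.const_smul ((1 + (n : ℝ) ^ 2) ^ (s / 2))⁻¹
  refine h2.congr fun u => ?_
  rw [Pi.smul_apply, Sobolev.toLp_apply, inv_smul_smul₀ (Sobolev.weight_pos s n).ne']

theorem isReal_trunc (N : ℕ) (u : Sobolev s) : IsReal (trunc N u) := by
  intro n
  rw [trunc_coeff, trunc_coeff, abs_neg, fc_neg]
  split_ifs
  · rfl
  · exact (map_zero _).symm

theorem trunc_coeff_zero (N : ℕ) (u : Sobolev s) : (trunc N u).coeff 0 = 0 := by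
  rw [trunc_coeff, fc_zero_freq, ite_self]

/-- The coordinates `û(1), …, û(N)`. -/
def lowCoord (N : ℕ) (u : Sobolev s) : Fin N → ℂ := fun k => fc u ((k : ℤ) + 1)

theorem trunc_eq_realPoly (N : ℕ) (u : Sobolev s) : trunc N u = realPoly (lowCoord N u) := by
  have h := eq_realPoly (N := N) (isReal_trunc N u) (trunc_coeff_zero N u) fun n hn => by
    rw [trunc_coeff, if_neg hn]
  rw [h]
  congr 1
  funext k
  rw [trunc_coeff, if_pos, lowCoord]
  have := k.2
  rw [abs_le]
  omega

theorem fc_of_abs_le {N : ℕ} (u : Sobolev s) {n : ℤ} (hn : |n| ≤ (N : ℤ)) :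
    fc u n = (realPoly (lowCoord N u)).coeff n := by
  rw [← trunc_eq_realPoly, trunc_coeff, if_pos hn]

/-! ### Well-posedness of the truncated problem -/

/-- The symbol of `-H∂ₓ²`. -/
def freeSymbol (n : ℤ) : ℂ := -(hilbertSymbol n * (I * n) ^ 2)

theorem norm_exp_freeSymbol (n : ℤ) (t : ℝ) : ‖Complex.exp (freeSymbol n * t)‖ = 1 := by
  rw [freeSymbol, hilbertSymbol_mul_sq, mul_right_comm, ← Complex.ofReal_intCast,
    ← Complex.ofReal_mul, Complex.norm_exp_ofReal_mul_I]

theorem conj_exp_freeSymbol (n : ℤ) (t : ℝ) :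
    conj (Complex.exp (freeSymbol n * t)) = Complex.exp (freeSymbol (-n) * t) := by
  rw [freeSymbol, freeSymbol, hilbertSymbol_mul_sq, hilbertSymbol_mul_sq, ← Complex.exp_conj,
    map_mul, map_mul, map_intCast, Complex.conj_I, Complex.conj_ofReal, Int.sign_neg]
  congr 1
  push_cast
  ring

theorem hasDerivAt_exp_freeSymbol (n : ℤ) (a : ℂ) (t : ℝ) :
    HasDerivAt (fun τ : ℝ => Complex.exp (freeSymbol n * τ) * a)
      (freeSymbol n * (Complex.exp (freeSymbol n * t) * a)) t := by
  have h1 : HasDerivAt (fun τ : ℝ => freeSymbol n * (τ : ℂ)) (freeSymbol n * 1) t :=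
    (Complex.ofRealCLM.hasDerivAt (x := t)).const_mul _
  refine (h1.cexp.mul_const a).congr_deriv ?_
  ring

theorem eq_exp_freeSymbol {n : ℤ} {f : ℝ → ℂ} (hf : ∀ t, HasDerivAt f (freeSymbol n * f t) t)
    (t : ℝ) : f t = Complex.exp (freeSymbol n * t) * f 0 := by
  have h : f = fun τ : ℝ => Complex.exp (freeSymbol n * τ) * f 0 :=
    ODE_solution_unique_univ (v := fun _ z => freeSymbol n * z) (s := fun _ => Set.univ)
      (K := ‖freeSymbol n‖₊) (t₀ := 0)
      (fun _ => (LipschitzWith.of_dist_le_mul fun x y => by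
        rw [dist_eq_norm, dist_eq_norm, ← mul_sub, norm_mul]; rfl).lipschitzOnWith)
      (fun t => ⟨hf t, trivial⟩) (fun t => ⟨hasDerivAt_exp_freeSymbol n (f 0) t, trivial⟩)
      (by simp)
  exact congrFun h t

theorem IsTruncatedSolution.hasDerivAt_lowCoord {N : ℕ} {u₀ : Sobolev s} {u : ℝ → Sobolev s}
    (hu : IsTruncatedSolution N u₀ u) (t : ℝ) :
    HasDerivAt (fun τ => lowCoord N (u τ)) (coordField N (lowCoord N (u t))) t := by
  refine hasDerivAt_pi.2 fun k => ?_
  refine (hu.2.2 t ((k : ℤ) + 1)).congr_deriv ?_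
  have hk : |((k : ℤ) + 1)| ≤ (N : ℤ) := by
    have := k.2
    rw [abs_le]
    omega
  rw [coordField, truncField_coeff, ← trunc_eq_realPoly, trunc_coeff, if_pos hk, neg_mul]

theorem IsTruncatedSolution.fc_high {N : ℕ} {u₀ : Sobolev s} {u : ℝ → Sobolev s}
    (hu : IsTruncatedSolution N u₀ u) {n : ℤ} (hn : ¬|n| ≤ (N : ℤ)) (t : ℝ) :
    fc (u t) n = Complex.exp (freeSymbol n * t) * fc u₀ n := by
  have h := eq_exp_freeSymbol (f := fun τ => fc (u τ) n) (n := n) (fun t => by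
    refine (hu.2.2 t n).congr_deriv ?_
    rw [dirichletProj_coeff, if_neg hn, sub_zero, freeSymbol, neg_mul]) t
  rwa [hu.2.1] at h

theorem IsTruncatedSolution.unique {N : ℕ} {u₀ : Sobolev s} {u w : ℝ → Sobolev s}
    (hu : IsTruncatedSolution N u₀ u) (hw : IsTruncatedSolution N u₀ w) : u = w := by
  have h : (fun τ => lowCoord N (u τ)) = fun τ => lowCoord N (w τ) :=
    unique_of_conserved (contDiff_coordField N) hasDerivAt_sqNorm sqNorm_coercive
      hu.hasDerivAt_lowCoord hw.hasDerivAt_lowCoord (by simp only [hu.2.1, hw.2.1])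
  funext t
  refine fc_injective (funext fun n => ?_)
  by_cases hn : |n| ≤ (N : ℤ)
  · rw [fc_of_abs_le _ hn, fc_of_abs_le _ hn, congrFun h t]
  · rw [hu.fc_high hn, hw.fc_high hn]

/-- The Fourier coefficients of the solution of the truncated problem, in terms of the coordinates
`û(1), …, û(N)` of the solution. -/
def solutionCoeff (N : ℕ) (u₀ : Sobolev s) (x : Fin N → ℂ) (t : ℝ) (n : ℤ) : ℂ :=
  if |n| ≤ (N : ℤ) then (realPoly x).coeff n else Complex.exp (freeSymbol n * t) * fc u₀ n

theorem solutionCoeff_mem (N : ℕ) (u₀ : Sobolev s) (x : Fin N → ℂ) (t : ℝ) :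
    solutionCoeff N u₀ x t ∈ sobolevSubmodule s := by
  refine ⟨?_, fun n => ?_, ?_⟩
  · rw [solutionCoeff, if_pos (by simp), realPoly_coeff_zero]
  · rw [solutionCoeff, solutionCoeff, abs_neg]
    split_ifs
    · exact isReal_realPoly x n
    · rw [map_mul, conj_exp_freeSymbol, fc_neg]
  · have h1 := (memℓp_gen_iff (p := 2) (by norm_num)).1 (memℓp_fc u₀)
    refine (memℓp_gen_iff (p := 2) (by norm_num)).2 ?_
    refine (summable_congr_cofinite ?_).2 h1
    have hfin : (Set.Icc (-(N : ℤ)) N).Finite := Set.finite_Icc _ _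
    filter_upwards [hfin.compl_mem_cofinite] with n hn
    have hn' : ¬|n| ≤ (N : ℤ) := fun h => hn (abs_le.1 h)
    rw [solutionCoeff, if_neg hn', norm_smul, norm_smul, norm_mul, norm_exp_freeSymbol, one_mul]

/-- A path in `Hˢ` is continuous if its Fourier coefficients are continuous and dominated by a
square summable sequence. -/
theorem continuous_of_dominated {u : ℝ → Sobolev s} {b : ℤ → ℝ} (hb : Summable fun n => b n ^ 2)
    (hub : ∀ (t : ℝ) (n : ℤ), ‖(1 + (n : ℝ) ^ 2) ^ (s / 2) • fc (u t) n‖ ≤ b n)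
    (hc : ∀ n, Continuous fun t => fc (u t) n) : Continuous u := by
  rw [continuous_iff_continuousAt]
  intro t₀
  rw [ContinuousAt, tendsto_iff_norm_sub_tendsto_zero]
  have h : Tendsto (fun t => ‖u t - u t₀‖ ^ 2) (𝓝 t₀) (𝓝 0) := by
    simp only [Sobolev.norm_sq]
    rw [← tsum_zero (α := ℝ) (β := ℤ)]
    refine tendsto_tsum_of_dominated_convergence (bound := fun n => (2 * b n) ^ 2) ?_ ?_ ?_
    · simp only [mul_pow]
      exact hb.mul_left _
    · intro n
      have h1 : Continuous fun t => ‖(1 + (n : ℝ) ^ 2) ^ (s / 2) • (fc (u t) n - fc (u t₀) n)‖ ^ 2 := by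
        have := hc n
        fun_prop
      have h2 := h1.tendsto t₀
      have e (t : ℝ) : fc (u t - u t₀) n = fc (u t) n - fc (u t₀) n := rfl
      simpa [e] using h2
    · refine Filter.Eventually.of_forall fun t n => ?_
      have h1 : ‖(1 + (n : ℝ) ^ 2) ^ (s / 2) • fc (u t - u t₀) n‖ ≤ 2 * b n := by
        have e : fc (u t - u t₀) n = fc (u t) n - fc (u t₀) n := rfl
        rw [e, smul_sub, two_mul]
        exact (norm_sub_le _ _).trans (add_le_add (hub t n) (hub t₀ n))
      rw [Real.norm_of_nonneg (by positivity)]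
      exact pow_le_pow_left₀ (norm_nonneg _) h1 2
  have h2 := h.sqrt
  simpa [Real.sqrt_sq] using h2

theorem norm_realPoly_coeff_le {N : ℕ} {x : Fin N → ℂ} {B : ℝ} (hx : ‖x‖ ≤ B) {n : ℤ}
    (hn : |n| ≤ (N : ℤ)) : ‖(realPoly x).coeff n‖ ≤ B := by
  have hB : 0 ≤ B := (norm_nonneg x).trans hx
  have hpos : ∀ n : ℤ, 0 < n → |n| ≤ (N : ℤ) → ‖(realPoly x).coeff n‖ ≤ B := by
    intro n h0 hn
    rw [abs_of_pos h0] at hn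
    obtain ⟨k, rfl⟩ : ∃ k : Fin N, n = (k : ℤ) + 1 :=
      ⟨⟨(n - 1).toNat, by omega⟩, by simp only; omega⟩
    rw [realPoly_coeff_succ]
    exact (norm_le_pi_norm x k).trans hx
  rcases lt_trichotomy n 0 with h0 | rfl | h0
  · rw [← neg_neg n, isReal_realPoly, RCLike.norm_conj]
    exact hpos (-n) (by omega) (by rwa [abs_neg])
  · rwa [realPoly_coeff_zero, norm_zero]
  · exact hpos n h0 hn

theorem exists_isTruncatedSolution (N : ℕ) (u₀ : Sobolev s) :
    ∃ u : ℝ → Sobolev s, IsTruncatedSolution N u₀ u := by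
  obtain ⟨x, hx0, hx, B, hB⟩ := exists_global_of_conserved (contDiff_coordField N)
    hasDerivAt_sqNorm sqNorm_coercive (lowCoord N u₀)
  let u : ℝ → Sobolev s := fun t =>
    (⟨solutionCoeff N u₀ (x t) t, solutionCoeff_mem N u₀ (x t) t⟩ : sobolevSubmodule s)
  have hu (t : ℝ) (n : ℤ) : fc (u t) n = solutionCoeff N u₀ (x t) t n := rfl
  have htrunc (t : ℝ) : trunc N (u t) = realPoly (x t) := by
    ext n
    rw [trunc_coeff, hu, solutionCoeff]
    split_ifs with hn
    · rfl
    · exact (realPoly_coeff_eq_zero _ hn).symm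
  have hderiv (t : ℝ) (n : ℤ) : HasDerivAt (fun τ => fc (u τ) n)
      (-(hilbertSymbol n * (I * n) ^ 2 * fc (u t) n) -
        (dirichletProj N (trunc N (u t) * dx (trunc N (u t)))).coeff n) t := by
    rw [htrunc]
    simp only [hu, solutionCoeff]
    split_ifs with hn
    · have h := hasDerivAt_realPoly (t := t) (c := 1) (by rw [one_smul]; exact hx t) hn
      refine h.congr_deriv ?_
      rw [truncField_coeff]
      push_cast
      ring
    · refine (hasDerivAt_exp_freeSymbol n _ t).congr_deriv ?_
      rw [dirichletProj_coeff, if_neg hn, freeSymbol]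
      ring
  refine ⟨u, ?_, ?_, hderiv⟩
  · have h1 := (memℓp_gen_iff (p := 2) (by norm_num)).1 (memℓp_fc u₀)
    simp only [ENNReal.toReal_ofNat, Real.rpow_ofNat] at h1
    refine continuous_of_dominated (b := fun n => if |n| ≤ (N : ℤ) then
      (1 + (n : ℝ) ^ 2) ^ (s / 2) * B else ‖(1 + (n : ℝ) ^ 2) ^ (s / 2) • fc u₀ n‖) ?_ ?_ ?_
    · refine (summable_congr_cofinite ?_).2 h1
      have hfin : (Set.Icc (-(N : ℤ)) N).Finite := Set.finite_Icc _ _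
      filter_upwards [hfin.compl_mem_cofinite] with n hn
      have hn' : ¬|n| ≤ (N : ℤ) := fun h => hn (abs_le.1 h)
      rw [if_neg hn']
    · intro t n
      have hw := Sobolev.weight_pos s n
      rw [hu, solutionCoeff]
      split_ifs with hn
      · rw [norm_smul, Real.norm_of_nonneg hw.le]
        exact mul_le_mul_of_nonneg_left (norm_realPoly_coeff_le (hB t) hn) hw.le
      · rw [norm_smul, norm_smul, norm_mul, norm_exp_freeSymbol, one_mul]
    · exact fun n => continuous_iff_continuousAt.2 fun t => (hderiv t n).continuousAt
  · refine fc_injective (funext fun n => ?_)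
    rw [hu, solutionCoeff, hx0]
    split_ifs with hn
    · exact (fc_of_abs_le u₀ hn).symm
    · simp

end Sobolev

/-! ### Measurability of the energy rates -/

/-- The random trigonometric polynomial `p`, with frequencies in a fixed finite set, has measurable
coefficients. -/
def MeasurableCoeff {Ω : Type*} [MeasurableSpace Ω] (p : Ω → TrigPoly) : Prop :=
  (∃ S : Finset ℤ, ∀ ω, (p ω).coeff.support ⊆ S) ∧ ∀ n, Measurable fun ω => (p ω).coeff n

namespace MeasurableCoeff

variable {Ω : Type*} [MeasurableSpace Ω] {p q : Ω → TrigPoly}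

theorem const (a : TrigPoly) : MeasurableCoeff fun _ : Ω => a :=
  ⟨⟨a.coeff.support, fun _ => subset_rfl⟩, fun _ => measurable_const⟩

theorem add (hp : MeasurableCoeff p) (hq : MeasurableCoeff q) :
    MeasurableCoeff fun ω => p ω + q ω := by
  obtain ⟨⟨S, hS⟩, hp⟩ := hp
  obtain ⟨⟨T, hT⟩, hq⟩ := hq
  exact ⟨⟨S ∪ T, fun ω => Finsupp.support_add.trans (Finset.union_subset_union (hS ω) (hT ω))⟩,
    fun n => (hp n).add (hq n)⟩

theorem sum {ι : Type*} {J : Finset ι} {p : ι → Ω → TrigPoly}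
    (h : ∀ i ∈ J, MeasurableCoeff (p i)) : MeasurableCoeff fun ω => ∑ i ∈ J, p i ω := by
  classical
  induction J using Finset.induction_on with
  | empty => simpa using const 0
  | insert i J hi ih =>
    simp only [Finset.sum_insert hi]
    exact (h i (Finset.mem_insert_self i J)).add
      (ih fun j hj => h j (Finset.mem_insert_of_mem hj))

theorem mul (hp : MeasurableCoeff p) (hq : MeasurableCoeff q) :
    MeasurableCoeff fun ω => p ω * q ω := by
  obtain ⟨⟨S, hS⟩, hp⟩ := hp
  obtain ⟨⟨T, hT⟩, hq⟩ := hq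
  refine ⟨⟨Finset.image₂ (· + ·) S T, fun ω n hn => ?_⟩, fun n => ?_⟩
  · by_contra hc
    refine Finsupp.mem_support_iff.1 hn ?_
    rw [coeff_mul_of_subset _ _ _ (hS ω)]
    refine Finset.sum_eq_zero fun a ha => ?_
    have h : n - a ∉ T := fun hT' => hc (Finset.mem_image₂.2 ⟨a, ha, n - a, hT', by simp⟩)
    rw [Finsupp.notMem_support_iff.1 (fun h' => h (hT ω h')), mul_zero]
  · simp only [coeff_mul_of_subset _ _ _ (hS _)]
    exact Finset.measurable_fun_sum _ fun a _ => (hp a).mul (hq (n - a))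

theorem smul (c : ℂ) (hp : MeasurableCoeff p) : MeasurableCoeff fun ω => c • p ω := by
  obtain ⟨⟨S, hS⟩, hp⟩ := hp
  exact ⟨⟨S, fun ω => Finsupp.support_smul.trans (hS ω)⟩, fun n => (hp n).const_smul c⟩

theorem multiplier (σ : ℤ → ℂ) (hp : MeasurableCoeff p) :
    MeasurableCoeff fun ω => multiplier σ (p ω) := by
  obtain ⟨⟨S, hS⟩, hp⟩ := hp
  refine ⟨⟨S, fun ω n hn => hS ω ?_⟩, fun n => ?_⟩
  · rw [Finsupp.mem_support_iff, multiplier_coeff] at hn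
    exact Finsupp.mem_support_iff.2 (right_ne_zero_of_mul hn)
  · simp only [multiplier_coeff]
    exact (hp n).const_mul (σ n)

theorem seriesPow {W : Ω → PowerSeries TrigPoly}
    (hW : ∀ n, MeasurableCoeff fun ω => PowerSeries.coeff n (W ω)) (k n : ℕ) :
    MeasurableCoeff fun ω => PowerSeries.coeff n (W ω ^ k) := by
  induction k generalizing n with
  | zero =>
    simp only [pow_zero]
    exact const _
  | succ k ih =>
    simp only [pow_succ, PowerSeries.coeff_mul]
    exact sum fun i _ => (ih _).mul (hW _)

theorem matsunoDensity (hp : MeasurableCoeff p) (n : ℕ) :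
    MeasurableCoeff fun ω => matsunoDensity (p ω) n := by
  induction n using Nat.strong_induction_on with
  | _ n ih =>
    cases n with
    | zero =>
      simp only [BenjaminOno.matsunoDensity]
      exact const 0
    | succ n =>
      simp only [BenjaminOno.matsunoDensity, I_smul_projNeg_dx]
      refine (((ih n n.lt_succ_self).multiplier _).add ?_).add
        (sum fun k _ => (seriesPow (fun j => ?_) k (n + 1)).smul _)
      · split_ifs
        · exact hp
        · exact const 0
      · simp only [PowerSeries.coeff_mk]
        split_ifs with hj
        · exact ih j hj
        · exact const 0

theorem potential (hp : MeasurableCoeff p) (n : ℕ) :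
    MeasurableCoeff fun ω => potential (p ω) n := by
  refine ((hp.matsunoDensity n).multiplier _).add ?_
  split_ifs
  · exact hp
  · exact const 0

theorem gradDensity (hp : MeasurableCoeff p) (n : ℕ) :
    MeasurableCoeff fun ω => gradDensity (p ω) n := by
  induction n using Nat.strong_induction_on with
  | _ n ih =>
    cases n with
    | zero =>
      simp only [BenjaminOno.gradDensity]
      exact const 1
    | succ n =>
      simp only [gradDensity_succ]
      exact ((ih n n.lt_succ_self).multiplier _).add
        (sum fun i hi => (hp.potential _).mul (ih i (Finset.mem_range.1 hi)))

end MeasurableCoeff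

section EnergyRate

variable {s : ℝ}

theorem measurable_fc_apply (n : ℤ) : Measurable fun u : Sobolev s => fc u n :=
  (continuous_fc_apply n).measurable

theorem measurable_fc : Measurable (fc : Sobolev s → ℤ → ℂ) :=
  measurable_pi_iff.2 measurable_fc_apply

theorem measurableCoeff_trunc (N : ℕ) : MeasurableCoeff (trunc N : Sobolev s → TrigPoly) := by
  refine ⟨⟨Finset.Icc (-(N : ℤ)) N, fun u n hn => ?_⟩, fun n => ?_⟩
  · by_contra h
    rw [Finset.mem_Icc, ← abs_le] at h
    refine Finsupp.mem_support_iff.1 hn ?_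
    rw [trunc_coeff, if_neg h]
  · simp only [trunc_coeff]
    split_ifs
    · exact measurable_fc_apply n
    · exact measurable_const

theorem energyRate_eq (N k : ℕ) (u : Sobolev s) : energyRate N k u =
    16 * Real.pi * ((gradDensity ((1 / 2 : ℂ) • trunc N u) (k + 1) *
      highPart N (dx (((1 / 2 : ℂ) • trunc N u) * ((1 / 2 : ℂ) • trunc N u)))).coeff 0).re := by
  rw [energyRate, (hasDerivAt_energy_truncatedFlow (exists_isTruncatedSolution N u) k).deriv,
    ← Complex.re_ofReal_mul]
  push_cast
  rfl

theorem measurable_energyRate (N k : ℕ) :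
    Measurable fun u : Sobolev s => energyRate N k u := by
  have hv : MeasurableCoeff fun u : Sobolev s => (1 / 2 : ℂ) • trunc N u :=
    (measurableCoeff_trunc N).smul _
  have hw := (hv.mul hv).multiplier fun n => I * n
  have hh : MeasurableCoeff fun u : Sobolev s =>
      highPart N (dx (((1 / 2 : ℂ) • trunc N u) * ((1 / 2 : ℂ) • trunc N u))) := by
    refine ⟨?_, fun n => ?_⟩
    · obtain ⟨S, hS⟩ := hw.1
      refine ⟨S, fun u n hn => hS u ?_⟩
      rw [Finsupp.mem_support_iff, highPart_coeff] at hn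
      refine Finsupp.mem_support_iff.2 fun h0 => hn ?_
      have h0' : (dx (((1 / 2 : ℂ) • trunc N u) * ((1 / 2 : ℂ) • trunc N u))).coeff n = 0 := h0
      rw [h0', ite_self]
    · simp only [highPart_coeff]
      split_ifs
      · exact measurable_const
      · exact hw.2 n
  simp only [energyRate_eq]
  exact (Complex.measurable_re.comp (((hv.gradDensity (k + 1)).mul hh).2 0)).const_mul _

theorem differentiableAt_energy (N k : ℕ) (u : Sobolev s) :
    DifferentiableAt ℝ (fun t => energy k (trunc N (truncatedFlow N t u))) 0 :=
  (hasDerivAt_energy_truncatedFlow (exists_isTruncatedSolution N u) k).differentiableAt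

/-- The deterministic estimate of the energy rates, for functions with
`|û(n)| ≤ M (1 + |n|)^{-σ}`. -/
theorem abs_energyRate_le {σ : ℝ} (hσ : 11 / 4 < σ) (k : ℕ) : ∃ C : ℝ, 0 ≤ C ∧
    ∀ (N : ℕ) (u : Sobolev s) (M : ℝ), (∀ n, ‖fc u n‖ ≤ M * decay σ n) →
      |energyRate N k u| ≤ C * (1 + M) ^ (k + 3) * (N + 1 : ℝ) ^ ((k : ℝ) - 1 - 2 * σ) := by
  obtain ⟨C, hC, h⟩ := abs_re_pairing_le hσ k
  refine ⟨16 * Real.pi * C, by positivity, fun N u M hM => ?_⟩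
  have hM0 : 0 ≤ M :=
    nonneg_of_mul_nonneg_left ((norm_nonneg _).trans (hM 0)) (decay_pos σ 0)
  have hv (n : ℤ) : ((1 / 2 : ℂ) • trunc N u).coeff n =
      (1 / 2 : ℂ) * if |n| ≤ (N : ℤ) then fc u n else 0 := by
    rw [AddMonoidAlgebra.coeff_smul_apply, smul_eq_mul, trunc_coeff]
  let D : Datum σ :=
    { N := N
      M := M
      v := (1 / 2 : ℂ) • trunc N u
      M_nonneg := hM0
      conj_coeff := fun n => by
        rw [hv, hv, abs_neg, fc_neg, map_mul, map_div₀, map_one, map_ofNat, apply_ite conj,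
          map_zero]
      coeff_eq_zero := fun n hn => by
        rw [hv, if_neg (not_le.2 hn), mul_zero]
      norm_coeff_le := fun n => by
        have h0 : 0 ≤ M * decay σ n := mul_nonneg hM0 (decay_pos σ n).le
        rw [hv, norm_mul]
        split_ifs
        · have := hM n
          have h1 : ‖(1 / 2 : ℂ)‖ = 1 / 2 := by norm_num
          rw [h1]
          linarith
        · simpa using h0 }
  have := h D
  rw [energyRate_eq, abs_mul, abs_of_nonneg (by positivity : 0 ≤ 16 * Real.pi)]
  calc _ ≤ 16 * Real.pi * (C * (1 + M) ^ (k + 3) * (N + 1 : ℝ) ^ ((k : ℝ) - 1 - 2 * σ)) :=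
        mul_le_mul_of_nonneg_left this (by positivity)
    _ = _ := by ring

end EnergyRate

/-! ### The Sobolev spaces are Polish spaces -/

theorem separableSpace_lp : TopologicalSpace.SeparableSpace (lp (fun _ : ℤ => ℂ) 2) := by
  let e (n : ℤ) : lp (fun _ : ℤ => ℂ) 2 := lp.single 2 n (1 : ℂ)
  have h : TopologicalSpace.IsSeparable (Submodule.span ℂ (Set.range e) :
      Set (lp (fun _ : ℤ => ℂ) 2)) :=
    (Set.countable_range e).isSeparable.span
  have hd : closure (Submodule.span ℂ (Set.range e) : Set (lp (fun _ : ℤ => ℂ) 2)) = Set.univ := by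
    refine Set.eq_univ_of_forall fun f => ?_
    have hf := lp.hasSum_single (E := fun _ : ℤ => ℂ) (p := 2) (by norm_num) f
    refine mem_closure_of_tendsto hf (Filter.Eventually.of_forall fun J => ?_)
    refine Submodule.sum_mem _ fun n _ => ?_
    have hn : lp.single 2 n (f n) = (f n) • e n := by
      rw [← lp.single_smul, smul_eq_mul, mul_one]
    rw [hn]
    exact Submodule.smul_mem _ _ (Submodule.subset_span (Set.mem_range_self n))
  have h2 := h.closure
  rw [hd] at h2
  exact TopologicalSpace.isSeparable_univ_iff.1 h2

theorem isClosed_range_toLp (s : ℝ) : IsClosed (Set.range (Sobolev.toLp s)) := by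
  have hc (n : ℤ) : Continuous fun f : lp (fun _ : ℤ => ℂ) 2 => f n :=
    (continuous_apply n).comp lp.uniformContinuous_coe.continuous
  have h : Set.range (Sobolev.toLp s) =
      {f | f 0 = 0} ∩ ⋂ n : ℤ, {f : lp (fun _ : ℤ => ℂ) 2 | f (-n) = conj (f n)} := by
    ext f
    simp only [Set.mem_range, Set.mem_inter_iff, Set.mem_ofPred_eq, Set.mem_iInter]
    constructor
    · rintro ⟨u, rfl⟩
      refine ⟨?_, fun n => ?_⟩
      · rw [Sobolev.toLp_apply, fc_zero_freq, smul_zero]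
      · rw [Sobolev.toLp_apply, Sobolev.toLp_apply, fc_neg, Int.cast_neg, neg_sq,
          Complex.real_smul, Complex.real_smul, map_mul, Complex.conj_ofReal]
    · rintro ⟨h0, hneg⟩
      have hw (n : ℤ) : (1 + (n : ℝ) ^ 2) ^ (s / 2) • (((1 + (n : ℝ) ^ 2) ^ (s / 2))⁻¹ • f n) =
          f n := smul_inv_smul₀ (Sobolev.weight_pos s n).ne' _
      refine ⟨(⟨fun n => ((1 + (n : ℝ) ^ 2) ^ (s / 2))⁻¹ • f n, ?_, fun n => ?_, ?_⟩ :
        sobolevSubmodule s), ?_⟩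
      · simp only [h0, smul_zero]
      · change ((1 + ((-n : ℤ) : ℝ) ^ 2) ^ (s / 2))⁻¹ • f (-n) =
          conj (((1 + (n : ℝ) ^ 2) ^ (s / 2))⁻¹ • f n)
        rw [hneg, Int.cast_neg, neg_sq, Complex.real_smul, Complex.real_smul, map_mul,
          Complex.conj_ofReal]
      · simp only [hw]
        exact lp.memℓp f
      · refine lp.ext (funext fun n => ?_)
        exact hw n
  rw [h]
  exact (isClosed_eq (hc 0) continuous_const).inter (isClosed_iInter fun n =>
    isClosed_eq (hc (-n)) (Complex.continuous_conj.comp (hc n)))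

theorem polishSpace_sobolev (s : ℝ) : PolishSpace (Sobolev s) := by
  have := separableSpace_lp
  have : PolishSpace (lp (fun _ : ℤ => ℂ) 2) := by
    have := UniformSpace.secondCountable_of_separable (lp (fun _ : ℤ => ℂ) 2)
    infer_instance
  exact Topology.IsClosedEmbedding.polishSpace
    ⟨(Sobolev.isometry_toLp s).isEmbedding, isClosed_range_toLp s⟩

/-- By the Lusin-Souslin theorem, the Borel `σ`-algebra of `Hˢ` is that of the Fourier
coefficients. -/
theorem measurableEmbedding_fc (s : ℝ) : MeasurableEmbedding (fc : Sobolev s → ℤ → ℂ) := by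
  have := polishSpace_sobolev s
  exact (continuous_pi continuous_fc_apply).measurableEmbedding fc_injective

/-! ### Moments of the gaussian measures -/

theorem measurable_randomCoeff (c : ℝ) (k : ℕ) : Measurable (randomCoeff c k) := by
  refine measurable_pi_iff.2 fun n => ?_
  simp only [randomCoeff]
  split_ifs
  · exact measurable_const
  · fun_prop

theorem randomCoeff_neg (c : ℝ) (k : ℕ) (ω : ℕ → ℝ × ℝ) (n : ℤ) :
    randomCoeff c k ω (-n) = conj (randomCoeff c k ω n) := by
  rw [randomCoeff, randomCoeff]
  split_ifs with h1 h2 h2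
  · simp
  · omega
  · omega
  · rw [Int.natAbs_neg, Int.cast_neg, abs_neg, Int.sign_neg, map_div₀, map_mul, map_add, map_mul,
      map_mul, Complex.conj_ofReal, Complex.conj_ofReal, Complex.conj_ofReal, Complex.conj_ofReal,
      map_intCast, Complex.conj_I]
    push_cast
    ring

theorem norm_randomCoeff_le (c : ℝ) (m : ℕ) (ω : ℕ → ℝ × ℝ) (n : ℤ) :
    ‖randomCoeff c (2 * (m + 1)) ω n‖ ≤
      2 ^ (m + 1) * |c| * (|(ω n.natAbs).1| + |(ω n.natAbs).2|) * decay (m + 1) n := by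
  have hd := (decay_pos (m + 1) n).le
  rw [randomCoeff]
  split_ifs with hn
  · rw [norm_zero]
    positivity
  · have hn1 : (1 : ℝ) ≤ |(n : ℝ)| := by exact_mod_cast Int.one_le_abs hn
    have e : ((2 * (m + 1) : ℕ) : ℝ) / 2 = ((m + 1 : ℕ) : ℝ) := by
      push_cast
      ring
    have hnum : ‖(c : ℂ) * ((ω n.natAbs).1 + n.sign * I * (ω n.natAbs).2)‖ ≤
        |c| * (|(ω n.natAbs).1| + |(ω n.natAbs).2|) := by
      rw [norm_mul, Complex.norm_real, Real.norm_eq_abs]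
      refine mul_le_mul_of_nonneg_left ((norm_add_le _ _).trans ?_) (abs_nonneg c)
      have hs : ‖((n.sign : ℤ) : ℂ)‖ = 1 := by
        rcases lt_or_gt_of_ne hn with h | h
        · simp [Int.sign_eq_neg_one_of_neg h]
        · simp [Int.sign_eq_one_of_pos h]
      rw [norm_mul, norm_mul, Complex.norm_I, Complex.norm_real, Complex.norm_real, hs,
        Real.norm_eq_abs, Real.norm_eq_abs, one_mul, one_mul]
    rw [norm_div, Complex.norm_real, Real.norm_of_nonneg (by positivity), e, Real.rpow_natCast,
      decay, Real.rpow_neg (by positivity), show (m : ℝ) + 1 = ((m + 1 : ℕ) : ℝ) by push_cast; rfl,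
      Real.rpow_natCast, div_le_iff₀ (by positivity)]
    refine hnum.trans ?_
    have h2 : (1 + |(n : ℝ)|) ^ (m + 1) ≤ 2 ^ (m + 1) * |(n : ℝ)| ^ (m + 1) := by
      rw [← mul_pow]
      exact pow_le_pow_left₀ (by positivity) (by linarith) _
    have h3 : 1 ≤ 2 ^ (m + 1) * ((1 + |(n : ℝ)|) ^ (m + 1))⁻¹ * |(n : ℝ)| ^ (m + 1) := by
      rw [mul_right_comm, ← div_eq_mul_inv, one_le_div (by positivity)]
      exact h2
    calc _ ≤ |c| * (|(ω n.natAbs).1| + |(ω n.natAbs).2|) *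
          (2 ^ (m + 1) * ((1 + |(n : ℝ)|) ^ (m + 1))⁻¹ * |(n : ℝ)| ^ (m + 1)) :=
        le_mul_of_one_le_right (by positivity) h3
      _ = _ := by ring

instance : IsProbabilityMeasure gaussianSpace := by
  unfold gaussianSpace
  infer_instance

theorem lintegral_gaussian_lt_top (r : ℕ) :
    ∫⁻ p : ℝ × ℝ, ENNReal.ofReal ((|p.1| + |p.2|) ^ r)
      ∂(gaussianReal 0 1).prod (gaussianReal 0 1) < ∞ := by
  have h1 : MemLp (fun p : ℝ × ℝ => |p.1|) r ((gaussianReal 0 1).prod (gaussianReal 0 1)) :=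
    ((memLp_id_gaussianReal' r (ENNReal.natCast_ne_top r)).comp_fst _).norm
  have h2 : MemLp (fun p : ℝ × ℝ => |p.2|) r ((gaussianReal 0 1).prod (gaussianReal 0 1)) :=
    ((memLp_id_gaussianReal' r (ENNReal.natCast_ne_top r)).comp_snd _).norm
  have h3 := (h1.add h2).integrable_norm_pow'
  refine lt_of_le_of_lt (lintegral_mono fun p => ?_) h3.lintegral_lt_top
  refine ENNReal.ofReal_le_ofReal (le_of_eq ?_)
  rw [Pi.add_apply, Real.norm_of_nonneg (by positivity)]

/-- The `r`-th power of the norm of `a` in a weighted `ℓʳ` space. -/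
def weightedSum (σ : ℝ) (r : ℕ) (a : ℤ → ℂ) : ℝ≥0∞ :=
  ∑' n : ℤ, ENNReal.ofReal (((decay σ n)⁻¹ * ‖a n‖) ^ r)

theorem measurable_weightedSum (σ : ℝ) (r : ℕ) : Measurable (weightedSum σ r) := by
  unfold weightedSum
  refine Measurable.tsum fun n => ?_
  fun_prop

theorem lintegral_weightedSum_lt_top (c : ℝ) (m : ℕ) {σ : ℝ} {r : ℕ}
    (h : 1 < ((m : ℝ) + 1 - σ) * r) :
    ∫⁻ ω, weightedSum σ r (randomCoeff c (2 * (m + 1)) ω) ∂gaussianSpace < ∞ := by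
  have hmeas : Measurable fun p : ℝ × ℝ => ENNReal.ofReal ((|p.1| + |p.2|) ^ r) := by fun_prop
  have hterm (n : ℤ) : ∫⁻ ω, ENNReal.ofReal
      (((decay σ n)⁻¹ * ‖randomCoeff c (2 * (m + 1)) ω n‖) ^ r) ∂gaussianSpace ≤
      ENNReal.ofReal (decay (((m : ℝ) + 1 - σ) * r) n) *
        (ENNReal.ofReal ((2 ^ (m + 1) * |c|) ^ r) *
        ∫⁻ p : ℝ × ℝ, ENNReal.ofReal ((|p.1| + |p.2|) ^ r)
          ∂(gaussianReal 0 1).prod (gaussianReal 0 1)) := by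
    have hmap : (gaussianSpace.map fun ω => ω n.natAbs) =
        (gaussianReal 0 1).prod (gaussianReal 0 1) := Measure.infinitePi_map_eval _ _
    rw [← hmap, lintegral_map hmeas (by fun_prop), ← lintegral_const_mul _ (by fun_prop),
      ← lintegral_const_mul _ (by fun_prop)]
    refine lintegral_mono fun ω => ?_
    rw [← ENNReal.ofReal_mul (by positivity), ← ENNReal.ofReal_mul (decay_pos _ _).le]
    refine ENNReal.ofReal_le_ofReal ?_
    have hd : decay (((m : ℝ) + 1 - σ) * r) n = ((decay σ n)⁻¹ * decay (m + 1) n) ^ r := by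
      have h1 : 0 < 1 + |(n : ℝ)| := by positivity
      rw [decay, decay, decay, ← Real.rpow_neg h1.le, ← Real.rpow_add h1, ← Real.rpow_mul_natCast h1.le]
      congr 1
      ring
    rw [hd, ← mul_pow, ← mul_pow]
    have hpos := inv_nonneg.2 (decay_pos σ n).le
    refine pow_le_pow_left₀ (by positivity) ?_ r
    calc _ ≤ (decay σ n)⁻¹ * _ := mul_le_mul_of_nonneg_left (norm_randomCoeff_le c m ω n) hpos
      _ = _ := by ring
  simp only [weightedSum]
  rw [lintegral_tsum fun n => ?_]
  · refine lt_of_le_of_lt (ENNReal.tsum_le_tsum hterm) ?_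
    rw [ENNReal.tsum_mul_right]
    refine ENNReal.mul_lt_top ?_ (ENNReal.mul_lt_top ENNReal.ofReal_lt_top
      (lintegral_gaussian_lt_top r))
    exact (summable_decay h).tsum_ofReal_lt_top
  · have := (measurable_pi_iff.1 (measurable_randomCoeff c (2 * (m + 1)))) n
    exact Measurable.aemeasurable (by fun_prop)

theorem summable_of_weightedSum_ne_top {σ : ℝ} {r : ℕ} {a : ℤ → ℂ} (h : weightedSum σ r a ≠ ∞) :
    Summable fun n : ℤ => ((decay σ n)⁻¹ * ‖a n‖) ^ r := by
  have h1 := ENNReal.summable_toReal h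
  refine h1.congr fun n => ?_
  have := inv_nonneg.2 (decay_pos σ n).le
  exact ENNReal.toReal_ofReal (by positivity)

theorem ae_randomCoeff_mem_range (c : ℝ) (m : ℕ) {s : ℝ} (hs : s < (m : ℝ) + 1 / 2) :
    ∀ᵐ ω ∂gaussianSpace, randomCoeff c (2 * (m + 1)) ω ∈ Set.range (fc : Sobolev s → ℤ → ℂ) := by
  have h := lintegral_weightedSum_lt_top c m (σ := s) (r := 2) (by push_cast; linarith)
  have hm := (measurable_weightedSum s 2).comp (measurable_randomCoeff c (2 * (m + 1)))
  filter_upwards [ae_lt_top hm h.ne] with ω hω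
  have hsum := summable_of_weightedSum_ne_top hω.ne
  refine ⟨(⟨randomCoeff c (2 * (m + 1)) ω, ?_, randomCoeff_neg _ _ _, ?_⟩ :
    sobolevSubmodule s), rfl⟩
  · rw [randomCoeff, if_pos rfl]
  · refine (memℓp_gen_iff (p := 2) (by norm_num)).2 ?_
    simp only [ENNReal.toReal_ofNat, Real.rpow_ofNat]
    refine (hsum.mul_left (2 ^ |s|)).of_nonneg_of_le (fun n => by positivity) fun n => ?_
    have h1 : (0 : ℝ) < 1 + (n : ℝ) ^ 2 := by positivity
    have h2 : 0 < 1 + |(n : ℝ)| := by positivity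
    rw [norm_smul, mul_pow, mul_pow, ← mul_assoc, Real.norm_of_nonneg (by positivity)]
    refine mul_le_mul_of_nonneg_right ?_ (by positivity)
    rw [decay, ← Real.rpow_neg h2.le, neg_neg, ← Real.rpow_mul_natCast h1.le,
      ← Real.rpow_mul_natCast h2.le]
    have e : s / 2 * ((2 : ℕ) : ℝ) = s := by push_cast; ring
    rw [e, mul_comm s, Real.rpow_mul h2.le, Real.rpow_natCast]
    have habs : |(n : ℝ)| ^ 2 = (n : ℝ) ^ 2 := sq_abs _
    rcases le_total 0 s with h0 | h0
    · rw [abs_of_nonneg h0, ← Real.mul_rpow (by norm_num) (by positivity)]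
      refine Real.rpow_le_rpow h1.le ?_ h0
      nlinarith [abs_nonneg (n : ℝ)]
    · rw [abs_of_nonpos h0, Real.rpow_neg (by norm_num), ← Real.inv_rpow (by norm_num),
        ← Real.mul_rpow (by norm_num) (by positivity)]
      refine Real.rpow_le_rpow_of_nonpos (by positivity) ?_ h0
      nlinarith [sq_nonneg (|(n : ℝ)| - 1)]

theorem isProbabilityMeasure_gaussianMeasure (c : ℝ) (m : ℕ) {s : ℝ} (hs : s < (m : ℝ) + 1 / 2) :
    IsProbabilityMeasure (gaussianMeasure c (2 * (m + 1)) s) := by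
  have hr := measurable_randomCoeff c (2 * (m + 1))
  have := Measure.isProbabilityMeasure_map (μ := gaussianSpace) hr.aemeasurable
  refine (measurableEmbedding_fc s).isProbabilityMeasure_comap ?_
  exact (ae_map_iff hr.aemeasurable (measurableEmbedding_fc s).measurableSet_range).2
    (ae_randomCoeff_mem_range c m hs)

theorem lintegral_gaussianMeasure_le (c : ℝ) (k : ℕ) (s : ℝ) {f : (ℤ → ℂ) → ℝ≥0∞}
    (hf : Measurable f) : ∫⁻ u, f (fc u) ∂gaussianMeasure c k s ≤
      ∫⁻ ω, f (randomCoeff c k ω) ∂gaussianSpace := by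
  rw [← lintegral_map hf measurable_fc, gaussianMeasure, (measurableEmbedding_fc s).map_comap,
    ← lintegral_map hf (measurable_randomCoeff c k)]
  exact lintegral_mono' Measure.restrict_le_self le_rfl

/-- Almost surely, `|û(n)| ≤ M (1 + |n|)^{-σ}` with a constant `M` that has all moments, provided
that `σ < m + 1`. -/
theorem exists_norm_fc_le (c : ℝ) (m : ℕ) {s σ : ℝ} (hs : s < (m : ℝ) + 1 / 2)
    (hσ : σ < (m : ℝ) + 1) {p : ℝ≥0∞} (hp : p ≠ ∞) : ∃ M : Sobolev s → ℝ, (∀ u, 0 ≤ M u) ∧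
      MemLp M p (gaussianMeasure c (2 * (m + 1)) s) ∧
      ∀ᵐ u ∂gaussianMeasure c (2 * (m + 1)) s, ∀ n, ‖fc u n‖ ≤ M u * decay σ n := by
  have := isProbabilityMeasure_gaussianMeasure c m hs
  obtain ⟨r, hr⟩ := exists_nat_gt (max p.toReal (1 / ((m : ℝ) + 1 - σ)))
  have hσ' : 0 < (m : ℝ) + 1 - σ := by linarith
  have hr0 : (0 : ℝ) < r := (ENNReal.toReal_nonneg.trans (le_max_left _ _)).trans_lt hr
  have hr1 : r ≠ 0 := by
    rintro rfl
    simp at hr0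
  have h : 1 < ((m : ℝ) + 1 - σ) * r := by
    rw [mul_comm, ← div_lt_iff₀ hσ']
    exact (le_max_right _ _).trans_lt hr
  have hpr : p ≤ r := by
    rw [← ENNReal.ofReal_toReal hp, ← ENNReal.ofReal_natCast]
    exact ENNReal.ofReal_le_ofReal ((le_max_left _ _).trans hr.le)
  have hmeas : Measurable fun u : Sobolev s => weightedSum σ r (fc u) :=
    (measurable_weightedSum σ r).comp measurable_fc
  have hint : ∫⁻ u : Sobolev s, weightedSum σ r (fc u) ∂gaussianMeasure c (2 * (m + 1)) s < ∞ :=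
    (lintegral_gaussianMeasure_le _ _ _ (measurable_weightedSum σ r)).trans_lt
      (lintegral_weightedSum_lt_top c m h)
  refine ⟨fun u => (weightedSum σ r (fc u)).toReal ^ (r : ℝ)⁻¹, fun u => by positivity,
    MemLp.mono_exponent ⟨(hmeas.ennreal_toReal.pow_const _).aestronglyMeasurable, ?_⟩ hpr, ?_⟩
  · rw [eLpNorm_lt_top_iff_lintegral_rpow_enorm_lt_top (by exact_mod_cast hr1)
      (ENNReal.natCast_ne_top r)]
    refine (lintegral_mono fun u => ?_).trans_lt hint
    rw [Real.enorm_of_nonneg (by positivity), ENNReal.toReal_natCast,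
      ENNReal.ofReal_rpow_of_nonneg (by positivity) hr0.le, Real.rpow_inv_rpow (by positivity) hr0.ne']
    exact ENNReal.ofReal_toReal_le
  · filter_upwards [ae_lt_top hmeas hint.ne] with u hu n
    have hd := decay_pos σ n
    have hpos : 0 ≤ (decay σ n)⁻¹ * ‖fc u n‖ := mul_nonneg (inv_nonneg.2 hd.le) (norm_nonneg _)
    have h1 : ((decay σ n)⁻¹ * ‖fc u n‖) ^ r ≤ (weightedSum σ r (fc u)).toReal := by
      refine (ENNReal.ofReal_le_iff_le_toReal hu.ne).1 ?_
      exact ENNReal.le_tsum (f := fun n : ℤ => ENNReal.ofReal (((decay σ n)⁻¹ * ‖fc u n‖) ^ r)) n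
    have h2 := Real.rpow_le_rpow (by positivity) h1 (inv_nonneg.2 hr0.le)
    rw [Real.pow_rpow_inv_natCast hpos hr1] at h2
    rwa [inv_mul_le_iff₀ hd, mul_comm] at h2

/-! ### Convergence of the energy rates -/

theorem memLp_pow {Ω : Type*} [MeasurableSpace Ω] {μ : Measure Ω} {f : Ω → ℝ} {q : ℝ≥0∞} {d : ℕ}
    (hd : d ≠ 0) (hf0 : ∀ ω, 0 ≤ f ω) (hf : MemLp f (d * q) μ) : MemLp (fun ω => f ω ^ d) q μ := by
  have h := hf.norm_rpow_div d
  have e : (d : ℝ≥0∞) * q / d = q := by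
    rw [mul_comm]
    exact ENNReal.mul_div_cancel_right (by exact_mod_cast hd) (ENNReal.natCast_ne_top d)
  rw [e] at h
  refine h.congr_norm ?_ ?_
  · exact (hf.aestronglyMeasurable.pow d)
  · refine Filter.Eventually.of_forall fun ω => ?_
    rw [ENNReal.toReal_natCast, Real.rpow_natCast, Real.norm_of_nonneg (hf0 ω)]

/-- The energy rates are dominated by `(N + 1)^{-3/4} Y`, with `Y` in `L^q`. The Fourier coefficients
have the decay `σ = m + 1 - 1/8`, for which `k - 1 - 2σ ≤ -3/4` and `σ > 11/4` if `m ≥ 2`. -/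
theorem exists_energyRate_le {m : ℕ} (hm : 2 ≤ m) {q : ℝ≥0∞} (hq : q ≠ ∞) (c : ℝ) {s : ℝ}
    (hs : s < (m : ℝ) + 1 / 2) {k : ℕ} (hk : k ≤ 2 * m + 2) :
    ∃ Y : Sobolev s → ℝ, MemLp Y q (gaussianMeasure c (2 * (m + 1)) s) ∧
      ∀ N : ℕ, ∀ᵐ u ∂gaussianMeasure c (2 * (m + 1)) s,
        ‖energyRate N k u‖ ≤ (N + 1 : ℝ) ^ (-(3 / 4) : ℝ) * ‖Y u‖ := by
  have := isProbabilityMeasure_gaussianMeasure c m hs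
  have hm' : (2 : ℝ) ≤ m := by exact_mod_cast hm
  have hk' : (k : ℝ) ≤ 2 * m + 2 := by exact_mod_cast hk
  obtain ⟨C, hC, hrate⟩ := abs_energyRate_le (s := s) (σ := m + 1 - 1 / 8) (by linarith) k
  obtain ⟨M, hM0, hM, hfc⟩ := exists_norm_fc_le c m hs (σ := m + 1 - 1 / 8) (by linarith)
    (p := ((k + 3 : ℕ) : ℝ≥0∞) * q) (ENNReal.mul_ne_top (ENNReal.natCast_ne_top _) hq)
  refine ⟨fun u => C * (1 + M u) ^ (k + 3), ?_, fun N => ?_⟩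
  · have h1 : MemLp (fun u => 1 + M u) (((k + 3 : ℕ) : ℝ≥0∞) * q)
        (gaussianMeasure c (2 * (m + 1)) s) := (memLp_const (1 : ℝ)).add hM
    have h2 : MemLp (fun u => (1 + M u) ^ (k + 3)) q (gaussianMeasure c (2 * (m + 1)) s) :=
      memLp_pow (Nat.succ_ne_zero _) (fun u => add_nonneg zero_le_one (hM0 u)) h1
    exact h2.const_mul C
  · filter_upwards [hfc] with u hu
    have h0 : 0 ≤ C * (1 + M u) ^ (k + 3) := by
      have := hM0 u
      positivity
    rw [Real.norm_of_nonneg h0, Real.norm_eq_abs, mul_comm]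
    refine (hrate N u (M u) hu).trans (mul_le_mul_of_nonneg_left ?_ h0)
    refine Real.rpow_le_rpow_of_exponent_le ?_ (by linarith)
    have : (0 : ℝ) ≤ N := N.cast_nonneg
    linarith

theorem memLp_energyRate {m : ℕ} (hm : 2 ≤ m) {q : ℝ≥0∞} (hq : q ≠ ∞) (c : ℝ) {s : ℝ}
    (hs : s < (m : ℝ) + 1 / 2) (N : ℕ) {k : ℕ} (hk : k ≤ 2 * m + 2) :
    MemLp (fun u : Sobolev s => energyRate N k u) q (gaussianMeasure c (2 * (m + 1)) s) := by
  obtain ⟨Y, hY, h⟩ := exists_energyRate_le hm hq c hs hk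
  exact hY.of_le_mul (measurable_energyRate N k).aestronglyMeasurable (h N)

theorem tendsto_eLpNorm_energyRate {m : ℕ} (hm : 2 ≤ m) {q : ℝ≥0∞} (hq : q ≠ ∞) (c : ℝ) {s : ℝ}
    (hs : s < (m : ℝ) + 1 / 2) {k : ℕ} (hk : k ≤ 2 * m + 2) :
    Tendsto (fun N : ℕ => eLpNorm (fun u : Sobolev s => energyRate N k u) q
      (gaussianMeasure c (2 * (m + 1)) s)) atTop (𝓝 0) := by
  obtain ⟨Y, hY, h⟩ := exists_energyRate_le hm hq c hs hk
  have h1 : Tendsto (fun N : ℕ => (N + 1 : ℝ) ^ (-(3 / 4) : ℝ)) atTop (𝓝 0) :=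
    (tendsto_rpow_neg_atTop (by norm_num)).comp
      (tendsto_atTop_add_const_right _ 1 tendsto_natCast_atTop_atTop)
  have h2 := ENNReal.Tendsto.mul_const (b := eLpNorm Y q (gaussianMeasure c (2 * (m + 1)) s))
    (ENNReal.tendsto_ofReal h1) (Or.inr hY.2.ne)
  rw [ENNReal.ofReal_zero, zero_mul] at h2
  exact tendsto_of_tendsto_of_tendsto_of_le_of_le tendsto_const_nhds h2 (fun _ => zero_le)
    fun N => eLpNorm_le_mul_eLpNorm_of_ae_le_mul (h N) q

end BenjaminOno

end

theorem proposition3p1 (m : ℕ) (hm : 2 ≤ m) (q : ℝ≥0∞) (hq : 1 ≤ q) (hq' : q ≠ ∞)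
    (c : ℝ) (s : ℝ) (hs : s < (m : ℝ) + 1 / 2) :
    (∀ (N : ℕ) (u₀ : BenjaminOno.Sobolev s),
      ∃! u : ℝ → BenjaminOno.Sobolev s, BenjaminOno.IsTruncatedSolution N u₀ u) ∧
    IsProbabilityMeasure (BenjaminOno.gaussianMeasure c (2 * (m + 1)) s) ∧
    (∀ N k : ℕ, k ≤ 2 * m + 2 →
      (∀ u : BenjaminOno.Sobolev s, DifferentiableAt ℝ
        (fun t => BenjaminOno.energy k
          (BenjaminOno.trunc N (BenjaminOno.truncatedFlow N t u))) 0) ∧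
      MemLp (fun u : BenjaminOno.Sobolev s => BenjaminOno.energyRate N k u) q
        (BenjaminOno.gaussianMeasure c (2 * (m + 1)) s)) ∧
    Tendsto (fun N : ℕ =>
      eLpNorm (fun u : BenjaminOno.Sobolev s => BenjaminOno.energyRate N (2 * m + 2) u) q
        (BenjaminOno.gaussianMeasure c (2 * (m + 1)) s) +
      eLpNorm (fun u : BenjaminOno.Sobolev s => BenjaminOno.energyRate N (2 * m + 1) u) q
        (BenjaminOno.gaussianMeasure c (2 * (m + 1)) s) +
      ∑ j ∈ Finset.range (2 * m + 1),
        eLpNorm (fun u : BenjaminOno.Sobolev s => BenjaminOno.energyRate N j u) q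
          (BenjaminOno.gaussianMeasure c (2 * (m + 1)) s))
      atTop (𝓝 0) := by
  refine ⟨fun N u₀ => ?_, BenjaminOno.isProbabilityMeasure_gaussianMeasure c m hs,
    fun N k hk => ⟨BenjaminOno.differentiableAt_energy N k,
      BenjaminOno.memLp_energyRate hm hq' c hs N hk⟩, ?_⟩
  · obtain ⟨u, hu⟩ := BenjaminOno.exists_isTruncatedSolution N u₀
    exact ⟨u, hu, fun w hw => hw.unique hu⟩
  · have h := ((BenjaminOno.tendsto_eLpNorm_energyRate hm hq' c hs (k := 2 * m + 2) le_rfl).add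
      (BenjaminOno.tendsto_eLpNorm_energyRate hm hq' c hs (k := 2 * m + 1) (by omega))).add
      (tendsto_finsetSum (Finset.range (2 * m + 1)) fun j hj =>
        BenjaminOno.tendsto_eLpNorm_energyRate hm hq' c hs (k := j)
          (by have := Finset.mem_range.1 hj; omega))
    simpa using h
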